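/- Let $\mathcal U$ be an open neighborhood of the origin in $\mathbb C^2$, let $\mathcal O$ be the ring of germs at $\mathbf 0$ of complex analytic functions, and let $f = g^p h$ on $\mathcal U$, where $g,h:\mathcal U\to\mathbb C$ are complex analytic, $g(\mathbf 0)=0$, the germ of $g$ at $\mathbf 0$ is irreducible in $\mathcal O$ and does not divide the germ of $h$, and $p>1$ is an integer. *Notation.* $V(g,h)_{\mathbf 0}=\dim_{\mathbb C}\mathcal O/(g,h)$ is the intersection number, $\mu_{\mathbf 0}(\cdot)$ is the Milnor number (the colength in the local ring at $\mathbf 0$ of the ideal of first partial derivatives), and $\Sigma f$ is the critical locus of $f$. Linear coordinates $(z_0,z_1)$ on $\mathbb C^2$ are called admissible if $\mathbf 0$ is an isolated critical point of $f_{|_{V(z_0)}}$. For such coordinates, the relative polar curve $\Gamma^1_{f,z_0}$ is the part of the analytic cycle $[V(\partial f/\partial z_1)]$ at $\mathbf 0$ consisting of the components not contained in $\Sigma f$, and the beta invariant is $$\beta_f=\beta_{f,z_0}=\Bigl(\Gamma^1_{f,z_0}\cdot V\bigl(\tfrac{\partial f}{\partial z_0}\bigr)\Bigr)_{\mathbf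 0}-\sum_C\mu^\circ_C\bigl[(C\cdot V(z_0))_{\mathbf 0}-1\bigr],$$ where $C$ runs through the irreducible components of $\Sigma f$ at $\mathbf 0$ (taken reduced) and $\mu^\circ_C$ is the Milnor number at $q$ of the restriction of $f$ to a generic line through a point $q\in C\setminus\{\mathbf 0\}$ close to $\mathbf 0$. Then $\mu_{\mathbf 0}(g)$ and $V(g,h)_{\mathbf 0}$ are finite, admissible coordinates exist, and for every choice of admissible coordinates all the numbers that enter into $\beta_f$ are finite and the following hold. 1. If $h(\mathbf 0)=0$ and $h$ has at most an isolated critical point at $\mathbf 0$ (that is, $\mu_{\mathbf 0}(h)<\infty$), then $$\beta_f=(p+1)\,V(g,h)_{\mathbf 0}+p\,\mu_{\mathbf 0}(g)+\mu_{\mathbf 0}(h)-1 .$$ 2. If $h(\mathbf 0)\neq 0$, then $\beta_f=p\,\mu_{\mathbf 0}(g)$. 3. If $\beta_f=0$, then $\Sigma f$ is smooth at $\mathbf 0$, that is, its germ at $\mathbf 0$ is that of a one-dimensional complex submanifold (here $h$ is not required to have an isolated critical point). -/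

import Mathlib

open Filter Topology

noncomputable section

namespace BetaInvariant

variable (E : Type*) [NormedAddCommGroup E] [NormedSpace ℂ E]

/-- The local ring `𝒪_{E,0}` of germs at the origin of complex analytic functions on `E`. -/
def AnalyticGerm : Subring (Germ (𝓝 (0 : E)) ℂ) where
  carrier := {φ | ∃ F : E → ℂ, AnalyticAt ℂ F 0 ∧ φ = (F : Germ (𝓝 (0 : E)) ℂ)}
  mul_mem' := by
    rintro _ _ ⟨F, hF, rfl⟩ ⟨G, hG, rfl⟩
    exact ⟨F * G, hF.mul hG, rfl⟩
  one_mem' := ⟨1, analyticAt_const, rfl⟩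
  add_mem' := by
    rintro _ _ ⟨F, hF, rfl⟩ ⟨G, hG, rfl⟩
    exact ⟨F + G, hF.add hG, rfl⟩
  zero_mem' := ⟨0, analyticAt_const, rfl⟩
  neg_mem' := by
    rintro _ ⟨F, hF, rfl⟩
    exact ⟨-F, hF.neg, rfl⟩

variable {E}

/-- The germ at the origin of a function that is analytic there. -/
def germ (F : E → ℂ) (hF : AnalyticAt ℂ F 0) : AnalyticGerm E :=
  ⟨(F : Germ (𝓝 (0 : E)) ℂ), F, hF, rfl⟩

/-- The ideal of `𝒪_{E,0}` generated by the germs of the functions in `S`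
(all functions to which this is applied are analytic at the origin). -/
def idealOf (S : Set (E → ℂ)) : Ideal (AnalyticGerm E) :=
  Ideal.span {φ | ∃ F ∈ S, (φ : Germ (𝓝 (0 : E)) ℂ) = (F : Germ (𝓝 (0 : E)) ℂ)}

/-- The length of `𝒪_{E,0} / I`. Since the residue field of `𝒪_{E,0}` is `ℂ`, this is
`dim_ℂ (𝒪_{E,0} / I)`. -/
def colength (I : Ideal (AnalyticGerm E)) : ℕ∞ :=
  Module.length (AnalyticGerm E) (AnalyticGerm E ⧸ I)

/-- The intersection number `V(F, G)₀` of two plane curve germs. -/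
def intersectionNumber (F G : E → ℂ) : ℕ∞ := colength (idealOf {F, G})

/-- The ideal generated by all the first order partial derivatives of `F`. -/
def jacobianIdeal (F : E → ℂ) : Ideal (AnalyticGerm E) :=
  idealOf {G | ∃ v : E, G = fun z => fderiv ℂ F z v}

/-- The Milnor number `μ₀(F)`; it is finite iff the origin is at most an isolated critical
point of `F`. -/
def milnorNumber (F : E → ℂ) : ℕ∞ := colength (jacobianIdeal F)

/-- The critical locus `ΣF`. -/
def criticalLocus (F : E → ℂ) : Set E := {z | fderiv ℂ F z = 0}

/-- The irreducible components at the origin of the analytic set defined by `I`,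
given by their prime ideals. -/
def components (I : Ideal (AnalyticGerm E)) : Set (PrimeSpectrum (AnalyticGerm E)) :=
  {P | P.asIdeal ∈ I.minimalPrimes}

/-- The multiplicity of the component `V(P)` in the analytic cycle `[V(I)]`. -/
def cycleMultiplicity (I : Ideal (AnalyticGerm E)) (P : PrimeSpectrum (AnalyticGerm E)) : ℕ∞ :=
  Module.length (Localization.AtPrime P.asIdeal)
    (Localization.AtPrime P.asIdeal ⧸
      I.map (algebraMap (AnalyticGerm E) (Localization.AtPrime P.asIdeal)))

/-- The intersection number `(C · V(u))₀` of the reduced irreducible curve germ `C = V(P)`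
with `V(u)`. -/
def curveIntersection (P : PrimeSpectrum (AnalyticGerm E)) (u : E → ℂ) : ℕ∞ :=
  colength (P.asIdeal ⊔ idealOf {u})

/-- The Milnor number at `p` of `F` restricted to a generic affine hyperplane through `p`. By upper
semicontinuity of the Milnor number, the generic value is the smallest one. -/
def sliceMilnorNumber (F : E → ℂ) (p : E) : ℕ∞ :=
  ⨅ (H : Submodule ℂ E) (_ : Module.finrank ℂ H + 1 = Module.finrank ℂ E),
    milnorNumber (fun w : H => F (p + w))

/-- The points of `V(P) \ {0}` tending to the origin. -/
def puncturedFilter (P : PrimeSpectrum (AnalyticGerm E)) : Filter E :=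
  𝓝[≠] (0 : E) ⊓ ⨅ (G : E → ℂ) (hG : AnalyticAt ℂ G 0) (_ : germ G hG ∈ P.asIdeal),
    𝓟 {z | G z = 0}

/-- `μ°_C`, for `C = V(P)`: the Milnor number of a generic hyperplane slice of `F` at the
points of `C \ {0}` close to the origin, where it is constant. -/
def nearbyMilnorNumber (F : E → ℂ) (P : PrimeSpectrum (AnalyticGerm E)) : ℕ∞ :=
  liminf (sliceMilnorNumber F) (puncturedFilter P)

section Coordinates

/-! Linear coordinates `(z₀, …, zₙ)` on `E` are given by a basis `b`: `zᵢ` is `b.coord i`, and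
`∂/∂zᵢ` is the derivative in the direction `b i`. -/

variable {n : ℕ} (F : E → ℂ) (b : Module.Basis (Fin (n + 1)) ℂ E)

/-- `∂F/∂zᵢ`. -/
def partialDeriv (i : Fin (n + 1)) : E → ℂ := fun z => fderiv ℂ F z (b i)

/-- `dim₀ Σ(F|_{V(z₀)}) = 0`: the origin is an isolated critical point of `F|_{V(z₀)}`. -/
def IsAdmissible : Prop :=
  ∀ᶠ w in 𝓝 (0 : LinearMap.ker (b.coord 0)),
    w ∈ criticalLocus (fun w : LinearMap.ker (b.coord 0) => F w) ↔ w = 0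

/-- The ideal `⟨∂F/∂z₁, …, ∂F/∂zₙ⟩`. -/
def polarIdeal : Ideal (AnalyticGerm E) :=
  idealOf {G | ∃ i : Fin (n + 1), i ≠ 0 ∧ G = partialDeriv F b i}

/-- The components of the relative polar curve `Γ¹_{F,z₀}`: those components of
`V(∂F/∂z₁, …, ∂F/∂zₙ)` that are not contained in `ΣF`. -/
def polarComponents : Set (PrimeSpectrum (AnalyticGerm E)) :=
  {P | P ∈ components (polarIdeal F b) ∧ ¬ jacobianIdeal F ≤ P.asIdeal}

/-- The Lê number `λ⁰_{F,z₀} = (Γ¹_{F,z₀} · V(∂F/∂z₀))₀`. -/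
def leNumberZero : ℕ∞ :=
  ∑ᶠ P ∈ polarComponents F b,
    cycleMultiplicity (polarIdeal F b) P * curveIntersection P (partialDeriv F b 0)

/-- All the numbers that enter into the beta invariant are finite. -/
def BetaFinite : Prop :=
  (polarComponents F b).Finite ∧ leNumberZero F b ≠ ⊤ ∧
    (components (jacobianIdeal F)).Finite ∧
    ∀ P ∈ components (jacobianIdeal F),
      nearbyMilnorNumber F P ≠ ⊤ ∧ curveIntersection P (b.coord 0) ≠ ⊤

/-- The beta invariant
`β_F = (Γ¹_{F,z₀} · V(∂F/∂z₀))₀ - ∑_C μ°_C ((C · V(z₀))₀ - 1)`, where `C` runs through the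
irreducible components of `ΣF` at the origin. -/
def beta : ℤ :=
  ((leNumberZero F b).toNat : ℤ) -
    ∑ᶠ P ∈ components (jacobianIdeal F),
      ((nearbyMilnorNumber F P).toNat : ℤ) * (((curveIntersection P (b.coord 0)).toNat : ℤ) - 1)

end Coordinates

/-- The germ of `S` at the origin is that of a `d`-dimensional complex submanifold through the
origin. -/
def IsSmoothAtOrigin (S : Set E) (d : ℕ) : Prop :=
  ∃ k : ℕ, k + d = Module.finrank ℂ E ∧ ∃ u : E → (Fin k → ℂ),
    AnalyticAt ℂ u 0 ∧ u 0 = 0 ∧ Function.Surjective (fderiv ℂ u 0) ∧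
      ∀ᶠ z in 𝓝 (0 : E), z ∈ S ↔ u z = 0

end BetaInvariant

end

/-!
Write `𝒪` for the ring of germs, `i(a, c)` for the length of `𝒪 / (a, c)` (`interMult`), and
`f₀, f₁` for the partial derivatives in admissible coordinates `(z₀, z₁)`. All numbers in the statement
become intersection multiplicities, and the work is done by one comparison of orders of vanishing
along polar branches.

*The ring `𝒪`.* Weierstrass division (`exists_weierstrass_division`) is the invertibility of a
bounded operator on a disc algebra that depends analytically on `z₀` and is bijective for
`z₀ = 0`. It makes `𝒪` Noetherian and factorial and makes the quotient by a germ that is regular in `z₁`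
a finite module over the discrete valuation ring `ℂ{z₀}`. Hence `i` is additive in both arguments,
and finite exactly for coprime germs (`interMult_mul_left`, `interMult_ne_top_iff`).

*The chain rule.* On a branch of `f₁ = 0` one has `df = f₀ dz₀`, so that `f` and `z₀ f₀` have the
same order there: `i(f, S) = i(f₀, S) + i(z₀, S)` for every divisor `S` of `f₁`
(`interMult_chain`). No parametrization of the branch is used. Instead, `ord_mul_derivation` shows
that the logarithmic derivative of `f` for the vector field `z₀ ∂/∂z₀` is a unit of the
normalization. For `S = f₁` this is Teissier's formula `i(f₁, f) = μ(f) + i(f, z₀) - 1`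
(`interMult_dirDeriv_self`).

*The beta invariant.* Let `R` be the greatest common divisor of `f₀` and `f₁`, and `f₁ = R B`. If
`q` divides `f` exactly `m + 1` times, it divides `R` exactly `m` times and does not divide `B`
(`polar_factor`), and `m` is also the Milnor number of a generic line slice of `f` at the points
of `q = 0` near the origin (`nearbyMilnorNumber_branch`). So the components of the critical locus,
weighted with these Milnor numbers, form the divisor of `R`, the polar curve is the divisor of
`B`, and the chain rule gives (`betaFinite_and_beta_eq`)

  `β = i(f, B) - i(f, z₀) + 1 + (number of prime factors of R, with multiplicity)`.

*The formulas.* For `f = g ^ p h` with `h` squarefree, `R = g ^ (p - 1)` and `B = p h g₁ + g h₁`,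
which gives `i(f, B) = p (i(g, h) + i(g₁, g)) + i(g, h) + i(h₁, h)`. Teissier's formula for `g`
and, if `h` is not a unit, for `h` turns this into the two formulas for `β`.

*Vanishing.* If `h` is not a unit, then `f` has two distinct prime factors, and `B` meets every
prime factor `q` of `f` with multiplicity at least `i(q, z₀)`. Hence `i(f, B) ≥ i(f, z₀)` and
`β > 0` (`beta_pos_of_evalZero_eq_zero`). So `β = 0` forces `h` to be a unit and `μ(g) = β / p = 0`,
that is `dg ≠ 0` at the origin, and the critical locus of `f` is the smooth curve `g = 0`
(`isSmoothAtOrigin_criticalLocus`).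
-/

noncomputable section

namespace BetaInvariant

/-! ### Weierstrass division for analytic functions of two variables -/

section DiscAlgebra

open Metric

/-- The extension by zero of a function on the closed disc. -/
def discExtend {r : ℝ} (g : C(closedBall (0 : ℂ) r, ℂ)) (z : ℂ) : ℂ :=
  open Classical in if h : z ∈ closedBall (0 : ℂ) r then g ⟨z, h⟩ else 0

lemma discExtend_of_mem {r : ℝ} (g : C(closedBall (0 : ℂ) r, ℂ)) {z : ℂ}
    (h : z ∈ closedBall (0 : ℂ) r) : discExtend g z = g ⟨z, h⟩ := dif_pos h

lemma continuousOn_discExtend {r : ℝ} (g : C(closedBall (0 : ℂ) r, ℂ)) :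
    ContinuousOn (discExtend g) (closedBall 0 r) := by
  rw [continuousOn_iff_continuous_domRestrict]
  convert! g.continuous using 1
  ext z
  exact discExtend_of_mem g z.2

/-- The disc algebra: continuous functions on the closed disc of radius `r` that are holomorphic
in its interior. -/
def discAlgebra (r : ℝ) : Subalgebra ℂ C(closedBall (0 : ℂ) r, ℂ) where
  carrier := {g | DifferentiableOn ℂ (discExtend g) (ball 0 r)}
  mul_mem' := by
    intro a b ha hb
    refine (DifferentiableOn.mul ha hb).congr fun z hz => ?_
    simp [discExtend_of_mem _ (ball_subset_closedBall hz)]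
  add_mem' := by
    intro a b ha hb
    refine (DifferentiableOn.add ha hb).congr fun z hz => ?_
    simp [discExtend_of_mem _ (ball_subset_closedBall hz)]
  algebraMap_mem' := by
    intro c
    refine (differentiableOn_const c).congr fun z hz => ?_
    simp [discExtend_of_mem _ (ball_subset_closedBall hz)]

lemma isClosed_discAlgebra (r : ℝ) : IsClosed (discAlgebra r : Set C(closedBall (0 : ℂ) r, ℂ)) := by
  refine IsSeqClosed.isClosed fun {u g} hu hg => ?_
  refine TendstoLocallyUniformlyOn.differentiableOn (φ := atTop)
    (F := fun n => discExtend (u n)) ?_ (Eventually.of_forall hu) isOpen_ball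
  refine TendstoUniformlyOn.tendstoLocallyUniformlyOn ?_
  rw [Metric.tendstoUniformlyOn_iff]
  intro ε hε
  filter_upwards [(Metric.tendsto_nhds.1 hg) ε hε] with n hn z hz
  rw [discExtend_of_mem _ (ball_subset_closedBall hz), discExtend_of_mem _ (ball_subset_closedBall hz),
    dist_comm]
  exact (ContinuousMap.dist_apply_le_dist _).trans_lt hn

instance (r : ℝ) : CompleteSpace (discAlgebra r) :=
  (isClosed_discAlgebra r).completeSpace_coe

lemma discAlgebra_diffContOnCl {r : ℝ} (hr : 0 < r) (g : discAlgebra r) :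
    DiffContOnCl ℂ (discExtend g.1) (ball 0 r) := by
  refine ⟨g.2, ?_⟩
  rw [closure_ball _ hr.ne']
  exact continuousOn_discExtend _

/-- The element of the disc algebra given by a function on the plane; zero if the function is
not continuous on the closed disc and holomorphic inside. -/
def discFn (r : ℝ) (f : ℂ → ℂ) : discAlgebra r :=
  open Classical in
  if h : ContinuousOn f (closedBall 0 r) ∧ DifferentiableOn ℂ f (ball 0 r) then
    ⟨⟨fun z => f z.1, continuousOn_iff_continuous_domRestrict.1 h.1⟩,
      h.2.congr fun _ hz => discExtend_of_mem _ (ball_subset_closedBall hz)⟩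
  else 0

lemma discFn_apply {r : ℝ} {f : ℂ → ℂ} (hc : ContinuousOn f (closedBall 0 r))
    (hd : DifferentiableOn ℂ f (ball 0 r)) (z : closedBall (0 : ℂ) r) :
    (discFn r f).1 z = f z := by
  rw [discFn, dif_pos ⟨hc, hd⟩]
  rfl

lemma discAlgebra_ext {r : ℝ} {g h : discAlgebra r} (H : ∀ z, g.1 z = h.1 z) : g = h :=
  Subtype.ext (ContinuousMap.ext H)

/-- The coordinate function of the disc algebra. -/
def discId (r : ℝ) : discAlgebra r := discFn r id

lemma discId_apply {r : ℝ} (z : closedBall (0 : ℂ) r) : (discId r).1 z = z :=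
  discFn_apply continuousOn_id differentiableOn_id z

/-- Evaluation at a point of the closed disc. -/
def discEval {r : ℝ} (z : closedBall (0 : ℂ) r) : discAlgebra r →L[ℂ] ℂ :=
  (ContinuousMap.evalCLM ℂ z).comp (discAlgebra r).toSubmodule.subtypeL

lemma discEval_apply {r : ℝ} (z : closedBall (0 : ℂ) r) (g : discAlgebra r) :
    discEval z g = g.1 z := rfl

lemma discAlgebra_exists_eq_add_mul {r : ℝ} (hr : 0 < r) (g : discAlgebra r) :
    ∃ (c : ℂ) (h : discAlgebra r), g = algebraMap ℂ _ c + discId r * h := by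
  have h0 : ball (0 : ℂ) r ∈ 𝓝 0 := ball_mem_nhds _ hr
  have h0' : closedBall (0 : ℂ) r ∈ 𝓝 0 := closedBall_mem_nhds _ hr
  have hd : DifferentiableOn ℂ (dslope (discExtend g.1) 0) (ball 0 r) :=
    (Complex.differentiableOn_dslope h0).2 g.2
  have hc : ContinuousOn (dslope (discExtend g.1) 0) (closedBall 0 r) :=
    (continuousOn_dslope h0').2 ⟨continuousOn_discExtend _,
      g.2.differentiableAt h0⟩
  refine ⟨discExtend g.1 0, discFn r (dslope (discExtend g.1) 0), discAlgebra_ext fun z => ?_⟩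
  have h1 : (algebraMap ℂ (discAlgebra r) (discExtend g.1 0) +
      discId r * discFn r (dslope (discExtend g.1) 0)).1 z
      = discExtend g.1 0 + (discId r).1 z * (discFn r (dslope (discExtend g.1) 0)).1 z := rfl
  rw [h1, discId_apply, discFn_apply hc hd, ← discExtend_of_mem g.1 z.2]
  have := sub_smul_dslope (discExtend g.1) 0 (z : ℂ)
  simp only [sub_zero, smul_eq_mul] at this
  rw [this]
  ring

/-- Taylor expansion to order `d` with a remainder in the disc algebra. This is Weierstrass division
by `z ^ d`. -/
lemma discAlgebra_exists_taylor {r : ℝ} (hr : 0 < r) (d : ℕ) (g : discAlgebra r) :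
    ∃ (c : Fin d → ℂ) (h : discAlgebra r),
      g = ∑ i, c i • discId r ^ (i : ℕ) + discId r ^ d * h := by
  induction d with
  | zero => exact ⟨0, g, by simp⟩
  | succ d ih =>
    obtain ⟨c, h, e⟩ := ih
    obtain ⟨a, h', e'⟩ := discAlgebra_exists_eq_add_mul hr h
    refine ⟨Fin.snoc c a, h', ?_⟩
    rw [Fin.sum_univ_castSucc]
    simp only [Fin.snoc_castSucc, Fin.snoc_last, Fin.val_castSucc, Fin.val_last]
    rw [e, e', mul_add, ← add_assoc, Algebra.algebraMap_eq_smul_one]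
    congr 1
    · simp
    · rw [pow_succ, mul_assoc]

/-- A polynomial of degree less than `d` that is `O(z ^ d)` at the origin vanishes. -/
lemma eq_zero_of_pow_mul_add_sum_eq_zero (d : ℕ) (c : Fin d → ℂ) (h : ℂ → ℂ)
    (hh : ContinuousAt h 0) (H : ∀ᶠ z in 𝓝 (0 : ℂ), z ^ d * h z + ∑ i, c i * z ^ (i : ℕ) = 0) :
    c = 0 := by
  induction d with
  | zero => exact Subsingleton.elim _ _
  | succ d ih =>
    have h0 : c 0 = 0 := by
      have := H.self_of_nhds
      simpa [Fin.sum_univ_succ] using this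
    have key : (fun i => c (Fin.succ i)) = 0 := by
      refine ih _ ?_
      have hne : ∀ᶠ z in 𝓝[≠] (0 : ℂ), z ^ d * h z + ∑ i, c (Fin.succ i) * z ^ (i : ℕ) = 0 := by
        filter_upwards [H.filter_mono nhdsWithin_le_nhds, self_mem_nhdsWithin] with z hz hz0
        rw [Fin.sum_univ_succ, h0] at hz
        simp only [Fin.val_succ, zero_mul, zero_add] at hz
        refine (mul_eq_zero.1 (?_ : z * _ = 0)).resolve_left hz0
        rw [← hz, mul_add, Finset.mul_sum]
        congr 1
        · ring
        · exact Finset.sum_congr rfl fun i _ => by ring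
      have hcont : ContinuousAt (fun z : ℂ => z ^ d * h z + ∑ i, c (Fin.succ i) * z ^ (i : ℕ)) 0 := by
        fun_prop
      have hval := tendsto_nhds_unique (hcont.tendsto.mono_left nhdsWithin_le_nhds)
        (tendsto_const_nhds.congr' (EventuallyEq.symm hne))
      rw [← nhdsNE_sup_pure, eventually_sup]
      exact ⟨hne, hval⟩
    funext i
    refine Fin.cases h0 (fun j => congrFun key j) i

/-- The map `(Q, c) ↦ Q φ + ∑ cᵢ zⁱ` whose inversion is Weierstrass division by `φ`. -/
def divisionMap (r : ℝ) (d : ℕ) :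
    discAlgebra r → ((discAlgebra r × (Fin d → ℂ)) →L[ℂ] discAlgebra r) := fun φ =>
  (ContinuousLinearMap.mul ℂ (discAlgebra r) φ).comp (ContinuousLinearMap.fst ℂ _ _) +
    (∑ i : Fin d, (ContinuousLinearMap.proj (R := ℂ) (φ := fun _ : Fin d => ℂ) i).smulRight
      (discId r ^ (i : ℕ))).comp (ContinuousLinearMap.snd ℂ _ _)

lemma divisionMap_apply (r : ℝ) (d : ℕ) (φ : discAlgebra r) (q : discAlgebra r × (Fin d → ℂ)) :
    divisionMap r d φ q = φ * q.1 + ∑ i, q.2 i • discId r ^ (i : ℕ) := by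
  simp [divisionMap]

/-- Division by `z ^ d u`, with `u` a unit of the disc algebra, is possible in a unique way: it is
the Taylor expansion to order `d`. -/
lemma divisionMap_bijective {r : ℝ} (hr : 0 < r) (d : ℕ) (u : (discAlgebra r)ˣ) :
    Function.Bijective (divisionMap r d (discId r ^ d * u)) := by
  constructor
  · rw [injective_iff_map_eq_zero]
    rintro ⟨q, c⟩ H
    rw [divisionMap_apply] at H
    simp only at H
    have hval : ∀ z : closedBall (0 : ℂ) r,
        (z : ℂ) ^ d * (u.1 * q).1 z + ∑ i, c i * (z : ℂ) ^ (i : ℕ) = 0 := by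
      intro z
      have := congrArg (discEval z) H
      rw [mul_assoc] at this
      simp only [map_add, map_sum, map_smul, map_zero, smul_eq_mul] at this
      refine Eq.trans ?_ this
      have h1 : ∀ n : ℕ, discEval z (discId r ^ n) = (z : ℂ) ^ n := by
        intro n
        change ((discId r).1 z) ^ n = _
        rw [discId_apply]
      have h2 : discEval z (discId r ^ d * (u.1 * q)) = (z : ℂ) ^ d * (u.1 * q).1 z := by
        rw [← h1]; rfl
      simp only [h1, h2]
    have hc : c = 0 := by
      refine eq_zero_of_pow_mul_add_sum_eq_zero d c (discExtend (u.1 * q).1) ?_ ?_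
      · exact (continuousOn_discExtend _).continuousAt (closedBall_mem_nhds _ hr)
      · filter_upwards [closedBall_mem_nhds (0 : ℂ) hr] with z hz
        rw [discExtend_of_mem _ hz]
        exact hval ⟨z, hz⟩
    subst hc
    have h0 : u.1 * q = 0 := by
      have hne : ∀ᶠ z in 𝓝[≠] (0 : ℂ), discExtend (u.1 * q).1 z = 0 := by
        filter_upwards [mem_nhdsWithin_of_mem_nhds (closedBall_mem_nhds (0 : ℂ) hr),
          self_mem_nhdsWithin] with z hz hz0
        have := hval ⟨z, hz⟩
        simp only [Pi.zero_apply, zero_mul, Finset.sum_const_zero, add_zero] at this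
        rw [discExtend_of_mem _ hz]
        exact (mul_eq_zero.1 this).resolve_left (pow_ne_zero _ hz0)
      refine discAlgebra_ext fun z => ?_
      by_cases hz : (z : ℂ) = 0
      · have hcont : ContinuousAt (discExtend (u.1 * q).1) 0 :=
          (continuousOn_discExtend _).continuousAt (closedBall_mem_nhds _ hr)
        have := tendsto_nhds_unique (hcont.tendsto.mono_left nhdsWithin_le_nhds)
          (tendsto_const_nhds.congr' (EventuallyEq.symm hne))
        change (u.1 * q).1 z = 0
        rw [← discExtend_of_mem _ z.2, hz, this]
      · have := hval z
        simp only [Pi.zero_apply, zero_mul, Finset.sum_const_zero, add_zero] at this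
        exact (mul_eq_zero.1 this).resolve_left (pow_ne_zero _ hz)
    have hq : q = 0 := by
      have := congrArg (fun t => (↑u⁻¹ : discAlgebra r) * t) h0
      simpa using this
    rw [hq]
    rfl
  · intro g
    obtain ⟨c, h, e⟩ := discAlgebra_exists_taylor hr d g
    refine ⟨(↑u⁻¹ * h, c), ?_⟩
    rw [divisionMap_apply, e, mul_assoc, Units.mul_inv_cancel_left, add_comm]

/-- The restriction of functions in the disc algebra to the circle. -/
def discRestrict (r : ℝ) : discAlgebra r →L[ℂ] C(sphere (0 : ℂ) r, ℂ) :=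
  LinearMap.mkContinuous
    { toFun := fun g => g.1.comp ⟨Set.inclusion sphere_subset_closedBall,
        continuous_inclusion sphere_subset_closedBall⟩
      map_add' := fun _ _ => rfl
      map_smul' := fun _ _ => rfl } 1 (by
    intro g
    rw [one_mul]
    refine (ContinuousMap.norm_le _ (norm_nonneg _)).2 fun z => ?_
    exact ContinuousMap.norm_coe_le_norm g.1 _)

/-- The normalized integral `(2πi)⁻¹ ∮ g(ζ) dζ` over the circle of radius `r`. -/
def circleFunctional {r : ℝ} (hr : 0 ≤ r) : C(sphere (0 : ℂ) r, ℂ) →L[ℂ] ℂ :=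
  LinearMap.mkContinuous
    { toFun := fun g => (2 * Real.pi * Complex.I : ℂ)⁻¹ • ∫ θ in (0 : ℝ)..2 * Real.pi,
        deriv (circleMap 0 r) θ • g ⟨circleMap 0 r θ, circleMap_mem_sphere 0 hr θ⟩
      map_add' := by
        intro f g
        rw [← smul_add, ← intervalIntegral.integral_add]
        · simp [mul_add]
        · exact Continuous.intervalIntegrable (by simp only [deriv_circleMap]; fun_prop) _ _
        · exact Continuous.intervalIntegrable (by simp only [deriv_circleMap]; fun_prop) _ _
      map_smul' := by
        intro c g
        rw [RingHom.id_apply, smul_comm c, ← intervalIntegral.integral_smul c]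
        simp only [ContinuousMap.smul_apply, smul_comm _ c] } r (by
    intro g
    simp only [LinearMap.coe_mk, AddHom.coe_mk]
    rw [norm_smul]
    have h1 : ‖∫ θ in (0 : ℝ)..2 * Real.pi,
        deriv (circleMap 0 r) θ • g ⟨circleMap 0 r θ, circleMap_mem_sphere 0 hr θ⟩‖
        ≤ (r * ‖g‖) * |2 * Real.pi - 0| := by
      refine intervalIntegral.norm_integral_le_of_norm_le_const fun θ _ => ?_
      rw [norm_smul]
      refine mul_le_mul (by simp [deriv_circleMap, abs_of_nonneg hr])
        (ContinuousMap.norm_coe_le_norm g _) (norm_nonneg _) hr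
    rw [sub_zero, abs_of_pos (by positivity)] at h1
    have h2 : ‖(2 * Real.pi * Complex.I : ℂ)⁻¹‖ = (2 * Real.pi)⁻¹ := by
      simp [abs_of_pos Real.pi_pos]
    rw [h2]
    calc _ ≤ (2 * Real.pi)⁻¹ * ((r * ‖g‖) * (2 * Real.pi)) := by gcongr
      _ = r * ‖g‖ := by field_simp)

/-- The function `ζ ↦ ζ` on the circle. -/
def circleId (r : ℝ) : C(sphere (0 : ℂ) r, ℂ) := ⟨fun z => z, continuous_subtype_val⟩

/-- Cauchy's integral formula in terms of the Banach algebra of continuous functions on the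
circle. It exhibits the value `g w` as an analytic function of the pair `(g, w)`. -/
lemma circleFunctional_cauchy {r : ℝ} (hr : 0 < r) (g : discAlgebra r) {w : ℂ}
    (hw : w ∈ ball (0 : ℂ) r) :
    circleFunctional hr.le (Ring.inverse (circleId r - algebraMap ℂ _ w) * discRestrict r g)
      = discExtend g.1 w := by
  rw [← (discAlgebra_diffContOnCl hr g).two_pi_i_inv_smul_circleIntegral_sub_inv_smul hw]
  change (2 * Real.pi * Complex.I : ℂ)⁻¹ • ∫ θ in (0 : ℝ)..2 * Real.pi,
    deriv (circleMap 0 r) θ • (Ring.inverse (circleId r - algebraMap ℂ _ w) * discRestrict r g)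
      ⟨circleMap 0 r θ, circleMap_mem_sphere 0 hr.le θ⟩ = _
  rw [circleIntegral]
  congr 1
  refine intervalIntegral.integral_congr fun θ _ => ?_
  have hne : ∀ ζ : sphere (0 : ℂ) r, (ζ : ℂ) - w ≠ 0 := by
    intro ζ h
    have h1 := ζ.2
    rw [sub_eq_zero.1 h, mem_sphere] at h1
    exact absurd (mem_ball.1 hw) (by rw [h1]; exact lt_irrefl r)
  have hinv : Ring.inverse (circleId r - algebraMap ℂ C(sphere (0 : ℂ) r, ℂ) w) =
      ⟨fun ζ => ((ζ : ℂ) - w)⁻¹, Continuous.inv₀ (by fun_prop) hne⟩ := by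
    have hu : (circleId r - algebraMap ℂ C(sphere (0 : ℂ) r, ℂ) w) *
        ⟨fun ζ => ((ζ : ℂ) - w)⁻¹, Continuous.inv₀ (by fun_prop) hne⟩ = 1 := by
      ext ζ
      exact mul_inv_cancel₀ (hne ζ)
    have h2 := Ring.inverse_mul_cancel _ (IsUnit.of_mul_eq_one _ hu)
    calc _ = Ring.inverse (circleId r - algebraMap ℂ C(sphere (0 : ℂ) r, ℂ) w) *
          ((circleId r - algebraMap ℂ C(sphere (0 : ℂ) r, ℂ) w) *
          ⟨fun ζ => ((ζ : ℂ) - w)⁻¹, Continuous.inv₀ (by fun_prop) hne⟩) := by rw [hu, mul_one]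
      _ = _ := by rw [← mul_assoc, h2, one_mul]
  rw [hinv]
  simp only [ContinuousMap.mul_apply, ContinuousMap.coe_mk, smul_eq_mul]
  rw [discExtend_of_mem _ (sphere_subset_closedBall (circleMap_mem_sphere 0 hr.le θ))]
  rfl

/-- An analytic family in the disc algebra is an analytic function of two variables, by Cauchy's
integral formula. -/
lemma analyticAt_discExtend {r : ℝ} (hr : 0 < r) (Q : ℂ → discAlgebra r) (hQ : AnalyticAt ℂ Q 0) :
    AnalyticAt ℂ (fun p : ℂ × ℂ => discExtend (Q p.1).1 p.2) 0 := by
  have hu : IsUnit (circleId r - algebraMap ℂ C(sphere (0 : ℂ) r, ℂ) 0) := by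
    have hne : ∀ ζ : sphere (0 : ℂ) r, (ζ : ℂ) ≠ 0 := fun ζ => ne_zero_of_mem_sphere hr.ne' ζ
    refine IsUnit.of_mul_eq_one ⟨fun ζ => (ζ : ℂ)⁻¹, Continuous.inv₀ (by fun_prop) hne⟩ ?_
    ext ζ
    simp [circleId, hne ζ]
  have h1 : AnalyticAt ℂ (fun p : ℂ × ℂ =>
      Ring.inverse (circleId r - algebraMap ℂ C(sphere (0 : ℂ) r, ℂ) p.2)) 0 := by
    refine AnalyticAt.fun_comp (g := Ring.inverse) ?_ ?_
    · exact (analyticAt_inverse (𝕜 := ℂ) hu.unit)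
    · refine analyticAt_const.sub ?_
      exact ((Algebra.linearMap ℂ C(sphere (0 : ℂ) r, ℂ)).toContinuousLinearMap.analyticAt _).fun_comp
        analyticAt_snd
  have h2 : AnalyticAt ℂ (fun p : ℂ × ℂ => discRestrict r (Q p.1)) 0 :=
    ((discRestrict r).analyticAt _).fun_comp (hQ.comp_of_eq analyticAt_fst rfl)
  have h3 : AnalyticAt ℂ (fun p : ℂ × ℂ => circleFunctional hr.le
      (Ring.inverse (circleId r - algebraMap ℂ C(sphere (0 : ℂ) r, ℂ) p.2) *
        discRestrict r (Q p.1))) 0 :=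
    ((circleFunctional hr.le).analyticAt _).fun_comp (h1.mul h2)
  refine h3.congr ?_
  have : ∀ᶠ p : ℂ × ℂ in 𝓝 0, p.2 ∈ ball (0 : ℂ) r :=
    continuous_snd.continuousAt.eventually (ball_mem_nhds (0 : ℂ) hr)
  filter_upwards [this] with p hp
  exact circleFunctional_cauchy hr (Q p.1) hp

/-- The slices `x ↦ F(x, ·)` of an analytic function form an analytic family in the disc algebra. -/
lemma analyticAt_discFn {r ε : ℝ} (hε : 0 < ε) {F : ℂ × ℂ → ℂ}
    (hF : AnalyticOnNhd ℂ F (closedBall 0 ε ×ˢ closedBall 0 r)) :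
    AnalyticAt ℂ (fun x => discFn r fun z => F (x, z)) 0 := by
  have hslice : ∀ x ∈ closedBall (0 : ℂ) ε, ContinuousOn (fun z => F (x, z)) (closedBall 0 r) ∧
      DifferentiableOn ℂ (fun z => F (x, z)) (ball 0 r) := by
    intro x hx
    have h : AnalyticOnNhd ℂ (fun z => F (x, z)) (closedBall 0 r) := fun z hz =>
      (hF (x, z) ⟨hx, hz⟩).fun_comp (analyticAt_const.prod analyticAt_id)
    exact ⟨h.continuousOn, h.differentiableOn.mono ball_subset_closedBall⟩
  have hslice' : ∀ z ∈ closedBall (0 : ℂ) r, DiffContOnCl ℂ (fun x => F (x, z)) (ball 0 ε) := by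
    intro z hz
    have h : AnalyticOnNhd ℂ (fun x => F (x, z)) (closedBall 0 ε) := fun x hx =>
      AnalyticAt.fun_comp (f := fun x => (x, z)) (hF (x, z) ⟨hx, hz⟩)
        (analyticAt_id.prod analyticAt_const)
    refine ⟨h.differentiableOn.mono ball_subset_closedBall, ?_⟩
    rw [closure_ball _ hε.ne']
    exact h.continuousOn
  have huc : UniformContinuousOn F (closedBall 0 ε ×ˢ closedBall 0 r) :=
    ((isCompact_closedBall _ _).prod (isCompact_closedBall _ _)).uniformContinuousOn_of_continuous
      hF.continuousOn
  have hcont : ContinuousOn (fun x => discFn r fun z => F (x, z)) (closedBall 0 ε) := by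
    rw [Metric.continuousOn_iff]
    intro x hx η hη
    obtain ⟨δ, hδ, H⟩ := Metric.uniformContinuousOn_iff.1 huc η hη
    refine ⟨δ, hδ, fun y hy hyx => ?_⟩
    rw [Subtype.dist_eq]
    refine (ContinuousMap.dist_lt_iff hη).2 fun z => ?_
    rw [discFn_apply (hslice y hy).1 (hslice y hy).2, discFn_apply (hslice x hx).1 (hslice x hx).2]
    exact H _ ⟨hy, z.2⟩ _ ⟨hx, z.2⟩ (by simpa [Prod.dist_eq] using hyx)
  have hci : CircleIntegrable (fun x => discFn r fun z => F (x, z)) 0 ε :=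
    (hcont.mono sphere_subset_closedBall).circleIntegrable hε.le
  lift ε to NNReal using hε.le
  have han := (hasFPowerSeriesOn_cauchy_integral hci (by exact_mod_cast hε)).analyticAt
  refine han.congr ?_
  filter_upwards [ball_mem_nhds (0 : ℂ) hε] with w hw
  refine discAlgebra_ext fun z => ?_
  rw [discFn_apply (hslice w (ball_subset_closedBall hw)).1 (hslice w (ball_subset_closedBall hw)).2,
    ← (hslice' z z.2).two_pi_i_inv_smul_circleIntegral_sub_inv_smul hw, ← discEval_apply,
    map_smul, circleIntegral, circleIntegral, ← ContinuousLinearMap.intervalIntegral_comp_comm]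
  · congr 1
    refine intervalIntegral.integral_congr fun θ _ => ?_
    have hθ := sphere_subset_closedBall (circleMap_mem_sphere (0 : ℂ) hε.le θ)
    simp only [map_smul, discEval_apply]
    rw [discFn_apply (hslice _ hθ).1 (hslice _ hθ).2]
  · have hne : ∀ ζ ∈ sphere (0 : ℂ) ε, ζ - w ≠ 0 := by
      intro ζ h1 h
      rw [sub_eq_zero.1 h, mem_sphere] at h1
      exact absurd (mem_ball.1 hw) (by rw [h1]; exact lt_irrefl _)
    have : CircleIntegrable (fun ζ => (ζ - w)⁻¹ • discFn r fun z => F (ζ, z)) 0 ε := by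
      refine ContinuousOn.circleIntegrable hε.le ?_
      exact ((continuousOn_id.sub continuousOn_const).inv₀ hne).smul
        (hcont.mono sphere_subset_closedBall)
    exact this.out

/-- An analytic family of linear equations that is uniquely solvable at one parameter has an
analytic family of solutions near it. -/
lemma exists_analyticAt_solution {X Y : Type*} [NormedAddCommGroup X] [NormedSpace ℂ X]
    [CompleteSpace X] [NormedAddCommGroup Y] [NormedSpace ℂ Y] [CompleteSpace Y]
    (T : ℂ → X →L[ℂ] Y) (g : ℂ → Y) (hT : AnalyticAt ℂ T 0) (hg : AnalyticAt ℂ g 0)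
    (hbij : Function.Bijective (T 0)) :
    ∃ s : ℂ → X, AnalyticAt ℂ s 0 ∧ ∀ᶠ x in 𝓝 (0 : ℂ), T x (s x) = g x := by
  set e := ContinuousLinearEquiv.ofBijective (T 0)
    (LinearMap.ker_eq_bot.2 hbij.1) (LinearMap.range_eq_top.2 hbij.2) with he
  set S : ℂ → X →L[ℂ] X := fun x => (e.symm : Y →L[ℂ] X).comp (T x) with hS
  have hSan : AnalyticAt ℂ S 0 :=
    ((ContinuousLinearMap.compL ℂ X Y X (e.symm : Y →L[ℂ] X)).analyticAt _).fun_comp hT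
  have hS0 : S 0 = 1 := ContinuousLinearMap.ext fun q => e.symm_apply_apply q
  have hinv : AnalyticAt ℂ (fun x => Ring.inverse (S x)) 0 := by
    refine AnalyticAt.fun_comp (g := Ring.inverse) ?_ hSan
    rw [hS0]
    exact analyticAt_inverse (𝕜 := ℂ) (1 : (X →L[ℂ] X)ˣ)
  have hunit : ∀ᶠ x in 𝓝 (0 : ℂ), IsUnit (S x) := by
    refine hSan.continuousAt.eventually (p := IsUnit) ?_
    exact Units.isOpen.mem_nhds (by rw [hS0]; exact isUnit_one)
  have hg' : AnalyticAt ℂ (fun x => e.symm (g x)) 0 :=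
    ((e.symm : Y →L[ℂ] X).analyticAt _).fun_comp hg
  refine ⟨fun x => Ring.inverse (S x) (e.symm (g x)), ?_, ?_⟩
  · exact AnalyticAt.fun_comp (f := fun x => (Ring.inverse (S x), e.symm (g x)))
      ((ContinuousLinearMap.apply ℂ X).flip.analyticAt_bilinear
        (Ring.inverse (S 0), e.symm (g 0))) (hinv.prod hg')
  · filter_upwards [hunit] with x hx
    apply e.symm.injective
    change S x (Ring.inverse (S x) (e.symm (g x))) = _
    rw [← mul_apply_eq_comp, Ring.mul_inverse_cancel _ hx]
    rfl

lemma analyticAt_mul_comp_add {A X : Type*} [NormedRing A] [NormedAlgebra ℂ A]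
    [NormedAddCommGroup X] [NormedSpace ℂ X] {f : ℂ → A} (hf : AnalyticAt ℂ f 0)
    (M : X →L[ℂ] A) (C : X →L[ℂ] A) :
    AnalyticAt ℂ (fun x => (ContinuousLinearMap.mul ℂ A (f x)).comp M + C) 0 := by
  refine AnalyticAt.add ?_ analyticAt_const
  exact ((((ContinuousLinearMap.compL ℂ X A A).flip M).comp
    (ContinuousLinearMap.mul ℂ A)).analyticAt _).fun_comp hf

/-- **Weierstrass division theorem** for functions of two variables. -/
theorem exists_weierstrass_division {F G : ℂ × ℂ → ℂ} (hF : AnalyticAt ℂ F 0)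
    (hG : AnalyticAt ℂ G 0) (d : ℕ) (u : ℂ → ℂ) (hu : AnalyticAt ℂ u 0) (hu0 : u 0 ≠ 0)
    (hFu : ∀ᶠ z in 𝓝 (0 : ℂ), F (0, z) = z ^ d * u z) :
    ∃ (Q : ℂ × ℂ → ℂ) (c : Fin d → ℂ → ℂ), AnalyticAt ℂ Q 0 ∧ (∀ i, AnalyticAt ℂ (c i) 0) ∧
      ∀ᶠ p in 𝓝 (0 : ℂ × ℂ), G p = Q p * F p + ∑ i, c i p.1 * p.2 ^ (i : ℕ) := by
  obtain ⟨ε, hε, Hε⟩ := Metric.eventually_nhds_iff_ball.1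
    (hF.eventually_analyticAt.and hG.eventually_analyticAt)
  obtain ⟨ε', hε', Hε'⟩ := Metric.eventually_nhds_iff_ball.1
    (hu.eventually_analyticAt.and ((hu.continuousAt.eventually_ne hu0).and hFu))
  set r := min (ε / 2) (ε' / 2) with hr_def
  have hr : 0 < r := by positivity
  have hrε : r < ε := (min_le_left _ _).trans_lt (by linarith)
  have hrε' : r < ε' := (min_le_right _ _).trans_lt (by linarith)
  have hsub : closedBall (0 : ℂ) r ×ˢ closedBall (0 : ℂ) r ⊆ ball (0 : ℂ × ℂ) ε := by
    rw [closedBall_prod_same]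
    exact closedBall_subset_ball hrε
  have hFn : AnalyticOnNhd ℂ F (closedBall 0 r ×ˢ closedBall 0 r) := fun p hp => (Hε p (hsub hp)).1
  have hGn : AnalyticOnNhd ℂ G (closedBall 0 r ×ˢ closedBall 0 r) := fun p hp => (Hε p (hsub hp)).2
  have hsub' := closedBall_subset_ball (x := (0 : ℂ)) hrε'
  have hun : AnalyticOnNhd ℂ u (closedBall 0 r) := fun z hz => (Hε' z (hsub' hz)).1
  have hune : ∀ z ∈ closedBall (0 : ℂ) r, u z ≠ 0 := fun z hz => (Hε' z (hsub' hz)).2.1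
  have hinv : AnalyticOnNhd ℂ (fun z => (u z)⁻¹) (closedBall 0 r) := fun z hz =>
    (hun z hz).inv (hune z hz)
  have hslice : ∀ H : ℂ × ℂ → ℂ, AnalyticOnNhd ℂ H (closedBall 0 r ×ˢ closedBall 0 r) →
      ∀ x ∈ closedBall (0 : ℂ) r, ∀ z (hz : z ∈ closedBall (0 : ℂ) r),
        (discFn r fun z => H (x, z)).1 ⟨z, hz⟩ = H (x, z) := by
    intro H hH x hx z hz
    have h : AnalyticOnNhd ℂ (fun z => H (x, z)) (closedBall 0 r) := fun z hz =>
      (hH (x, z) ⟨hx, hz⟩).fun_comp (analyticAt_const.prod analyticAt_id)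
    exact discFn_apply h.continuousOn (h.differentiableOn.mono ball_subset_closedBall) _
  -- `F` and `G` are regarded as analytic families of elements of the disc algebra; the division map
  -- of `F(0, ·)` is bijective, so that the equation can be solved for all small parameters
  set f : ℂ → discAlgebra r := fun x => discFn r fun z => F (x, z)
  set g : ℂ → discAlgebra r := fun x => discFn r fun z => G (x, z)
  have hf : AnalyticAt ℂ f 0 := analyticAt_discFn hr hFn
  have hg : AnalyticAt ℂ g 0 := analyticAt_discFn hr hGn
  have hu1 : discFn r u * discFn r (fun z => (u z)⁻¹) = 1 := by
    refine discAlgebra_ext fun z => ?_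
    change (discFn r u).1 z * (discFn r fun z => (u z)⁻¹).1 z = 1
    rw [discFn_apply hun.continuousOn (hun.differentiableOn.mono ball_subset_closedBall),
      discFn_apply hinv.continuousOn (hinv.differentiableOn.mono ball_subset_closedBall)]
    exact mul_inv_cancel₀ (hune z z.2)
  set U : (discAlgebra r)ˣ := ⟨discFn r u, discFn r (fun z => (u z)⁻¹), hu1, by rw [mul_comm, hu1]⟩
  have hf0 : f 0 = discId r ^ d * U := by
    refine discAlgebra_ext fun z => ?_
    change (f 0).1 z = (discId r).1 z ^ d * (discFn r u).1 z
    rw [discId_apply, discFn_apply hun.continuousOn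
      (hun.differentiableOn.mono ball_subset_closedBall), hslice F hFn 0 (by simpa using hr.le) z z.2]
    exact (Hε' z (hsub' z.2)).2.2
  have hbij := divisionMap_bijective hr d U
  rw [← hf0] at hbij
  obtain ⟨s, hsan, hsol⟩ := exists_analyticAt_solution (fun x => divisionMap r d (f x)) g
    (analyticAt_mul_comp_add hf _ _) hg hbij
  refine ⟨fun p => discExtend (s p.1).1.1 p.2, fun i x => (s x).2 i,
    analyticAt_discExtend hr (fun x => (s x).1)
      (((ContinuousLinearMap.fst ℂ _ _).analyticAt _).fun_comp hsan), fun i => ?_, ?_⟩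
  · exact (((ContinuousLinearMap.proj (R := ℂ) (φ := fun _ : Fin d => ℂ) i).comp
      (ContinuousLinearMap.snd ℂ _ _)).analyticAt _).fun_comp hsan
  · have h1 : ∀ᶠ p : ℂ × ℂ in 𝓝 0, p.1 ∈ closedBall (0 : ℂ) r :=
      continuous_fst.continuousAt.eventually (closedBall_mem_nhds (0 : ℂ) hr)
    have h2 : ∀ᶠ p : ℂ × ℂ in 𝓝 0, p.2 ∈ closedBall (0 : ℂ) r :=
      continuous_snd.continuousAt.eventually (closedBall_mem_nhds (0 : ℂ) hr)
    have h3 : ∀ᶠ p : ℂ × ℂ in 𝓝 0, divisionMap r d (f p.1) (s p.1) = g p.1 :=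
      Tendsto.eventually (p := fun x => divisionMap r d (f x) (s x) = g x)
        (continuous_fst.tendsto' (0 : ℂ × ℂ) 0 rfl) hsol
    filter_upwards [h1, h2, h3] with p hp1 hp2 hp3
    rw [divisionMap_apply] at hp3
    have h4 := congrArg (discEval ⟨p.2, hp2⟩) hp3
    simp only [map_add, map_sum, map_smul, smul_eq_mul] at h4
    have h5 : ∀ n : ℕ, discEval ⟨p.2, hp2⟩ (discId r ^ n) = p.2 ^ n := by
      intro n
      change ((discId r).1 ⟨p.2, hp2⟩) ^ n = _
      rw [discId_apply]
    have h6 : discEval ⟨p.2, hp2⟩ (f p.1 * (s p.1).1) = F p * discExtend (s p.1).1.1 p.2 := by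
      rw [discExtend_of_mem _ hp2, ← hslice F hFn p.1 hp1 p.2 hp2]
      rfl
    have h7 : discEval ⟨p.2, hp2⟩ (g p.1) = G p := hslice G hGn p.1 hp1 p.2 hp2
    rw [h6, h7] at h4
    simp only [h5] at h4
    rw [← h4, mul_comm (F p)]

end DiscAlgebra

/-! ### The local ring of analytic germs -/

section Germs

variable {E : Type*} [NormedAddCommGroup E] [NormedSpace ℂ E]
  {E' : Type*} [NormedAddCommGroup E'] [NormedSpace ℂ E']
  {E'' : Type*} [NormedAddCommGroup E''] [NormedSpace ℂ E'']

/-- The ring structure of `AnalyticGerm E`, recorded to shorten instance searches. -/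
scoped instance : CommSemiring (AnalyticGerm E) := CommRing.toCommSemiring

lemma exists_rep (φ : AnalyticGerm E) : ∃ (F : E → ℂ) (hF : AnalyticAt ℂ F 0), φ = germ F hF := by
  obtain ⟨_, F, hF, rfl⟩ := φ
  exact ⟨F, hF, rfl⟩

lemma germ_eq_iff {F G : E → ℂ} {hF : AnalyticAt ℂ F 0} {hG : AnalyticAt ℂ G 0} :
    germ F hF = germ G hG ↔ F =ᶠ[𝓝 0] G :=
  Subtype.ext_iff.trans Germ.coe_eq

lemma germ_eq_zero_iff {F : E → ℂ} {hF : AnalyticAt ℂ F 0} :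
    germ F hF = 0 ↔ ∀ᶠ z in 𝓝 0, F z = 0 :=
  germ_eq_iff (hG := analyticAt_const)

lemma germ_mul {F G : E → ℂ} (hF : AnalyticAt ℂ F 0) (hG : AnalyticAt ℂ G 0) :
    germ F hF * germ G hG = germ (fun z => F z * G z) (hF.mul hG) := rfl

lemma germ_add {F G : E → ℂ} (hF : AnalyticAt ℂ F 0) (hG : AnalyticAt ℂ G 0) :
    germ F hF + germ G hG = germ (fun z => F z + G z) (hF.add hG) := rfl

lemma germ_pow {F : E → ℂ} (hF : AnalyticAt ℂ F 0) (n : ℕ) :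
    germ F hF ^ n = germ (fun z => F z ^ n) (hF.pow n) := rfl

/-- The germs of constant functions. -/
def constGerm : ℂ →+* AnalyticGerm E where
  toFun c := germ (fun _ => c) analyticAt_const
  map_one' := rfl
  map_mul' _ _ := rfl
  map_zero' := rfl
  map_add' _ _ := rfl

instance : Algebra ℂ (AnalyticGerm E) := constGerm.toAlgebra

lemma algebraMap_germ (c : ℂ) :
    algebraMap ℂ (AnalyticGerm E) c = germ (fun _ => c) analyticAt_const := rfl

/-- The value at the origin. -/
def evalZero : AnalyticGerm E →+* ℂ :=
  (Germ.valueRingHom (x := (0 : E))).comp (AnalyticGerm E).subtype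

@[simp] lemma evalZero_germ {F : E → ℂ} (hF : AnalyticAt ℂ F 0) : evalZero (germ F hF) = F 0 := rfl

@[simp] lemma evalZero_algebraMap (c : ℂ) : evalZero (algebraMap ℂ (AnalyticGerm E) c) = c := rfl

lemma isUnit_iff_evalZero {φ : AnalyticGerm E} : IsUnit φ ↔ evalZero φ ≠ 0 := by
  constructor
  · intro h
    exact (h.map evalZero).ne_zero
  · obtain ⟨F, hF, rfl⟩ := exists_rep φ
    intro h
    refine IsUnit.of_mul_eq_one (germ (fun z => (F z)⁻¹) (hF.inv h)) ?_
    rw [germ_mul]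
    refine germ_eq_iff (hG := analyticAt_const).2 ?_
    filter_upwards [hF.continuousAt.eventually_ne h] with z hz
    exact mul_inv_cancel₀ hz

instance : Nontrivial (AnalyticGerm E) :=
  (evalZero (E := E)).domain_nontrivial

instance : IsLocalRing (AnalyticGerm E) := by
  refine IsLocalRing.of_nonunits_add fun a b ha hb => ?_
  simp only [mem_nonunits_iff, isUnit_iff_evalZero, not_not] at *
  simp [ha, hb]

lemma mem_maximalIdeal_iff {φ : AnalyticGerm E} :
    φ ∈ IsLocalRing.maximalIdeal (AnalyticGerm E) ↔ evalZero φ = 0 := by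
  rw [IsLocalRing.mem_maximalIdeal, mem_nonunits_iff, isUnit_iff_evalZero, not_not]

/-- The identity theorem on a ball: if `F G = 0` and `F` does not vanish identically, then `G`
vanishes near some point of the ball and hence everywhere on it. -/
instance : IsDomain (AnalyticGerm E) := by
  have : NoZeroDivisors (AnalyticGerm E) := by
    refine ⟨fun {a b} h => ?_⟩
    obtain ⟨F, hF, rfl⟩ := exists_rep a
    obtain ⟨G, hG, rfl⟩ := exists_rep b
    rw [germ_mul, germ_eq_zero_iff] at h
    rw [germ_eq_zero_iff, germ_eq_zero_iff]
    obtain ⟨ε, hε, H⟩ := Metric.eventually_nhds_iff_ball.1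
      (hF.eventually_analyticAt.and (hG.eventually_analyticAt.and h))
    by_cases hz : ∀ z ∈ Metric.ball (0 : E) ε, F z = 0
    · left
      filter_upwards [Metric.ball_mem_nhds _ hε] with z hz' using hz z hz'
    · right
      push Not at hz
      obtain ⟨z₀, hz₀, hne⟩ := hz
      have hG' : AnalyticOnNhd ℂ G (Metric.ball 0 ε) := fun z hz => (H z hz).2.1
      have hpre : IsPreconnected (Metric.ball (0 : E) ε) := by
        let : NormedSpace ℝ E := NormedSpace.restrictScalars ℝ ℂ E
        exact (convex_ball _ _).isPreconnected
      have := hG'.eqOn_zero_of_preconnected_of_eventuallyEq_zero hpre hz₀ (by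
        filter_upwards [(H z₀ hz₀).1.continuousAt.eventually_ne hne,
          Metric.isOpen_ball.mem_nhds hz₀] with z h1 h2
        exact (mul_eq_zero.1 (H z h2).2.2).resolve_left h1)
      filter_upwards [Metric.ball_mem_nhds _ hε] with z hz using this hz
  exact NoZeroDivisors.to_isDomain _

/-- Composition of germs with a continuous linear map. -/
def germMap (a : E' →L[ℂ] E) : AnalyticGerm E →+* AnalyticGerm E' where
  toFun φ := ⟨Germ.compTendsto φ.1 a (a.continuous.tendsto' 0 0 (map_zero a)), by
    obtain ⟨_, F, hF, rfl⟩ := φ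
    exact ⟨F ∘ a, AnalyticAt.comp (by rwa [map_zero]) (a.analyticAt 0), rfl⟩⟩
  map_one' := rfl
  map_mul' x y := by
    obtain ⟨F, hF, rfl⟩ := exists_rep x
    obtain ⟨G, hG, rfl⟩ := exists_rep y
    rfl
  map_zero' := rfl
  map_add' x y := by
    obtain ⟨F, hF, rfl⟩ := exists_rep x
    obtain ⟨G, hG, rfl⟩ := exists_rep y
    rfl

lemma _root_.AnalyticAt.comp_clm {F : E → ℂ} (hF : AnalyticAt ℂ F 0) (a : E' →L[ℂ] E) :
    AnalyticAt ℂ (fun z => F (a z)) 0 :=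
  AnalyticAt.comp (g := F) (f := a) (by rwa [map_zero]) (a.analyticAt 0)

lemma germMap_germ (a : E' →L[ℂ] E) {F : E → ℂ} (hF : AnalyticAt ℂ F 0) :
    germMap a (germ F hF) = germ (fun z => F (a z)) (hF.comp_clm a) := rfl

lemma germMap_comp (a : E' →L[ℂ] E) (a' : E'' →L[ℂ] E') (φ : AnalyticGerm E) :
    germMap a' (germMap a φ) = germMap (a.comp a') φ := by
  obtain ⟨F, hF, rfl⟩ := exists_rep φ
  rfl

lemma germMap_id (φ : AnalyticGerm E) : germMap (ContinuousLinearMap.id ℂ E) φ = φ := by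
  obtain ⟨F, hF, rfl⟩ := exists_rep φ
  rfl

@[simp] lemma germMap_algebraMap (a : E' →L[ℂ] E) (c : ℂ) :
    germMap a (algebraMap ℂ _ c) = algebraMap ℂ _ c := rfl

@[simp] lemma evalZero_germMap (a : E' →L[ℂ] E) (φ : AnalyticGerm E) :
    evalZero (germMap a φ) = evalZero φ := by
  obtain ⟨F, hF, rfl⟩ := exists_rep φ
  simp [germMap_germ]

/-- The ring isomorphism induced by a linear change of coordinates. -/
def germEquiv (e : E' ≃L[ℂ] E) : AnalyticGerm E ≃+* AnalyticGerm E' where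
  toFun := germMap (e : E' →L[ℂ] E)
  invFun := germMap (e.symm : E →L[ℂ] E')
  left_inv φ := by
    rw [germMap_comp, e.coe_comp_coe_symm, germMap_id]
  right_inv φ := by
    rw [germMap_comp, e.coe_symm_comp_coe, germMap_id]
  map_mul' := map_mul _
  map_add' := map_add _

/-- The germ of a continuous linear form. -/
def linGerm (l : E →L[ℂ] ℂ) : AnalyticGerm E := germ l (l.analyticAt 0)

lemma germMap_linGerm (a : E' →L[ℂ] E) (l : E →L[ℂ] ℂ) :
    germMap a (linGerm l) = linGerm (l.comp a) := rfl

lemma linGerm_zero : linGerm (0 : E →L[ℂ] ℂ) = 0 := rfl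

lemma germMap_zero (φ : AnalyticGerm E) :
    germMap (0 : E' →L[ℂ] E) φ = algebraMap ℂ _ (evalZero φ) := by
  obtain ⟨F, hF, rfl⟩ := exists_rep φ
  rfl

lemma _root_.AnalyticAt.dirDeriv {F : E → ℂ} (hF : AnalyticAt ℂ F 0) (v : E) :
    AnalyticAt ℂ (fun z => fderiv ℂ F z v) 0 :=
  ((ContinuousLinearMap.apply ℂ ℂ v : (E →L[ℂ] ℂ) →L[ℂ] ℂ).analyticAt _).fun_comp hF.fderiv

/-- The derivative of germs in the direction `v`, as a derivation. -/
def dirDeriv (v : E) : Derivation ℂ (AnalyticGerm E) (AnalyticGerm E) :=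
  have key : ∀ (F : E → ℂ) (hF : AnalyticAt ℂ F 0),
      germ (fun z => fderiv ℂ (exists_rep (germ F hF)).choose z v)
        ((exists_rep (germ F hF)).choose_spec.choose.dirDeriv v) =
      germ (fun z => fderiv ℂ F z v) (hF.dirDeriv v) := by
    intro F hF
    have h := germ_eq_iff.1 (exists_rep (germ F hF)).choose_spec.choose_spec
    refine germ_eq_iff.2 ?_
    filter_upwards [h.symm.fderiv (𝕜 := ℂ)] with z hz
    rw [hz]
  Derivation.mk'
    { toFun := fun φ => germ (fun z => fderiv ℂ (exists_rep φ).choose z v)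
        ((exists_rep φ).choose_spec.choose.dirDeriv v)
      map_add' := by
        intro x y
        obtain ⟨F, hF, rfl⟩ := exists_rep x
        obtain ⟨G, hG, rfl⟩ := exists_rep y
        rw [germ_add, key, key, key, germ_add]
        refine germ_eq_iff.2 ?_
        filter_upwards [hF.eventually_analyticAt, hG.eventually_analyticAt] with z h1 h2
        rw [fderiv_fun_add h1.differentiableAt h2.differentiableAt]
        rfl
      map_smul' := by
        intro c y
        obtain ⟨G, hG, rfl⟩ := exists_rep y
        rw [Algebra.smul_def, Algebra.smul_def, algebraMap_germ, germ_mul, key, key,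
          RingHom.id_apply, algebraMap_germ, germ_mul]
        refine germ_eq_iff.2 ?_
        filter_upwards [hG.eventually_analyticAt] with z h2
        rw [fderiv_const_mul h2.differentiableAt]
        rfl }
    (by
      intro x y
      obtain ⟨F, hF, rfl⟩ := exists_rep x
      obtain ⟨G, hG, rfl⟩ := exists_rep y
      simp only [LinearMap.coe_mk, AddHom.coe_mk, smul_eq_mul]
      rw [germ_mul, key, key, key, germ_mul, germ_mul, germ_add]
      refine germ_eq_iff.2 ?_
      filter_upwards [hF.eventually_analyticAt, hG.eventually_analyticAt] with z h1 h2
      rw [fderiv_fun_mul h1.differentiableAt h2.differentiableAt]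
      simp)

lemma dirDeriv_germ (v : E) {F : E → ℂ} (hF : AnalyticAt ℂ F 0) :
    dirDeriv v (germ F hF) = germ (fun z => fderiv ℂ F z v) (hF.dirDeriv v) := by
  have h := germ_eq_iff.1 (exists_rep (germ F hF)).choose_spec.choose_spec
  change germ (fun z => fderiv ℂ (exists_rep (germ F hF)).choose z v)
        ((exists_rep (germ F hF)).choose_spec.choose.dirDeriv v) = _
  refine germ_eq_iff.2 ?_
  filter_upwards [h.symm.fderiv (𝕜 := ℂ)] with z hz
  rw [hz]

/-- The chain rule for the composition with a linear map. -/
lemma germMap_dirDeriv (a : E' →L[ℂ] E) (v : E') (φ : AnalyticGerm E) :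
    germMap a (dirDeriv (a v) φ) = dirDeriv v (germMap a φ) := by
  obtain ⟨F, hF, rfl⟩ := exists_rep φ
  rw [dirDeriv_germ, germMap_germ, germMap_germ, dirDeriv_germ]
  refine germ_eq_iff.2 ?_
  have : ∀ᶠ z in 𝓝 (0 : E'), AnalyticAt ℂ F (a z) :=
    (a.continuous.tendsto' 0 0 (map_zero a)).eventually hF.eventually_analyticAt
  filter_upwards [this] with z hz
  have h := (hz.differentiableAt.hasFDerivAt.comp z a.hasFDerivAt).fderiv
  change fderiv ℂ (fun z => F (a z)) z = _ at h
  rw [h]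
  rfl

lemma dirDeriv_linGerm (v : E) (l : E →L[ℂ] ℂ) :
    dirDeriv v (linGerm l) = algebraMap ℂ _ (l v) := by
  rw [linGerm, dirDeriv_germ, algebraMap_germ]
  refine germ_eq_iff.2 (Eventually.of_forall fun z => ?_)
  simp

lemma dirDeriv_add (v w : E) (φ : AnalyticGerm E) :
    dirDeriv (v + w) φ = dirDeriv v φ + dirDeriv w φ := by
  obtain ⟨F, hF, rfl⟩ := exists_rep φ
  rw [dirDeriv_germ, dirDeriv_germ, dirDeriv_germ, germ_add]
  exact germ_eq_iff.2 (Eventually.of_forall fun z => by simp)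

lemma dirDeriv_smul (c : ℂ) (v : E) (φ : AnalyticGerm E) :
    dirDeriv (c • v) φ = c • dirDeriv v φ := by
  obtain ⟨F, hF, rfl⟩ := exists_rep φ
  rw [dirDeriv_germ, dirDeriv_germ, Algebra.smul_def, algebraMap_germ, germ_mul]
  exact germ_eq_iff.2 (Eventually.of_forall fun z => by simp)

lemma idealOf_eq_span {S : Set (E → ℂ)} (hS : ∀ F ∈ S, AnalyticAt ℂ F 0) :
    idealOf S = Ideal.span {φ | ∃ F, ∃ h : F ∈ S, φ = germ F (hS F h)} := by
  unfold idealOf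
  congr 1
  ext φ
  constructor
  · rintro ⟨F, h, e⟩
    exact ⟨F, h, Subtype.ext e⟩
  · rintro ⟨F, h, rfl⟩
    exact ⟨F, h, rfl⟩

lemma idealOf_singleton {F : E → ℂ} (hF : AnalyticAt ℂ F 0) :
    idealOf {F} = Ideal.span {germ F hF} := by
  rw [idealOf_eq_span (by simpa using hF)]
  congr 1
  ext φ
  simp

lemma idealOf_pair {F G : E → ℂ} (hF : AnalyticAt ℂ F 0) (hG : AnalyticAt ℂ G 0) :
    idealOf {F, G} = Ideal.span {germ F hF, germ G hG} := by
  rw [idealOf_eq_span (by simpa using ⟨hF, hG⟩)]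
  congr 1
  ext φ
  constructor
  · rintro ⟨_, rfl | rfl, rfl⟩
    · exact Or.inl rfl
    · exact Or.inr rfl
  · rintro (rfl | rfl)
    · exact ⟨F, Or.inl rfl, rfl⟩
    · exact ⟨G, Or.inr rfl, rfl⟩

lemma jacobianIdeal_eq {F : E → ℂ} (hF : AnalyticAt ℂ F 0) :
    jacobianIdeal F = Ideal.span (Set.range fun v => dirDeriv v (germ F hF)) := by
  rw [jacobianIdeal, idealOf_eq_span (by rintro _ ⟨v, rfl⟩; exact hF.dirDeriv v)]
  congr 1
  ext φ
  constructor
  · rintro ⟨_, ⟨v, rfl⟩, rfl⟩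
    exact ⟨v, dirDeriv_germ v hF⟩
  · rintro ⟨v, rfl⟩
    exact ⟨_, ⟨v, rfl⟩, dirDeriv_germ v hF⟩

/-- A nonzero germ has a nonzero restriction to some line through the origin. -/
lemma exists_germMap_line_ne_zero [Nontrivial E] {φ : AnalyticGerm E} (hφ : φ ≠ 0) :
    ∃ v : E, v ≠ 0 ∧ germMap (ContinuousLinearMap.toSpanSingleton ℂ v) φ ≠ 0 := by
  obtain ⟨F, hF, rfl⟩ := exists_rep φ
  by_contra! H
  apply hφ
  rw [germ_eq_zero_iff]
  obtain ⟨ε, hε, Hε⟩ := Metric.eventually_nhds_iff_ball.1 hF.eventually_analyticAt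
  have hne : ∀ v : E, v ≠ 0 → v ∈ Metric.ball (0 : E) ε → F v = 0 := by
    intro v hv hvε
    have h0 := H v hv
    rw [germMap_germ, germ_eq_zero_iff] at h0
    set l := ContinuousLinearMap.toSpanSingleton ℂ v
    have han : AnalyticOnNhd ℂ (fun t => F (l t)) (l ⁻¹' Metric.ball 0 ε) := fun t ht =>
      AnalyticAt.comp (g := F) (Hε _ ht) (l.analyticAt t)
    have hpre : IsPreconnected (l ⁻¹' Metric.ball 0 ε) := by
      let : NormedSpace ℝ E := NormedSpace.restrictScalars ℝ ℂ E
      have : Convex ℝ (l ⁻¹' Metric.ball 0 ε) :=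
        (convex_ball (0 : E) ε).is_linear_preimage
          ⟨l.map_add, fun c x => by
            have := l.map_smul (c : ℂ) x
            simpa using this⟩
      exact this.isPreconnected
    have h1 := han.eqOn_zero_of_preconnected_of_eventuallyEq_zero hpre (z₀ := 0)
      (by simp [l, hε]) h0 (x := 1) (by simpa [l] using hvε)
    simpa [l] using h1
  have h0 : F 0 = 0 := by
    obtain ⟨v, hv⟩ := exists_ne (0 : E)
    have h0 := H v hv
    rw [germMap_germ, germ_eq_zero_iff] at h0
    simpa using h0.self_of_nhds
  filter_upwards [Metric.ball_mem_nhds _ hε] with z hz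
  by_cases hz0 : z = 0
  · rw [hz0, h0]
  · exact hne z hz0 hz

end Germs

/-! ### Germs of functions of one variable -/

section OneVariable

/-- The coordinate of `ℂ`, a uniformizer of the ring of germs of functions of one variable. -/
def uniformizer : AnalyticGerm ℂ := linGerm (ContinuousLinearMap.id ℂ ℂ)

lemma uniformizer_eq : uniformizer = germ (fun z : ℂ => z) analyticAt_id := rfl

lemma exists_eq_pow_mul_unit {φ : AnalyticGerm ℂ} (hφ : φ ≠ 0) :
    ∃ (n : ℕ) (u : (AnalyticGerm ℂ)ˣ), φ = uniformizer ^ n * u := by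
  obtain ⟨F, hF, rfl⟩ := exists_rep φ
  rw [Ne, germ_eq_zero_iff, ← hF.exists_eventuallyEq_pow_smul_nonzero_iff] at hφ
  obtain ⟨n, g, hg, hg0, H⟩ := hφ
  refine ⟨n, (isUnit_iff_evalZero (φ := germ g hg).2 hg0).unit, ?_⟩
  rw [IsUnit.unit_spec, uniformizer_eq, germ_pow, germ_mul]
  refine germ_eq_iff.2 ?_
  filter_upwards [H] with z hz
  rw [hz]
  simp

lemma irreducible_uniformizer : Irreducible uniformizer := by
  refine ⟨fun h => isUnit_iff_evalZero.1 h rfl, fun a b hab => ?_⟩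
  by_contra! H
  rw [isUnit_iff_evalZero, isUnit_iff_evalZero, not_not, not_not] at H
  have h := congrArg (dirDeriv (1 : ℂ)) hab
  rw [uniformizer, dirDeriv_linGerm, Derivation.leibniz] at h
  have := congrArg evalZero h
  simp [H.1, H.2] at this

instance : IsDiscreteValuationRing (AnalyticGerm ℂ) := by
  refine IsDiscreteValuationRing.ofHasUnitMulPowIrreducibleFactorization
    ⟨uniformizer, irreducible_uniformizer, fun {x} hx => ?_⟩
  obtain ⟨n, u, rfl⟩ := exists_eq_pow_mul_unit hx
  exact ⟨n, u, rfl⟩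

/-- The length of the quotient by a germ in one variable is its order of vanishing. -/
lemma ord_uniformizer_pow_mul_unit (n : ℕ) (u : (AnalyticGerm ℂ)ˣ) :
    Ring.ord (AnalyticGerm ℂ) (uniformizer ^ n * u) = n := by
  rw [Ring.ord_mul_of_isUnit_right u.isUnit, Ring.ord_pow
    (mem_nonZeroDivisors_of_ne_zero irreducible_uniformizer.ne_zero),
    Ring.ord_of_irreducible irreducible_uniformizer]
  simp

/-- Differentiation lowers the order of vanishing by one. -/
lemma ord_dirDeriv_add_one {φ : AnalyticGerm ℂ} (hφ : φ ≠ 0) (h0 : evalZero φ = 0) :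
    dirDeriv (1 : ℂ) φ ≠ 0 ∧
    Ring.ord (AnalyticGerm ℂ) (dirDeriv (1 : ℂ) φ) + 1 = Ring.ord (AnalyticGerm ℂ) φ := by
  obtain ⟨n, u, rfl⟩ := exists_eq_pow_mul_unit hφ
  obtain _ | n := n
  · simp at h0
    exact absurd h0 (isUnit_iff_evalZero.1 u.isUnit)
  · have h1 : dirDeriv (1 : ℂ) (uniformizer ^ (n + 1) * (u : AnalyticGerm ℂ)) = uniformizer ^ n *
        (((n + 1 : ℕ) : AnalyticGerm ℂ) * u + uniformizer * dirDeriv (1 : ℂ) (u : AnalyticGerm ℂ)) := by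
      rw [Derivation.leibniz, Derivation.leibniz_pow, uniformizer, dirDeriv_linGerm]
      simp only [ContinuousLinearMap.id_apply, map_one, smul_eq_mul, Nat.add_sub_cancel,
        nsmul_eq_mul, mul_one]
      ring
    have h2 : IsUnit (((n + 1 : ℕ) : AnalyticGerm ℂ) * u +
        uniformizer * dirDeriv (1 : ℂ) (u : AnalyticGerm ℂ)) := by
      rw [isUnit_iff_evalZero]
      have : evalZero uniformizer = 0 := rfl
      simp only [map_add, map_mul, this, zero_mul, add_zero, map_natCast]
      exact mul_ne_zero (Nat.cast_ne_zero.2 n.succ_ne_zero) (isUnit_iff_evalZero.1 u.isUnit)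
    rw [h1]
    refine ⟨mul_ne_zero (pow_ne_zero _ irreducible_uniformizer.ne_zero) h2.ne_zero, ?_⟩
    rw [ord_uniformizer_pow_mul_unit, ← h2.unit_spec, ord_uniformizer_pow_mul_unit]
    push_cast
    rfl

end OneVariable

/-! ### The ring of germs in two variables: division, Noetherianity, unique factorization -/

lemma finite_of_monic_of_surjective {R A : Type*} [CommRing R] [CommRing A]
    (φ : Polynomial R →+* A) {W : Polynomial R} (hW : W.Monic) (hφ : φ W = 0)
    (hsurj : Function.Surjective φ) : (φ.comp Polynomial.C).Finite := by
  have h1 : ∀ P ∈ Ideal.span {W}, φ P = 0 := by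
    intro P hP
    obtain ⟨c, rfl⟩ := Ideal.mem_span_singleton.1 hP
    rw [map_mul, hφ, zero_mul]
  have h2 : (algebraMap R (Polynomial R ⧸ Ideal.span {W})).Finite := by
    rw [RingHom.finite_algebraMap]
    exact hW.finite_quotient
  exact (RingHom.Finite.of_surjective (Ideal.Quotient.lift (Ideal.span {W}) φ h1)
    (Ideal.Quotient.lift_surjective_of_surjective _ h1 hsurj)).comp h2

lemma isNoetherianRing_of_finite {R A : Type*} [CommRing R] [CommRing A] [IsNoetherianRing R]
    (φ : R →+* A) (hφ : φ.Finite) : IsNoetherianRing A := by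
  let := φ.toAlgebra
  have : Module.Finite R A := hφ
  have : IsNoetherian R A := isNoetherian_of_isNoetherianRing_of_finite R A
  exact isNoetherian_of_tower R this

/-- An ideal is finitely generated if its image modulo a finitely generated ideal contained in it is
so. -/
lemma fg_of_fg_quotient {A : Type*} [CommRing A] (I J : Ideal A) (hJ : J.FG) (hle : J ≤ I)
    (hI : (I.map (Ideal.Quotient.mk J)).FG) : I.FG := by
  obtain ⟨s, hs⟩ := hJ
  obtain ⟨t, ht, ht'⟩ := (Submodule.fg_def.1 hI)
  have hsub : ∀ x ∈ t, ∃ y ∈ I, Ideal.Quotient.mk J y = x := by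
    intro x hx
    have : x ∈ I.map (Ideal.Quotient.mk J) := ht' ▸ Submodule.subset_span hx
    exact (Ideal.mem_map_iff_of_surjective _ Ideal.Quotient.mk_surjective).1 this
  choose! y hyI hy using hsub
  have hle' : Ideal.span (y '' t) ≤ I := Ideal.span_le.2 (by rintro _ ⟨x, hx, rfl⟩; exact hyI x hx)
  have hmap : (Ideal.span (y '' t)).map (Ideal.Quotient.mk J) = I.map (Ideal.Quotient.mk J) := by
    rw [Ideal.map_span, ← ht', Set.image_image]
    refine congrArg Ideal.span ?_
    exact (Set.image_congr hy).trans (Set.image_id' t)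
  have : I = Ideal.span (y '' t) ⊔ J := by
    have h1 := congrArg (Ideal.comap (Ideal.Quotient.mk J)) hmap
    rw [Ideal.comap_map_of_surjective _ Ideal.Quotient.mk_surjective,
      Ideal.comap_map_of_surjective _ Ideal.Quotient.mk_surjective, ← RingHom.ker_eq_comap_bot,
      Ideal.mk_ker, sup_eq_left.2 hle] at h1
    exact h1.symm
  rw [this]
  exact Submodule.FG.sup (Submodule.fg_def.2 ⟨_, ht.image y, rfl⟩) ⟨s, hs⟩

section Plane

variable (b : Module.Basis (Fin 2) ℂ (Fin 2 → ℂ))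

/-- The linear isomorphism `(x, y) ↦ x b₀ + y b₁`. -/
def planeEquiv : (ℂ × ℂ) ≃L[ℂ] (Fin 2 → ℂ) :=
  (b.equivFun.trans (LinearEquiv.finTwoArrow ℂ ℂ)).symm.toContinuousLinearEquiv

lemma planeEquiv_symm_apply (z : Fin 2 → ℂ) :
    (planeEquiv b).symm z = (b.coord 0 z, b.coord 1 z) := rfl

lemma planeEquiv_apply (x y : ℂ) : planeEquiv b (x, y) = x • b 0 + y • b 1 := by
  rw [← ContinuousLinearEquiv.eq_symm_apply, planeEquiv_symm_apply]
  simp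

/-- A coordinate, as a continuous linear form. -/
def coordL (i : Fin 2) : (Fin 2 → ℂ) →L[ℂ] ℂ := LinearMap.toContinuousLinearMap (b.coord i)

lemma coordL_apply (i : Fin 2) (z : Fin 2 → ℂ) : coordL b i z = b.coord i z := rfl

/-- The germ of a coordinate. -/
def coordGerm (i : Fin 2) : AnalyticGerm (Fin 2 → ℂ) := linGerm (coordL b i)

/-- The inclusion of the germs of functions of the coordinate `z₀` alone. -/
def pull : AnalyticGerm ℂ →+* AnalyticGerm (Fin 2 → ℂ) := germMap (coordL b 0)

/-- The restriction of germs to the line `V(z₀)`, parametrized by `t ↦ t b₁`. -/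
def restr : AnalyticGerm (Fin 2 → ℂ) →+* AnalyticGerm ℂ :=
  germMap (ContinuousLinearMap.toSpanSingleton ℂ (b 1))

lemma pull_uniformizer : pull b uniformizer = coordGerm b 0 := rfl

lemma restr_coordGerm_zero : restr b (coordGerm b 0) = 0 := by
  rw [restr, coordGerm, germMap_linGerm, ← linGerm_zero]
  congr 1
  ext
  simp [coordL_apply]

lemma restr_coordGerm_one : restr b (coordGerm b 1) = uniformizer := by
  rw [restr, coordGerm, germMap_linGerm, uniformizer]
  congr 1
  ext
  simp [coordL_apply]

lemma restr_pull (φ : AnalyticGerm ℂ) : restr b (pull b φ) = algebraMap ℂ _ (evalZero φ) := by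
  rw [restr, pull, germMap_comp, ← germMap_zero (E' := ℂ)]
  congr 1
  congr 1
  ext
  simp [coordL_apply]

@[simp] lemma evalZero_restr (φ : AnalyticGerm (Fin 2 → ℂ)) :
    evalZero (restr b φ) = evalZero φ := evalZero_germMap _ _

@[simp] lemma evalZero_coordGerm (i : Fin 2) : evalZero (coordGerm b i) = 0 :=
  (coordL b i).map_zero

lemma evalZero_uniformizer : evalZero uniformizer = 0 := rfl

/-- The substitution of `z₁` for the variable of a polynomial with coefficients in `ℂ{z₀}`. -/
def polyGerm : Polynomial (AnalyticGerm ℂ) →+* AnalyticGerm (Fin 2 → ℂ) :=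
  Polynomial.eval₂RingHom (pull b) (coordGerm b 1)

lemma polyGerm_C (c : AnalyticGerm ℂ) : polyGerm b (Polynomial.C c) = pull b c := by
  simp [polyGerm]

lemma polyGerm_X : polyGerm b Polynomial.X = coordGerm b 1 := by
  simp [polyGerm]

lemma restr_polyGerm (r : Polynomial (AnalyticGerm ℂ)) :
    restr b (polyGerm b r) = Polynomial.aeval uniformizer (r.map evalZero) := by
  rw [Polynomial.aeval_def, Polynomial.eval₂_map, polyGerm, Polynomial.coe_eval₂RingHom,
    Polynomial.hom_eval₂, restr_coordGerm_one]
  congr 1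
  ext1 c
  exact restr_pull b c

/-- Weierstrass division for germs: `G = Q F + r`, with `r` a polynomial in `z₁` over `ℂ{z₀}` of
degree less than the order `d` of `F` on the line `z₀ = 0`. -/
theorem exists_division {F : AnalyticGerm (Fin 2 → ℂ)} {d : ℕ} {u : (AnalyticGerm ℂ)ˣ}
    (hF : restr b F = uniformizer ^ d * u) (G : AnalyticGerm (Fin 2 → ℂ)) :
    ∃ (Q : AnalyticGerm (Fin 2 → ℂ)) (r : Polynomial (AnalyticGerm ℂ)), r.degree < d ∧
      G = Q * F + polyGerm b r := by
  obtain ⟨F, hFa, rfl⟩ := exists_rep F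
  obtain ⟨G, hGa, rfl⟩ := exists_rep G
  have hu0 := u.isUnit
  obtain ⟨u, hua, hu⟩ := exists_rep (u : AnalyticGerm ℂ)
  rw [hu] at hF hu0
  rw [restr, germMap_germ, uniformizer_eq, germ_pow, germ_mul] at hF
  have hF' := germ_eq_iff.1 hF
  have hpe : Tendsto (planeEquiv b).symm (𝓝 0) (𝓝 0) :=
    (planeEquiv b).symm.continuous.tendsto' 0 0 (map_zero _)
  obtain ⟨Q, c, hQ, hc, H⟩ := exists_weierstrass_division
    (hFa.comp_clm (planeEquiv b : ℂ × ℂ →L[ℂ] _)) (hGa.comp_clm (planeEquiv b : ℂ × ℂ →L[ℂ] _))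
    d u hua (isUnit_iff_evalZero.1 hu0) (by
      filter_upwards [hF'] with z hz
      rw [← hz]
      congr 1
      change planeEquiv b (0, z) = _
      rw [planeEquiv_apply]
      simp)
  refine ⟨germ _ (hQ.comp_clm ((planeEquiv b).symm : _ →L[ℂ] ℂ × ℂ)),
    ∑ i : Fin d, Polynomial.C (germ (c i) (hc i)) * Polynomial.X ^ (i : ℕ), ?_, ?_⟩
  · refine (Polynomial.degree_sum_le _ _).trans_lt ?_
    refine (Finset.sup_lt_iff (WithBot.bot_lt_coe d)).2 fun i _ => ?_
    refine (Polynomial.degree_C_mul_X_pow_le _ _).trans_lt ?_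
    exact Nat.cast_lt.2 i.2
  · rw [map_sum]
    have hsum : (∑ i : Fin d, polyGerm b (Polynomial.C (germ (c i) (hc i)) *
        Polynomial.X ^ (i : ℕ))) = germ (fun z => ∑ i : Fin d, c i (b.coord 0 z) *
          (b.coord 1 z) ^ (i : ℕ)) (Finset.analyticAt_fun_sum _ fun i _ =>
          ((hc i).comp_clm (coordL b 0)).fun_mul (((coordL b 1).analyticAt 0).fun_pow _)) := by
      refine Subtype.ext ?_
      rw [AddSubmonoidClass.coe_finsetSum]
      refine Eq.trans (b := ∑ i : Fin d, (((fun z => c i (b.coord 0 z) *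
          (b.coord 1 z) ^ (i : ℕ)) : (Fin 2 → ℂ) → ℂ) : Germ (𝓝 (0 : Fin 2 → ℂ)) ℂ)) ?_ ?_
      · refine Finset.sum_congr rfl fun i _ => ?_
        rw [map_mul, map_pow, polyGerm_C, polyGerm_X]
        rfl
      · have h1 := map_sum (Germ.coeRingHom (R := ℂ) (𝓝 (0 : Fin 2 → ℂ)))
          (fun i : Fin d => fun z : Fin 2 → ℂ => c i (b.coord 0 z) * (b.coord 1 z) ^ (i : ℕ))
          Finset.univ
        refine Eq.trans h1.symm ?_
        change Germ.ofFun _ = Germ.ofFun _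
        congr 1
        ext z
        simp
    rw [hsum, germ_mul, germ_add]
    refine germ_eq_iff.2 ?_
    filter_upwards [hpe.eventually H] with z hz
    have e1 : planeEquiv b ((planeEquiv b).symm z) = z := (planeEquiv b).apply_symm_apply z
    simp only [ContinuousLinearEquiv.coe_coe, e1] at hz
    exact hz

/-- Germs that vanish on the line `V(z₀)` are divisible by `z₀`. -/
lemma restr_eq_zero_iff {φ : AnalyticGerm (Fin 2 → ℂ)} : restr b φ = 0 ↔ coordGerm b 0 ∣ φ := by
  constructor
  · intro h
    -- divide by `z₀` itself, with the roles of the coordinates exchanged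
    set b' := b.reindex (Equiv.swap 0 1) with hb'
    have h1 : coordGerm b' 1 = coordGerm b 0 := by
      rw [coordGerm, coordGerm]
      congr 1
    obtain ⟨Q, r, hr, e⟩ := exists_division b' (F := coordGerm b 0) (d := 1) (u := 1) (by
      rw [← h1, restr_coordGerm_one]; simp) φ
    obtain ⟨c, rfl⟩ : ∃ c, r = Polynomial.C c := by
      refine ⟨_, Polynomial.eq_C_of_degree_le_zero ?_⟩
      exact Order.lt_succ_iff.1 hr
    have hc : restr b (polyGerm b' (Polynomial.C c)) = c := by
      rw [polyGerm_C, restr, pull, germMap_comp]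
      refine Eq.trans ?_ (germMap_id c)
      congr 2
      ext
      simp [coordL_apply, hb']
    have := congrArg (restr b) e
    rw [h, map_add, map_mul, restr_coordGerm_zero, mul_zero, zero_add, hc] at this
    rw [e, ← this]
    simp
  · rintro ⟨c, rfl⟩
    rw [map_mul, restr_coordGerm_zero, zero_mul]

lemma coordGerm_ne_zero (i : Fin 2) : coordGerm b i ≠ 0 := by
  intro h
  have := dirDeriv_linGerm (b i) (coordL b i)
  change dirDeriv (b i) (coordGerm b i) = _ at this
  rw [h, map_zero] at this
  have h2 := congrArg evalZero this
  simp [coordL_apply] at h2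

/-- A polynomial of degree less than `d` whose germ vanishes to order `d` at the origin is zero. -/
lemma eq_zero_of_uniformizer_pow_dvd {d : ℕ} {p : Polynomial ℂ} (hp : p.degree < d)
    (h : uniformizer ^ d ∣ Polynomial.aeval uniformizer p) : p = 0 := by
  by_contra hne
  obtain ⟨q, hq, hq0⟩ := Polynomial.exists_eq_pow_rootMultiplicity_mul_and_not_dvd p hne 0
  rw [map_zero, sub_zero] at hq hq0
  set k := p.rootMultiplicity 0
  have hunit : IsUnit (Polynomial.aeval uniformizer q) := by
    rw [isUnit_iff_evalZero]
    intro h0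
    apply hq0
    rw [Polynomial.X_dvd_iff, Polynomial.coeff_zero_eq_eval_zero]
    rw [Polynomial.aeval_def, Polynomial.hom_eval₂, evalZero_uniformizer] at h0
    have : evalZero.comp (algebraMap ℂ (AnalyticGerm ℂ)) = RingHom.id ℂ := by
      ext1 c
      simp
    rw [this] at h0
    exact h0
  have hk : k < d := by
    have h1 : (k : WithBot ℕ) ≤ p.degree := by
      rw [Polynomial.degree_eq_natDegree hne]
      have := Polynomial.natDegree_le_of_dvd (Dvd.intro _ hq.symm) hne
      simpa using this
    exact_mod_cast h1.trans_lt hp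
  rw [hq, map_mul, map_pow, Polynomial.aeval_X, hunit.dvd_mul_right] at h
  have := (pow_dvd_pow_iff irreducible_uniformizer.ne_zero irreducible_uniformizer.not_isUnit).1 h
  omega

/-- A remainder of Weierstrass division that is a multiple of `F` vanishes to every order in `z₀`:
restricted to `z₀ = 0` it is a polynomial of degree less than `d` divisible by `z₁ ^ d`, hence zero,
and a factor `z₀` can be cancelled. -/
lemma coeff_dvd_of_dvd_polyGerm {F : AnalyticGerm (Fin 2 → ℂ)} {d : ℕ} {u : (AnalyticGerm ℂ)ˣ}
    (hF : restr b F = uniformizer ^ d * u) (n : ℕ) {r : Polynomial (AnalyticGerm ℂ)}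
    (hr : r.degree < d) (h : F ∣ polyGerm b r) : Polynomial.C (uniformizer ^ n) ∣ r := by
  induction n generalizing r with
  | zero => simp
  | succ n ih =>
    have h1 : uniformizer ^ d ∣ Polynomial.aeval uniformizer (r.map evalZero) := by
      rw [← restr_polyGerm]
      exact (Dvd.intro _ hF.symm).trans (map_dvd (restr b) h)
    have h2 := eq_zero_of_uniformizer_pow_dvd
      (Polynomial.degree_map_le.trans_lt hr) h1
    have h3 : Polynomial.C uniformizer ∣ r := by
      rw [Polynomial.C_dvd_iff_dvd_coeff]
      intro i
      have h4 := congrArg (fun p => Polynomial.coeff p i) h2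
      simp only [Polynomial.coeff_map, Polynomial.coeff_zero] at h4
      by_cases h5 : r.coeff i = 0
      · rw [h5]; exact dvd_zero _
      obtain ⟨m, v, hv⟩ := exists_eq_pow_mul_unit h5
      rw [hv] at h4 ⊢
      cases m with
      | zero =>
        simp only [pow_zero, one_mul] at h4
        exact absurd h4 (isUnit_iff_evalZero.1 v.isUnit)
      | succ m => exact (dvd_pow_self _ m.succ_ne_zero).mul_right _
    obtain ⟨r', rfl⟩ := h3
    obtain ⟨Q, hQ⟩ := h
    rw [map_mul, polyGerm_C, pull_uniformizer] at hQ
    have h6 := congrArg (restr b) hQ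
    rw [map_mul, restr_coordGerm_zero, zero_mul, map_mul, hF] at h6
    have h7 : restr b Q = 0 := by
      rcases mul_eq_zero.1 h6.symm with h | h
      · exact absurd h (mul_ne_zero (pow_ne_zero _ irreducible_uniformizer.ne_zero) u.ne_zero)
      · exact h
    obtain ⟨Q', rfl⟩ := (restr_eq_zero_iff b).1 h7
    have h8 : polyGerm b r' = F * Q' := by
      refine mul_left_cancel₀ (coordGerm_ne_zero b 0) ?_
      rw [hQ]
      ring
    have h9 : r'.degree < d := by
      rwa [Polynomial.degree_C_mul irreducible_uniformizer.ne_zero] at hr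
    obtain ⟨r'', rfl⟩ := ih h9 ⟨Q', h8⟩
    exact ⟨r'', by rw [pow_succ', Polynomial.C_mul, mul_assoc]⟩

/-- The uniqueness part of Weierstrass division. -/
lemma eq_zero_of_dvd_polyGerm {F : AnalyticGerm (Fin 2 → ℂ)} {d : ℕ} {u : (AnalyticGerm ℂ)ˣ}
    (hF : restr b F = uniformizer ^ d * u) {r : Polynomial (AnalyticGerm ℂ)}
    (hr : r.degree < d) (h : F ∣ polyGerm b r) : r = 0 := by
  refine Polynomial.ext fun i => ?_
  rw [Polynomial.coeff_zero]
  by_contra h5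
  obtain ⟨m, v, hv⟩ := exists_eq_pow_mul_unit h5
  have h1 := (Polynomial.C_dvd_iff_dvd_coeff _ _).1 (coeff_dvd_of_dvd_polyGerm b hF (m + 1) hr h) i
  rw [hv, v.isUnit.dvd_mul_right,
    pow_dvd_pow_iff irreducible_uniformizer.ne_zero irreducible_uniformizer.not_isUnit] at h1
  omega

/-- **Weierstrass preparation theorem**, together with the resulting description of the quotient
by a regular germ. -/
theorem exists_weierstrass_polynomial {F : AnalyticGerm (Fin 2 → ℂ)} {d : ℕ}
    {u : (AnalyticGerm ℂ)ˣ} (hF : restr b F = uniformizer ^ d * u) :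
    ∃ W : Polynomial (AnalyticGerm ℂ), W.Monic ∧ W.natDegree = d ∧
      Associated F (polyGerm b W) ∧ ∀ P, F ∣ polyGerm b P ↔ W ∣ P := by
  obtain ⟨Q, r, hr, e⟩ := exists_division b hF (coordGerm b 1 ^ d)
  have hWm : (Polynomial.X ^ d - r).Monic := Polynomial.monic_X_pow_sub hr
  have hWd : (Polynomial.X ^ d - r).degree = (d : WithBot ℕ) := by
    rw [Polynomial.degree_sub_eq_left_of_degree_lt (by simpa using hr), Polynomial.degree_X_pow]
  have hWn : (Polynomial.X ^ d - r).natDegree = d := Polynomial.natDegree_eq_of_degree_eq_some hWd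
  have hWF : polyGerm b (Polynomial.X ^ d - r) = F * Q := by
    rw [map_sub, map_pow, polyGerm_X, e]
    ring
  refine ⟨Polynomial.X ^ d - r, hWm, hWn, ?_, fun P => ⟨fun h => ?_, ?_⟩⟩
  · have h1 := congrArg (restr b) e
    rw [map_pow, restr_coordGerm_one, map_add, map_mul, restr_polyGerm, hF] at h1
    have h2 : r.map evalZero = 0 := by
      refine eq_zero_of_uniformizer_pow_dvd (d := d) (Polynomial.degree_map_le.trans_lt hr) ?_
      rw [← sub_eq_iff_eq_add'.2 h1]
      exact dvd_sub (dvd_refl _) (Dvd.intro (restr b Q * u) (by ring))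
    rw [h2, map_zero, add_zero] at h1
    have h3 : restr b Q * u = 1 := by
      refine mul_left_cancel₀ (pow_ne_zero d irreducible_uniformizer.ne_zero) ?_
      rw [mul_one]
      conv_rhs => rw [h1]
      ring
    have h4 : IsUnit Q := by
      rw [isUnit_iff_evalZero, ← evalZero_restr b, ← isUnit_iff_evalZero]
      exact IsUnit.of_mul_eq_one _ h3
    exact ⟨h4.unit, by rw [hWF]; rfl⟩
  · rw [← Polynomial.modByMonic_eq_zero_iff_dvd hWm]
    refine eq_zero_of_dvd_polyGerm b hF ?_ ?_
    · rw [← hWd]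
      exact Polynomial.degree_modByMonic_lt _ hWm
    · rw [← Polynomial.modByMonic_add_div P (Polynomial.X ^ d - r)] at h
      rw [map_add, map_mul, hWF] at h
      exact (dvd_add_left (Dvd.intro (Q * polyGerm b (P /ₘ (Polynomial.X ^ d - r))) (by ring))).1 h
  · intro h
    exact (Dvd.intro _ hWF.symm).trans (map_dvd (polyGerm b) h)

/-- An irreducible regular germ is associated to an irreducible Weierstrass polynomial `W` over the
principal ideal domain `ℂ{z₀}`. By the Gauss lemma `W` is prime, and division by `W` reduces
products of germs to products of polynomials. -/
lemma prime_of_irreducible_of_restr_ne_zero {F : AnalyticGerm (Fin 2 → ℂ)} (hF : Irreducible F)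
    (hreg : restr b F ≠ 0) : Prime F := by
  obtain ⟨d, u, hdu⟩ := exists_eq_pow_mul_unit hreg
  obtain ⟨W, hWm, hWd, hFW, hdvd⟩ := exists_weierstrass_polynomial b hdu
  have hWirr : Irreducible W := by
    have hW1 : W ≠ 1 := by
      rintro rfl
      rw [map_one, associated_one_iff_isUnit] at hFW
      exact hF.not_isUnit hFW
    refine hWm.irreducible_iff_natDegree.2 ⟨hW1, ?_⟩
    intro f g hf hg hfg
    have hirr : Irreducible (polyGerm b f * polyGerm b g) := by
      rw [← map_mul, hfg]
      exact hFW.irreducible_iff.1 hF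
    have hdeg : f.natDegree + g.natDegree = d := by
      rw [← hf.natDegree_mul hg, hfg, hWd]
    -- a factor whose partner is a unit is divisible by `W`, hence has full degree
    have key : ∀ f' g' : Polynomial (AnalyticGerm ℂ), f'.Monic → g'.Monic → f' * g' = W →
        IsUnit (polyGerm b f') → d ≤ g'.natDegree := by
      intro f' g' _ hg' hfg' hu
      have h1 : F ∣ polyGerm b g' := by
        rw [← hu.dvd_mul_left, ← map_mul, hfg']
        exact hFW.dvd
      rw [← hWd]
      exact Polynomial.natDegree_le_of_dvd ((hdvd g').1 h1) hg'.ne_zero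
    rcases of_irreducible_mul hirr with h | h
    · left
      have := key f g hf hg hfg h
      omega
    · right
      have := key g f hg hf (by rw [mul_comm, hfg]) h
      omega
  have hWp := hWirr.prime
  refine ⟨hF.ne_zero, hF.not_isUnit, fun G H h => ?_⟩
  obtain ⟨Q1, r1, -, e1⟩ := exists_division b hdu G
  obtain ⟨Q2, r2, -, e2⟩ := exists_division b hdu H
  have h1 : W ∣ r1 * r2 := by
    rw [← hdvd, map_mul]
    have e3 : polyGerm b r1 * polyGerm b r2 =
        G * H - F * (Q1 * H + Q2 * polyGerm b r1) := by
      rw [e2, e1]; ring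
    rw [e3]
    exact dvd_sub h (Dvd.intro _ rfl)
  rcases hWp.dvd_or_dvd h1 with h2 | h2
  · left
    rw [e1]
    exact dvd_add (Dvd.intro_left _ rfl) ((hdvd _).2 h2)
  · right
    rw [e2]
    exact dvd_add (Dvd.intro_left _ rfl) ((hdvd _).2 h2)

/-- The quotient by a regular germ is a finite `ℂ{z₀}`-module. -/
lemma finite_quotient {F : AnalyticGerm (Fin 2 → ℂ)} (hreg : restr b F ≠ 0) :
    ((Ideal.Quotient.mk (Ideal.span {F})).comp (pull b)).Finite := by
  obtain ⟨d, u, hdu⟩ := exists_eq_pow_mul_unit hreg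
  obtain ⟨W, hWm, -, -, hdvd⟩ := exists_weierstrass_polynomial b hdu
  have h := finite_of_monic_of_surjective ((Ideal.Quotient.mk (Ideal.span {F})).comp (polyGerm b))
    hWm ?_ ?_
  · convert h using 1
    ext1 c
    simp [polyGerm_C]
  · rw [RingHom.comp_apply, Ideal.Quotient.eq_zero_iff_dvd, hdvd]
  · intro x
    obtain ⟨G, rfl⟩ := Ideal.Quotient.mk_surjective x
    obtain ⟨Q, r, -, e⟩ := exists_division b hdu G
    refine ⟨r, ?_⟩
    rw [RingHom.comp_apply, Ideal.Quotient.mk_eq_mk_iff_sub_mem, Ideal.mem_span_singleton, e]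
    exact ⟨-Q, by ring⟩

end Plane

lemma exists_basis_of_ne_zero {v : Fin 2 → ℂ} (hv : v ≠ 0) :
    ∃ b : Module.Basis (Fin 2) ℂ (Fin 2 → ℂ), b 1 = v := by
  obtain ⟨w, hw⟩ : ∃ w : Fin 2 → ℂ, w 0 * v 1 - w 1 * v 0 ≠ 0 := by
    by_cases h : v 1 = 0
    · refine ⟨![0, 1], ?_⟩
      simp only [Matrix.cons_val_zero, Matrix.cons_val_one]
      intro h0
      apply hv
      ext i
      fin_cases i
      · simpa using h0
      · exact h
    · exact ⟨![1, 0], by simpa using h⟩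
  have hli : LinearIndependent ℂ ![w, v] := by
    rw [LinearIndependent.pair_iff]
    intro s t hst
    have h0 := congrFun hst 0
    have h1 := congrFun hst 1
    simp only [Pi.add_apply, Pi.smul_apply, smul_eq_mul, Pi.zero_apply] at h0 h1
    constructor
    · refine (mul_eq_zero.1 (?_ : s * (w 0 * v 1 - w 1 * v 0) = 0)).resolve_right hw
      linear_combination v 1 * h0 - v 0 * h1
    · refine (mul_eq_zero.1 (?_ : t * (w 0 * v 1 - w 1 * v 0) = 0)).resolve_right hw
      linear_combination w 0 * h1 - w 1 * h0
  refine ⟨basisOfLinearIndependentOfCardEqFinrank hli (by simp), ?_⟩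
  rw [coe_basisOfLinearIndependentOfCardEqFinrank]
  rfl

/-- Every nonzero germ is regular in suitable coordinates. -/
lemma exists_basis_restr_ne_zero {φ : AnalyticGerm (Fin 2 → ℂ)} (hφ : φ ≠ 0) :
    ∃ b : Module.Basis (Fin 2) ℂ (Fin 2 → ℂ), restr b φ ≠ 0 := by
  obtain ⟨v, hv, h⟩ := exists_germMap_line_ne_zero hφ
  obtain ⟨b, rfl⟩ := exists_basis_of_ne_zero hv
  exact ⟨b, h⟩

/-- A nonzero ideal contains a germ that is regular in suitable coordinates, and the quotient by it
is finite over the discrete valuation ring `ℂ{z₀}`. -/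
instance : IsNoetherianRing (AnalyticGerm (Fin 2 → ℂ)) := by
  refine (isNoetherianRing_iff_ideal_fg _).2 fun I => ?_
  by_cases hI : I = ⊥
  · rw [hI]; exact Submodule.fg_bot
  obtain ⟨F, hFI, hF⟩ := Submodule.exists_mem_ne_zero_of_ne_bot hI
  obtain ⟨b, hb⟩ := exists_basis_restr_ne_zero hF
  have hN := isNoetherianRing_of_finite _ (finite_quotient b hb)
  exact fg_of_fg_quotient I (Ideal.span {F}) ⟨{F}, by simp⟩
    ((Ideal.span_singleton_le_iff_mem I).2 hFI) (hN.noetherian _)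

/-- The ring of germs in two variables is factorial: it is Noetherian, and its irreducible elements
are prime. -/
instance : UniqueFactorizationMonoid (AnalyticGerm (Fin 2 → ℂ)) where
  irreducible_iff_prime {F} := by
    refine ⟨fun h => ?_, Prime.irreducible⟩
    obtain ⟨b, hb⟩ := exists_basis_restr_ne_zero h.ne_zero
    exact prime_of_irreducible_of_restr_ne_zero b h hb

/-! ### Logarithmic derivatives on one-dimensional domains -/

section Algebraic

/-- The extension of a derivation of a domain to its field of fractions. -/
lemma exists_derivation_extension {k A K : Type*} [Field k] [CommRing A] [IsDomain A] [Algebra k A]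
    [Field K] [Algebra k K] [Algebra A K] [IsScalarTower k A K] [IsFractionRing A K]
    (d : Derivation k A A) :
    ∃ D : Derivation k K K, ∀ a : A, D (algebraMap A K a) = algebraMap A K (d a) := by
  -- a derivation is a section of the dual numbers, and these lift to localizations
  let g : A →+* TrivSqZeroExt K K :=
    { toFun := fun a => TrivSqZeroExt.inl (algebraMap A K a) + TrivSqZeroExt.inr (algebraMap A K (d a))
      map_one' := by
        simp
      map_mul' := fun a b => by
        ext
        · simp only [TrivSqZeroExt.fst_add, TrivSqZeroExt.fst_inl, TrivSqZeroExt.fst_inr, add_zero,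
            TrivSqZeroExt.fst_mul, map_mul]
        · simp only [TrivSqZeroExt.fst_add, TrivSqZeroExt.fst_inl, TrivSqZeroExt.fst_inr, add_zero,
            TrivSqZeroExt.snd_mul, TrivSqZeroExt.snd_add, TrivSqZeroExt.snd_inl,
            TrivSqZeroExt.snd_inr, zero_add, Derivation.leibniz, map_add, map_mul, smul_eq_mul,
            MulOpposite.smul_eq_mul_unop, MulOpposite.unop_op]
          ring
      map_zero' := by
        simp
      map_add' := fun a b => by
        simp only [map_add, TrivSqZeroExt.inl_add, TrivSqZeroExt.inr_add]
        abel }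
  have hg : ∀ y : nonZeroDivisors A, IsUnit (g y) := by
    intro y
    rw [TrivSqZeroExt.isUnit_iff_isUnit_fst]
    have : (g y).fst = algebraMap A K y := by simp [g]
    rw [this, isUnit_iff_ne_zero]
    exact IsFractionRing.to_map_ne_zero_of_mem_nonZeroDivisors y.2
  let G : K →+* TrivSqZeroExt K K := IsLocalization.lift hg
  have hG : ∀ a, G (algebraMap A K a) = g a := fun a => IsLocalization.lift_eq hg a
  have hfst : ∀ w, (G w).fst = w := by
    intro w
    have : ((TrivSqZeroExt.fstHom K K K).toRingHom).comp G = RingHom.id K := by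
      refine IsLocalization.ringHom_ext (nonZeroDivisors A) ?_
      ext1 a
      change (G (algebraMap A K a)).fst = algebraMap A K a
      rw [hG]
      simp [g]
    exact congrArg (fun h : K →+* K => h w) this
  refine ⟨Derivation.mk' { toFun := fun w => (G w).snd
                           map_add' := fun a b => by simp
                           map_smul' := fun c w => ?_ } ?_, fun a => ?_⟩
  · have hc : G (algebraMap k K c) = TrivSqZeroExt.inl (algebraMap k K c) := by
      rw [IsScalarTower.algebraMap_apply k A K, hG]
      ext <;> simp [g]
    rw [Algebra.smul_def, map_mul, hc]
    simp [Algebra.smul_def]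
  · intro a b
    simp only [LinearMap.coe_mk, AddHom.coe_mk, map_mul, TrivSqZeroExt.snd_mul, hfst]
    simp [mul_comm]
  · change (G (algebraMap A K a)).snd = _
    rw [hG]
    change (TrivSqZeroExt.inl (algebraMap A K a) + TrivSqZeroExt.inr (algebraMap A K (d a))).snd = _
    rw [TrivSqZeroExt.snd_add, TrivSqZeroExt.snd_inl, TrivSqZeroExt.snd_inr, zero_add]

open WithZero
open scoped Pointwise

/-- Let `δ` be a derivation of a discretely valued field with `δ x = x` for some `x` in the maximal
ideal. If the residue field consists of constants and `δ` is bounded on the valuation ring, then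
`δ` preserves the valuation of elements of the maximal ideal. -/
lemma valuation_logDeriv {k K : Type*} [Field k] [CharZero k] [Field K] [Algebra k K]
    (δ : Derivation k K K) (v : Valuation K ℤᵐ⁰) {x : K} (hx : v x < 1) (hx0 : x ≠ 0)
    (hδx : δ x = x) (hk : ∀ c : k, v (algebraMap k K c) ≤ 1)
    (hres : ∀ w, v w ≤ 1 → ∃ c : k, v (w - algebraMap k K c) < 1)
    (hbd : ∃ C : ℤᵐ⁰, ∀ w, v w ≤ 1 → v (δ w) ≤ C) {w : K} (hw : v w < 1) : v (δ w) = v w := by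
  have hk1 : ∀ c : k, c ≠ 0 → v (algebraMap k K c) = 1 := by
    intro c hc
    refine le_antisymm (hk c) ?_
    have h1 := hk c⁻¹
    rw [map_inv₀, map_inv₀] at h1
    have h2 : v (algebraMap k K c) ≠ 0 := by simpa using hc
    exact (inv_le_one₀ (zero_lt_iff.2 h2)).1 h1
  have hexp : ∀ a : ℤᵐ⁰, a ≠ 0 → ∃ n : ℤ, a = exp n := fun a h => ⟨log a, (exp_log h).symm⟩
  obtain ⟨e', he'⟩ := hexp (v x) (by simpa using hx0)
  have he'0 : e' < 0 := by
    rw [he', ← exp_zero, exp_lt_exp] at hx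
    exact hx
  obtain ⟨e, rfl⟩ : ∃ e : ℕ, e' = -e := ⟨e'.natAbs, by omega⟩
  have he0 : e ≠ 0 := by rintro rfl; simp at he'0
  -- the logarithmic derivative of `w` in terms of that of the unit `w ^ e / x ^ m`
  have key : ∀ w : K, w ≠ 0 → v w < 1 → ∃ (m : ℕ) (u : K), m ≠ 0 ∧ v u = 1 ∧
      algebraMap k K e * δ w = w * (algebraMap k K m + δ u / u) := by
    intro w hw0 hw
    obtain ⟨m', hm'⟩ := hexp (v w) (by simpa using hw0)
    have hm'0 : m' < 0 := by
      rw [hm', ← exp_zero, exp_lt_exp] at hw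
      exact hw
    obtain ⟨m, rfl⟩ : ∃ m : ℕ, m' = -m := ⟨m'.natAbs, by omega⟩
    have hm0 : m ≠ 0 := by rintro rfl; simp at hm'0
    have hu : v (w ^ e / x ^ m) = 1 := by
      rw [map_div₀, map_pow, map_pow, hm', he', ← exp_nsmul, ← exp_nsmul]
      have : e • (-m : ℤ) = m • (-e : ℤ) := by simp [mul_comm]
      rw [this, div_self exp_ne_zero]
    refine ⟨m, w ^ e / x ^ m, hm0, hu, ?_⟩
    have hδu : x ^ m * δ (w ^ e / x ^ m) + (w ^ e / x ^ m) * (m * x ^ m) =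
        e * w ^ (e - 1) * δ w := by
      have h1 : δ (x ^ m * (w ^ e / x ^ m)) = δ (w ^ e) := by
        congr 1
        field_simp
      rw [Derivation.leibniz, Derivation.leibniz_pow, Derivation.leibniz_pow, hδx] at h1
      simp only [smul_eq_mul, nsmul_eq_mul] at h1
      have h2 : x ^ (m - 1) * x = x ^ m := by
        rw [← pow_succ, Nat.sub_add_cancel (Nat.one_le_iff_ne_zero.2 hm0)]
      rw [h2] at h1
      rw [h1]
      ring
    have hwe : w ^ e = w ^ (e - 1) * w := by
      rw [← pow_succ, Nat.sub_add_cancel (Nat.one_le_iff_ne_zero.2 he0)]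
    simp only [map_natCast]
    generalize δ (w ^ e / x ^ m) = U at *
    have hwe0 : w ^ (e - 1) ≠ 0 := pow_ne_zero _ hw0
    rw [hwe] at hδu ⊢
    refine mul_left_cancel₀ hwe0 ?_
    rw [← mul_assoc, mul_comm (w ^ (e - 1)) (e : K), ← hδu]
    field_simp
    ring
  have hδc : ∀ (w : K) (c : k), δ (w - algebraMap k K c) = δ w := by
    intro w c
    rw [map_sub, Derivation.map_algebraMap, sub_zero]
  -- a bound on `δ` improves by one: subtracting its residue, which `δ` kills, from `w` leaves an
  -- element of the maximal ideal, to which `key` applies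
  have hstep : ∀ n : ℤ, 0 ≤ n → (∀ w, v w ≤ 1 → v (δ w) ≤ exp n) →
      ∀ w, v w ≤ 1 → v (δ w) ≤ exp (n - 1) := by
    intro n hn H w hw
    obtain ⟨c, hc⟩ := hres w hw
    rw [← hδc w c]
    generalize w - algebraMap k K c = w at hc
    by_cases hw0 : w = 0
    · simp [hw0]
    obtain ⟨m, u, hm0, hu, h⟩ := key w hw0 hc
    have h1 : v (δ w) = v w * v (algebraMap k K m + δ u / u) := by
      rw [← map_mul, ← h, map_mul, hk1 e (Nat.cast_ne_zero.2 he0), one_mul]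
    have h2 : v (algebraMap k K m + δ u / u) ≤ exp n := by
      refine (Valuation.map_add _ _ _).trans (max_le ?_ ?_)
      · rw [hk1 m (Nat.cast_ne_zero.2 hm0), ← exp_zero, exp_le_exp]
        exact hn
      · rw [map_div₀, hu, div_one]
        exact H u hu.le
    have h3 : v w ≤ exp (-1) := by
      obtain ⟨j, hj⟩ := hexp (v w) (by simpa using hw0)
      rw [hj, ← exp_zero, exp_lt_exp] at hc
      rw [hj, exp_le_exp]
      omega
    rw [h1, sub_eq_neg_add, exp_add]
    exact mul_le_mul' h3 h2
  -- hence `δ` maps the valuation ring to its maximal ideal, so that `m + δ u / u` is a unit in `key`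
  have hall : ∀ w, v w ≤ 1 → v (δ w) ≤ exp (-1) := by
    obtain ⟨C, hC⟩ := hbd
    obtain ⟨N, hN⟩ : ∃ N : ℕ, C ≤ exp (N : ℤ) := by
      by_cases hC0 : C = 0
      · exact ⟨0, by simp [hC0]⟩
      · obtain ⟨n, rfl⟩ := hexp C hC0
        exact ⟨n.natAbs, exp_le_exp.2 (by omega)⟩
    have : ∀ j : ℕ, j ≤ N + 1 → ∀ w, v w ≤ 1 → v (δ w) ≤ exp ((N : ℤ) - j) := by
      intro j
      induction j with
      | zero => exact fun _ w hw => by simpa using (hC w hw).trans hN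
      | succ j ih =>
        intro hj w hw
        have := hstep ((N : ℤ) - j) (by omega) (ih (by omega)) w hw
        push_cast
        rwa [← sub_sub]
    have h := this (N + 1) le_rfl
    have h2 : (N : ℤ) - ((N + 1 : ℕ) : ℤ) = -1 := by push_cast; ring
    rwa [h2] at h
  by_cases hw0 : w = 0
  · simp [hw0]
  obtain ⟨m, u, hm0, hu, h⟩ := key w hw0 hw
  have h1 : v (δ w) = v w * v (algebraMap k K m + δ u / u) := by
    rw [← map_mul, ← h, map_mul, hk1 e (Nat.cast_ne_zero.2 he0), one_mul]
  have hm1 := hk1 m (Nat.cast_ne_zero.2 hm0)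
  have h2 : v (δ u / u) < v (algebraMap k K m) := by
    rw [map_div₀, hu, div_one, hm1, ← exp_zero]
    exact (hall u hu.le).trans_lt (exp_lt_exp.2 (by norm_num))
  rw [h1, Valuation.map_add_eq_of_lt_left _ h2, hm1, mul_one]

/-- Two elements of a one-dimensional domain `A` whose quotient is a unit of an overring with
nonzero conductor have the same order: multiplication by either one maps the conductor-type ideal `y
B` of `A` to the same ideal. -/
lemma ord_eq_of_unit_in_overring {A K : Type*} [CommRing A] [IsDomain A] [IsNoetherianRing A]
    [Ring.KrullDimLE 1 A] [Field K] [Algebra A K] [IsFractionRing A K] (B : Subring K)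
    (hAB : ∀ a, algebraMap A K a ∈ B) {y : A} (hy : y ≠ 0)
    (hyB : ∀ b ∈ B, ∃ a, algebraMap A K a = algebraMap A K y * b) {f g : A} (hf : f ≠ 0)
    {ε : K} (hε : ε ∈ B) (hε' : ε⁻¹ ∈ B) (hε0 : ε ≠ 0)
    (h : algebraMap A K g = ε * algebraMap A K f) : Ring.ord A f = Ring.ord A g := by
  have hinj := IsFractionRing.injective A K
  have hg : g ≠ 0 := by
    rintro rfl
    rw [map_zero] at h
    exact mul_ne_zero hε0 ((map_ne_zero_iff _ hinj).2 hf) h.symm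
  let c : Ideal A :=
    { carrier := {a | ∃ b ∈ B, algebraMap A K a = algebraMap A K y * b}
      zero_mem' := ⟨0, B.zero_mem, by simp⟩
      add_mem' := by
        rintro a a' ⟨b, hb, e⟩ ⟨b', hb', e'⟩
        exact ⟨b + b', B.add_mem hb hb', by rw [map_add, e, e', mul_add]⟩
      smul_mem' := by
        rintro r a ⟨b, hb, e⟩
        refine ⟨algebraMap A K r * b, B.mul_mem (hAB r) hb, ?_⟩
        rw [smul_eq_mul, map_mul, e]
        ring }
  have hle : ∀ (f g : A) (ε : K), ε⁻¹ ∈ B → ε ≠ 0 → algebraMap A K g = ε * algebraMap A K f →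
      f • c ≤ g • c := by
    intro f g ε hε' hε0 h a ha
    obtain ⟨a, ⟨b, hb, e⟩, rfl⟩ := (Submodule.mem_smul_pointwise_iff_exists _ _ _).1 ha
    obtain ⟨a', ha'⟩ := hyB (ε⁻¹ * b) (B.mul_mem hε' hb)
    refine (Submodule.mem_smul_pointwise_iff_exists _ _ _).2 ⟨a', ⟨_, B.mul_mem hε' hb, ha'⟩, ?_⟩
    apply hinj
    rw [smul_eq_mul, smul_eq_mul, map_mul, map_mul, h, ha', e]
    field_simp
  have heq : f • c = g • c := by
    refine le_antisymm (hle f g ε hε' hε0 h) (hle g f ε⁻¹ (by rwa [inv_inv]) (inv_ne_zero hε0) ?_)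
    rw [h, inv_mul_cancel_left₀ hε0]
  have hlen : ∀ a : A, a ≠ 0 → Module.length A (A ⧸ a • c) =
      Module.length A (A ⧸ c) + Ring.ord A a := fun a ha =>
    Module.length_eq_add_of_exact (Ideal.mulQuot a c) (Ideal.quotOfMul a c)
      (Ideal.mulQuot_injective c (mem_nonZeroDivisors_of_ne_zero ha))
      (Ideal.quotOfMul_surjective c) (Ideal.exact_mulQuot_quotOfMul c)
  have hfin : Module.length A (A ⧸ c) ≠ ⊤ := by
    have h1 : Ideal.span {y} ≤ c :=
      (Ideal.span_singleton_le_iff_mem _).2 ⟨1, B.one_mem, by rw [mul_one]⟩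
    refine ne_top_of_le_ne_top (Ring.ord_ne_top (mem_nonZeroDivisors_of_ne_zero hy)) ?_
    exact Module.length_le_of_surjective (Submodule.factor h1) (Submodule.factor_surjective h1)
  have h1 := hlen f hf
  rw [heq, hlen g hg] at h1
  exact (WithTop.add_left_cancel hfin h1).symm

/-- The residue field of the integral closure of a local ring with algebraically closed residue
field `k` at a maximal ideal is `k` again. -/
lemma exists_sub_algebraMap_mem {k R B : Type*} [Field k] [IsAlgClosed k] [CommRing R] [Algebra k R]
    (π : R →+* k) [CommRing B] [Algebra R B] [Algebra k B] [IsScalarTower k R B]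
    [Algebra.IsIntegral R B] (P : Ideal B) [P.IsPrime]
    (hP : ∀ r, algebraMap R B (r - algebraMap k R (π r)) ∈ P) (b : B) :
    ∃ c : k, b - algebraMap k B c ∈ P := by
  have hint : Algebra.IsIntegral k (B ⧸ P) := by
    refine ⟨fun x => ?_⟩
    obtain ⟨b, rfl⟩ := Ideal.Quotient.mk_surjective x
    obtain ⟨p, hp, hpb⟩ := Algebra.IsIntegral.isIntegral (R := R) b
    refine ⟨p.map π, hp.map π, ?_⟩
    rw [Polynomial.eval₂_map]
    have h1 : (algebraMap k (B ⧸ P)).comp π = (Ideal.Quotient.mk P).comp (algebraMap R B) := by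
      ext1 r
      change Ideal.Quotient.mk P (algebraMap k B (π r)) = Ideal.Quotient.mk P (algebraMap R B r)
      rw [eq_comm, Ideal.Quotient.mk_eq_mk_iff_sub_mem]
      have := hP r
      rwa [map_sub, ← IsScalarTower.algebraMap_apply] at this
    rw [h1, ← Polynomial.hom_eval₂, hpb, map_zero]
  obtain ⟨c, hc⟩ := (IsAlgClosed.algebraMap_bijective_of_isIntegral (k := k) (K := B ⧸ P)).2
    (Ideal.Quotient.mk P b)
  refine ⟨c, ?_⟩
  rw [← Ideal.Quotient.mk_eq_mk_iff_sub_mem, ← hc]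
  rfl

/-- Let `A` be a local domain, finite over a discrete valuation ring `R`, whose residue field `k` is
algebraically closed of characteristic zero, and let `d` be a derivation of `A` with `d x ≠ 0` for a
nonunit `x` of `R`. Then `x d f / d x` and `f` have the same order for every nonunit `f` of `A`. In
geometric terms: along a curve branch, the vector field `x ∂/∂x` preserves orders of vanishing. -/
theorem ord_mul_derivation {k R A : Type*} [Field k] [IsAlgClosed k] [CharZero k]
    [CommRing R] [IsDomain R] [IsDiscreteValuationRing R] [Algebra k R]
    (π : R →+* k) (hπ : ∀ r, r - algebraMap k R (π r) ∈ IsLocalRing.maximalIdeal R)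
    [CommRing A] [IsDomain A] [IsLocalRing A] [Algebra k A] [Algebra R A] [IsScalarTower k R A]
    [Module.Finite R A] [FaithfulSMul R A] (d : Derivation k A A) {x : R}
    (hx : x ∈ IsLocalRing.maximalIdeal R) (hdx : d (algebraMap R A x) ≠ 0) {f : A}
    (hf : f ∈ IsLocalRing.maximalIdeal A) :
    (d f = 0 → f = 0) ∧
      Ring.ord A (algebraMap R A x * d f) = Ring.ord A (d (algebraMap R A x) * f) := by
  by_cases hf0 : f = 0
  · simp [hf0]
  let K := FractionRing A
  have : IsNoetherian R A := isNoetherian_of_isNoetherianRing_of_finite R A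
  have : IsNoetherianRing A := isNoetherian_of_tower R this
  have : Ring.DimensionLEOne A := Ring.DimensionLEOne.of_isIntegral R A
  have hinj : Function.Injective (algebraMap A K) := IsFractionRing.injective A K
  have hinjR : Function.Injective (algebraMap R A) := FaithfulSMul.algebraMap_injective R A
  let : Algebra (FractionRing R) K := FractionRing.liftAlgebra R K
  have : IsScalarTower R (FractionRing R) K := FractionRing.isScalarTower_liftAlgebra R K
  have hRchar : CharZero R := charZero_of_injective_algebraMap (algebraMap k R).injective
  have : CharZero (FractionRing R) :=
    charZero_of_injective_algebraMap (IsFractionRing.injective R (FractionRing R))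
  have : Module.IsTorsionFree R A := inferInstance
  have : FiniteDimensional (FractionRing R) K := inferInstance
  -- `B` is the normalization of the branch, a Dedekind domain whose maximal ideals are the points
  -- above the origin
  let B := integralClosure R K
  have : IsDedekindDomain B := integralClosure.isDedekindDomain_fractionRing R K
  have : IsFractionRing B K :=
    integralClosure.isFractionRing_of_finite_extension (FractionRing R) K
  have : Module.Finite R B := IsIntegralClosure.finite R (FractionRing R) K B
  have hAB : ∀ a : A, algebraMap A K a ∈ B := fun a =>
    (Algebra.IsIntegral.isIntegral (R := R) a).algebraMap
  let j : A →+* B := (algebraMap A K).codRestrict B.toSubring hAB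
  have hjR : ∀ r : R, j (algebraMap R A r) = algebraMap R B r := fun r => by
    apply Subtype.ext
    exact (IsScalarTower.algebraMap_apply R A K r).symm
  have hjK : ∀ a : A, algebraMap B K (j a) = algebraMap A K a := fun a => rfl
  -- maximal ideals of `B` lie over the maximal ideals of `R` and `A`
  have hRmax : ∀ P : Ideal B, P.IsMaximal → ∀ r ∈ IsLocalRing.maximalIdeal R,
      algebraMap R B r ∈ P := by
    intro P hP r hr
    have h1 := Ideal.isMaximal_comap_of_isIntegral_of_isMaximal (R := R) P
    rw [← IsLocalRing.eq_maximalIdeal h1] at hr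
    exact hr
  have hAmax : ∀ P : Ideal B, P.IsMaximal → ∀ a ∈ IsLocalRing.maximalIdeal A, j a ∈ P := by
    intro P hP a ha
    have hint : j.IsIntegral := by
      have h1 : (j.comp (algebraMap R A)).IsIntegral := by
        have : j.comp (algebraMap R A) = algebraMap R B := RingHom.ext hjR
        rw [this]
        exact algebraMap_isIntegral_iff.2 inferInstance
      exact RingHom.IsIntegral.tower_top _ _ h1
    have h1 := Ideal.isMaximal_comap_of_isIntegral_of_isMaximal' j hint P
    rw [← IsLocalRing.eq_maximalIdeal h1] at ha
    exact ha
  obtain ⟨D, hD⟩ := exists_derivation_extension (K := K) d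
  set X : K := algebraMap A K (algebraMap R A x) with hX
  set c : K := algebraMap A K (d (algebraMap R A x)) with hc
  have hx0 : x ≠ 0 := by
    rintro rfl
    simp at hdx
  have hX0 : X ≠ 0 := (map_ne_zero_iff _ hinj).2 ((map_ne_zero_iff _ hinjR).2 hx0)
  have hc0 : c ≠ 0 := (map_ne_zero_iff _ hinj).2 hdx
  -- the vector field `x ∂/∂x`
  let δ : Derivation k K K := (X / c) • D
  have hδ : ∀ w, δ w = X / c * D w := fun w => rfl
  have hδX : δ X = X := by
    rw [hδ, hX, hD, ← hc]
    exact div_mul_cancel₀ _ hc0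
  -- a common denominator of a set of generators of `B` and of their derivatives
  obtain ⟨s, hs⟩ := this
  classical
  obtain ⟨y₁, hy₁⟩ := IsLocalization.exist_integer_multiples_of_finset (nonZeroDivisors A)
    (s.image fun b : B => (b : K))
  obtain ⟨y₂, hy₂⟩ := IsLocalization.exist_integer_multiples_of_finset (nonZeroDivisors A)
    (s.image fun b : B => D (b : K))
  have hy₁0 : (y₁ : A) ≠ 0 := nonZeroDivisors.ne_zero y₁.2
  have hy₂0 : (y₂ : A) ≠ 0 := nonZeroDivisors.ne_zero y₂.2
  have hyB : ∀ b ∈ B, ∃ a, algebraMap A K a = algebraMap A K y₁ * b := by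
    intro b hb
    have hmem : (⟨b, hb⟩ : B) ∈ Submodule.span R (s : Set B) := hs ▸ Submodule.mem_top
    have h1 : ∀ b' : B, b' ∈ Submodule.span R (s : Set B) →
        ∃ a, algebraMap A K a = algebraMap A K y₁ * b' := by
      intro b' hb'
      induction hb' using Submodule.span_induction with
      | mem z hz =>
        obtain ⟨a, ha⟩ := hy₁ z (Finset.mem_image_of_mem _ hz)
        exact ⟨a, by rw [ha, Algebra.smul_def]⟩
      | zero => exact ⟨0, by simp⟩
      | add z z' _ _ h h' =>
        obtain ⟨a, ha⟩ := h
        obtain ⟨a', ha'⟩ := h'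
        exact ⟨a + a', by rw [map_add, ha, ha']; push_cast; ring⟩
      | smul r z _ h =>
        obtain ⟨a, ha⟩ := h
        refine ⟨algebraMap R A r * a, ?_⟩
        rw [map_mul, ha, ← IsScalarTower.algebraMap_apply, Subalgebra.coe_smul, Algebra.smul_def]
        ring
    exact h1 _ hmem
  have hDB : ∀ b : B, ∃ b' : B, (b' : K) = algebraMap A K (y₂ : A) * D (b : K) := by
    intro b
    have hmem : b ∈ Submodule.span R (s : Set B) := hs ▸ Submodule.mem_top
    induction hmem using Submodule.span_induction with
    | mem z hz =>
      obtain ⟨a, ha⟩ := hy₂ _ (Finset.mem_image_of_mem _ hz)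
      exact ⟨j a, by rw [← Algebra.smul_def]; exact ha⟩
    | zero => exact ⟨0, by simp⟩
    | add z z' _ _ h h' =>
      obtain ⟨a, ha⟩ := h
      obtain ⟨a', ha'⟩ := h'
      exact ⟨a + a', by push_cast; rw [ha, ha', map_add]; ring⟩
    | smul r z _ h =>
      obtain ⟨a, ha⟩ := h
      refine ⟨algebraMap R B r * a + j (y₂ * d (algebraMap R A r)) * z, ?_⟩
      have e1 : ((algebraMap R B r : B) : K) = algebraMap A K (algebraMap R A r) :=
        (IsScalarTower.algebraMap_apply R A K r)
      have e2 : ((j (y₂ * d (algebraMap R A r)) : B) : K) =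
        algebraMap A K y₂ * D (algebraMap A K (algebraMap R A r)) := by
        rw [hD, ← map_mul]; rfl
      push_cast
      rw [Algebra.smul_def, e2, ha, IsScalarTower.algebraMap_apply R A K, Derivation.leibniz]
      simp only [smul_eq_mul]
      ring
  -- `valuation_logDeriv` applies at every point of the normalization; the bound on `δ` there comes
  -- from the common denominator
  have hval : ∀ v : IsDedekindDomain.HeightOneSpectrum B, ∀ w : K, v.valuation K w < 1 →
      v.valuation K (δ w) = v.valuation K w := by
    intro v w hw
    have hkB : ∀ t : k, algebraMap k K t = algebraMap B K (algebraMap R B (algebraMap k R t)) := by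
      intro t
      rw [IsScalarTower.algebraMap_apply k A K, IsScalarTower.algebraMap_apply k R A, ← hjR, hjK]
    refine valuation_logDeriv δ (v.valuation K) (x := X) ?_ hX0 hδX ?_ ?_ ?_ hw
    · rw [hX, ← hjK, v.valuation_lt_one_iff_mem, hjR]
      exact hRmax _ v.isMaximal _ hx
    · intro t
      rw [hkB]
      exact v.valuation_le_one _
    · intro w hw
      obtain ⟨a, ha⟩ := v.exists_valuation_sub_lt_of_integer hw 1
      let : Algebra k B := ((algebraMap R B).comp (algebraMap k R)).toAlgebra
      have : IsScalarTower k R B := IsScalarTower.of_algebraMap_eq fun _ => rfl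
      obtain ⟨t, ht⟩ := exists_sub_algebraMap_mem π v.asIdeal
        (fun r => hRmax _ v.isMaximal _ (hπ r)) a
      refine ⟨t, ?_⟩
      replace ht : v.valuation K (algebraMap B K (a - algebraMap k B t)) < 1 :=
        (v.valuation_lt_one_iff_mem _).2 ht
      rw [map_sub] at ht
      have e : w - algebraMap k K t = (algebraMap B K a - algebraMap B K (algebraMap k B t)) -
          (algebraMap B K a - w) := by
        rw [hkB]
        change _ = (algebraMap B K a - algebraMap B K (algebraMap R B (algebraMap k R t))) - _
        ring
      rw [e]
      exact Valuation.map_sub_lt _ ht (by simpa using ha)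
    · set C := v.valuation K (X / c) * (v.valuation K (algebraMap A K (y₂ : A)))⁻¹ with hC
      refine ⟨C, fun w hw => ?_⟩
      obtain ⟨n, m, hnm⟩ := v.exists_primeCompl_mul_eq_of_integer w hw
      have hm : v.valuation K (algebraMap B K m) = 1 := v.valuation_eq_one_iff_notMem.2 m.2
      have hbd : ∀ b : B, v.valuation K (δ (algebraMap B K b)) ≤ C := by
        intro b
        obtain ⟨b', hb'⟩ := hDB b
        have h1 : D (b : K) = (algebraMap A K (y₂ : A))⁻¹ * b' := by
          rw [hb', inv_mul_cancel_left₀ ((map_ne_zero_iff _ hinj).2 hy₂0)]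
        change v.valuation K (X / c * D (b : K)) ≤ C
        rw [h1, ← mul_assoc, map_mul, map_mul, map_inv₀]
        exact mul_le_of_le_one_right' (v.valuation_le_one b')
      have h1 := congrArg δ hnm
      rw [Derivation.leibniz, smul_eq_mul, smul_eq_mul] at h1
      have h2 : algebraMap B K m * δ w = δ (algebraMap B K n) - w * δ (algebraMap B K m) := by
        rw [← h1]; ring
      have h3 : v.valuation K (δ w) = v.valuation K (algebraMap B K m * δ w) := by
        rw [map_mul, hm, one_mul]
      rw [h3, h2]
      refine (Valuation.map_sub _ _ _).trans (max_le (hbd n) ?_)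
      rw [map_mul]
      exact (mul_le_of_le_one_left' hw).trans (hbd m)
  have hvf : ∀ v : IsDedekindDomain.HeightOneSpectrum B,
      v.valuation K (δ (algebraMap A K f)) = v.valuation K (algebraMap A K f) := by
    intro v
    refine hval v _ ?_
    rw [← hjK, v.valuation_lt_one_iff_mem]
    exact hAmax _ v.isMaximal _ hf
  have hfK : algebraMap A K f ≠ 0 := (map_ne_zero_iff _ hinj).2 hf0
  have hdf : d f ≠ 0 := by
    intro h
    obtain ⟨P, hP⟩ := Ideal.exists_maximal B
    have hPbot : P ≠ ⊥ := by
      rintro rfl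
      have := hRmax _ hP x hx
      rw [Ideal.mem_bot, ← hjR] at this
      apply hX0
      rw [hX, ← hjK, this, map_zero]
    have := hvf ⟨P, hP.isPrime, hPbot⟩
    rw [hδ, hD, h, map_zero, mul_zero, map_zero, eq_comm, Valuation.zero_iff] at this
    exact hfK this
  refine ⟨fun h => absurd h hdf, ?_⟩
  -- the logarithmic derivative of `f` is a unit of `B`
  set ε := δ (algebraMap A K f) / algebraMap A K f with hε
  have hδf0 : δ (algebraMap A K f) ≠ 0 := by
    rw [hδ, hD]
    exact mul_ne_zero (div_ne_zero hX0 hc0) ((map_ne_zero_iff _ hinj).2 hdf)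
  have hmem : ∀ w : K, (∀ v : IsDedekindDomain.HeightOneSpectrum B, v.valuation K w ≤ 1) →
      w ∈ B.toSubring := by
    intro w hw
    obtain ⟨b, rfl⟩ := IsDedekindDomain.HeightOneSpectrum.mem_integers_of_valuation_le_one K w hw
    exact b.2
  have hε1 : ∀ v : IsDedekindDomain.HeightOneSpectrum B, v.valuation K ε = 1 := by
    intro v
    rw [hε, map_div₀, hvf v, div_self]
    exact (Valuation.ne_zero_iff _).2 hfK
  symm
  refine ord_eq_of_unit_in_overring B.toSubring hAB hy₁0 hyB (mul_ne_zero hdx hf0)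
    (hmem ε fun v => (hε1 v).le) (hmem ε⁻¹ fun v => ?_) (div_ne_zero hδf0 hfK) ?_
  · rw [map_inv₀, hε1 v, inv_one]
  · have aux : ∀ {F : Type _} [Field F] (X c u v : F), c ≠ 0 → v ≠ 0 →
        X * u = X / c * u / v * (c * v) := by
      intro F _ X c u v hc hv
      field_simp
    rw [map_mul, map_mul, hε, hδ, hD, ← hX, ← hc]
    exact aux _ _ _ _ hc0 hfK

end Algebraic

/-! ### Intersection multiplicities of plane curve germs -/

section Inter

/-- The intersection multiplicity of `a` and `c`: the length of the quotient by `(a, c)`. -/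
def interMult {R : Type*} [CommRing R] (a c : R) : ℕ∞ := Module.length R (R ⧸ Ideal.span {a, c})

section General

variable {R : Type*} [CommRing R]

lemma interMult_comm (a c : R) : interMult a c = interMult c a := by
  rw [interMult, interMult, Set.pair_comm]

lemma interMult_eq_of_span_eq {a c a' c' : R} (h : Ideal.span {a, c} = Ideal.span {a', c'}) :
    interMult a c = interMult a' c' := by
  rw [interMult, interMult, h]

lemma interMult_add_mul_left (a b c : R) : interMult (a + b * c) c = interMult a c :=
  interMult_eq_of_span_eq (Ideal.span_pair_add_mul_right ..)

lemma interMult_eq_zero_of_isUnit_left {a : R} (ha : IsUnit a) (c : R) : interMult a c = 0 := by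
  rw [interMult, Ideal.eq_top_of_isUnit_mem _ (Ideal.subset_span (Set.mem_insert a _)) ha]
  exact Module.length_eq_zero

lemma interMult_eq_zero_of_isUnit_right {c : R} (hc : IsUnit c) (a : R) : interMult a c = 0 := by
  rw [interMult_comm, interMult_eq_zero_of_isUnit_left hc]

lemma interMult_congr_left {a a' : R} (h : Associated a a') (c : R) :
    interMult a c = interMult a' c := by
  apply interMult_eq_of_span_eq
  obtain ⟨u, rfl⟩ := h
  rw [Ideal.span_insert, Ideal.span_insert, Ideal.span_singleton_mul_right_unit u.isUnit]

lemma one_le_interMult [IsLocalRing R] {a c : R} (ha : ¬ IsUnit a) (hc : ¬ IsUnit c) :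
    1 ≤ interMult a c := by
  rw [Order.one_le_iff_pos, interMult, Module.length_pos_iff]
  apply Ideal.Quotient.nontrivial_iff.2
  refine ne_top_of_le_ne_top (Ideal.IsPrime.ne_top' (I := IsLocalRing.maximalIdeal R)) ?_
  rw [Ideal.span_le]
  rintro x (rfl | rfl) <;> assumption

/-- On the curve `c = 0` the intersection multiplicity is the order of vanishing. -/
lemma interMult_eq_ord {A : Type*} [CommRing A] (φ : R →+* A) (hφ : Function.Surjective φ) {c : R}
    (hc : ∀ x, φ x = 0 ↔ c ∣ x) (a : R) : interMult a c = Ring.ord A (φ a) := by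
  let := φ.toAlgebra
  rw [Ring.ord, ← Module.length_eq_of_surjective (S := R) (R := A) hφ, interMult]
  let L : R →ₗ[R] A ⧸ Ideal.span {φ a} :=
    ((Ideal.Quotient.mkₐ R (Ideal.span {φ a})).comp (Algebra.ofId R A)).toLinearMap
  have hL : ∀ x, L x = Ideal.Quotient.mk _ (φ x) := fun x => rfl
  have hLs : Function.Surjective L := fun y => by
    obtain ⟨y, rfl⟩ := Ideal.Quotient.mk_surjective y
    obtain ⟨x, rfl⟩ := hφ y
    exact ⟨x, rfl⟩
  refine ((Submodule.quotEquivOfEq _ _ ?_).trans (L.quotKerEquivOfSurjective hLs)).length_eq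
  ext x
  rw [LinearMap.mem_ker, hL, Ideal.Quotient.eq_zero_iff_mem, Ideal.mem_span_singleton',
    Ideal.mem_span_pair]
  constructor
  · rintro ⟨s, t, rfl⟩
    refine ⟨φ s, ?_⟩
    rw [map_add, (hc (t * c)).2 (Dvd.intro_left _ rfl), add_zero, map_mul]
  · rintro ⟨y, hy⟩
    obtain ⟨s, rfl⟩ := hφ y
    obtain ⟨t, ht⟩ := (hc (x - s * a)).1 (by rw [map_sub, map_mul, hy, sub_self])
    exact ⟨s, t, by rw [mul_comm t, ← ht]; ring⟩

lemma interMult_le_of_dvd_left {a a' : R} (h : a ∣ a') (c : R) :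
    interMult a c ≤ interMult a' c := by
  rw [interMult_eq_ord (Ideal.Quotient.mk (Ideal.span {c})) Ideal.Quotient.mk_surjective
    (fun x => Ideal.Quotient.eq_zero_iff_dvd c x),
    interMult_eq_ord (Ideal.Quotient.mk (Ideal.span {c})) Ideal.Quotient.mk_surjective
    (fun x => Ideal.Quotient.eq_zero_iff_dvd c x)]
  exact Ring.ord_le_ord_of_dvd (map_dvd _ h)

/-- Additivity of the intersection multiplicity in the coprime case. -/
lemma interMult_mul_left_of_isRelPrime [IsDomain R] [UniqueFactorizationMonoid R] {a c : R}
    (h : IsRelPrime a c) (b : R) :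
    interMult (a * b) c = interMult a c + interMult b c := by
  have key := interMult_eq_ord (Ideal.Quotient.mk (Ideal.span {c})) Ideal.Quotient.mk_surjective
    (fun x => Ideal.Quotient.eq_zero_iff_dvd c x)
  rw [key, key, key, map_mul]
  refine Ring.ord_mul' _ (mem_nonZeroDivisors_iff_right.2 fun x hx => ?_)
  obtain ⟨x, rfl⟩ := Ideal.Quotient.mk_surjective x
  rw [← map_mul, Ideal.Quotient.eq_zero_iff_dvd] at hx
  rw [Ideal.Quotient.eq_zero_iff_dvd]
  exact h.symm.dvd_of_dvd_mul_right hx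

lemma length_eq_top_of_isDomain [IsDomain R] (h : ¬ IsField R) : Module.length R R = ⊤ := by
  by_contra H
  rw [← Ne, Module.length_ne_top_iff, isFiniteLength_iff_isNoetherian_isArtinian] at H
  obtain ⟨-, h2⟩ := H
  have : IsArtinianRing R := h2
  exact h (IsArtinianRing.isField_of_isDomain R)

lemma ord_ne_top_of_finite {A : Type*} [IsDomain R] [IsDiscreteValuationRing R] [CommRing A]
    [IsDomain A] (φ : R →+* A) (hφ : φ.Finite) {a : A} (ha : a ≠ 0) : Ring.ord A a ≠ ⊤ := by
  let := φ.toAlgebra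
  have : Module.Finite R A := hφ
  have : IsNoetherianRing A := isNoetherianRing_of_finite φ hφ
  have : Ring.DimensionLEOne A := Ring.DimensionLEOne.of_isIntegral R A
  exact Ring.ord_ne_top (mem_nonZeroDivisors_of_ne_zero ha)

end General

section Plane

variable (b : Module.Basis (Fin 2) ℂ (Fin 2 → ℂ))

local notation "𝒪" => AnalyticGerm (Fin 2 → ℂ)

lemma evalZero_dvd_eq_zero {E : Type*} [NormedAddCommGroup E] [NormedSpace ℂ E]
    {q φ : AnalyticGerm E} (h : q ∣ φ) (hq : evalZero q = 0) : evalZero φ = 0 := by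
  obtain ⟨c, rfl⟩ := h
  rw [map_mul, hq, zero_mul]

lemma not_isUnit_iff_evalZero {E : Type*} [NormedAddCommGroup E] [NormedSpace ℂ E]
    {q : AnalyticGerm E} : ¬ IsUnit q ↔ evalZero q = 0 := by
  rw [isUnit_iff_evalZero, not_not]

lemma restr_surjective : Function.Surjective (restr b) := by
  intro φ
  refine ⟨germMap (coordL b 1) φ, ?_⟩
  rw [restr, germMap_comp]
  have h : (coordL b 1).comp (ContinuousLinearMap.toSpanSingleton ℂ (b 1)) =
      ContinuousLinearMap.id ℂ ℂ := by
    ext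
    simp [coordL_apply]
  rw [h, germMap_id]

lemma isRelPrime_coordGerm : IsRelPrime (coordGerm b 0) (coordGerm b 1) := by
  intro q h0 h1
  have hr : restr b q ≠ 0 := by
    intro h
    have := map_dvd (restr b) h1
    rw [h, restr_coordGerm_one, zero_dvd_iff] at this
    exact irreducible_uniformizer.ne_zero this
  obtain ⟨c, hc⟩ := h0
  have h2 : restr b c = 0 := by
    have := congrArg (restr b) hc
    rw [restr_coordGerm_zero, map_mul, eq_comm, mul_eq_zero] at this
    exact this.resolve_left hr
  obtain ⟨c', rfl⟩ := (restr_eq_zero_iff b).1 h2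
  refine IsUnit.of_mul_eq_one c' (mul_left_cancel₀ (coordGerm_ne_zero b 0) ?_)
  rw [mul_one]
  nth_rw 2 [hc]
  ring

lemma prime_coordGerm_zero : Prime (coordGerm b 0) := by
  refine ⟨coordGerm_ne_zero b 0, by rw [isUnit_iff_evalZero]; simp, fun x y h => ?_⟩
  rw [← restr_eq_zero_iff, map_mul, mul_eq_zero] at h
  rwa [← restr_eq_zero_iff, ← restr_eq_zero_iff]

/-- Germs with a common component meet in infinite multiplicity. -/
lemma interMult_eq_top_of_not_isRelPrime {a c : 𝒪} (h : ¬ IsRelPrime a c) :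
    interMult a c = ⊤ := by
  obtain ⟨q, hq, hqa, hqc⟩ : ∃ q, Prime q ∧ q ∣ a ∧ q ∣ c := by
    by_contra! H
    by_cases hz : a = 0 ∧ c = 0
    · exact H _ (prime_coordGerm_zero (Pi.basisFun ℂ (Fin 2))) (hz.1 ▸ dvd_zero _)
        (hz.2 ▸ dvd_zero _)
    · exact h (WfDvdMonoid.isRelPrime_of_no_irreducible_factors hz
        fun z hz h1 h2 => H z (UniqueFactorizationMonoid.irreducible_iff_prime.1 hz) h1 h2)
  have h1 : interMult q q ≤ interMult a c := by
    refine (interMult_le_of_dvd_left hqa q).trans ?_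
    rw [interMult_comm a q, interMult_comm a c]
    exact interMult_le_of_dvd_left hqc a
  refine top_le_iff.1 (le_trans (le_of_eq ?_) h1)
  rw [interMult_eq_ord (Ideal.Quotient.mk (Ideal.span {q})) Ideal.Quotient.mk_surjective
    (fun x => Ideal.Quotient.eq_zero_iff_dvd q x),
    (Ideal.Quotient.eq_zero_iff_dvd q q).2 dvd_rfl, Ring.ord_zero, eq_comm]
  have hqp : (Ideal.span {q}).IsPrime := (Ideal.span_singleton_prime hq.ne_zero).2 hq
  refine length_eq_top_of_isDomain fun hF => ?_
  have hmax := Ideal.Quotient.maximal_of_isField _ hF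
  rw [IsLocalRing.isMaximal_iff] at hmax
  have hm : ∀ i, q ∣ coordGerm (Pi.basisFun ℂ (Fin 2)) i := fun i => by
    rw [← Ideal.mem_span_singleton, hmax, mem_maximalIdeal_iff, evalZero_coordGerm]
  exact hq.not_isUnit (isRelPrime_coordGerm _ (hm 0) (hm 1))

/-- A germ vanishes to finite order on an irreducible curve that it does not contain. -/
lemma interMult_ne_top_of_prime {a q : 𝒪} (hq : Prime q) (h : ¬ q ∣ a) : interMult a q ≠ ⊤ := by
  obtain ⟨b, hb⟩ := exists_basis_restr_ne_zero hq.ne_zero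
  have hqp : (Ideal.span {q}).IsPrime := (Ideal.span_singleton_prime hq.ne_zero).2 hq
  rw [interMult_eq_ord (Ideal.Quotient.mk (Ideal.span {q})) Ideal.Quotient.mk_surjective
    (fun x => Ideal.Quotient.eq_zero_iff_dvd q x)]
  exact ord_ne_top_of_finite _ (finite_quotient b hb)
    (fun H => h ((Ideal.Quotient.eq_zero_iff_dvd q a).1 H))

lemma interMult_ne_top {a c : 𝒪} (h : IsRelPrime a c) : interMult a c ≠ ⊤ := by
  induction c using UniqueFactorizationMonoid.induction_on_prime with
  | h₁ => rw [interMult_eq_zero_of_isUnit_left (isRelPrime_zero_right.1 h)]; simp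
  | h₂ c hc => rw [interMult_eq_zero_of_isUnit_right hc]; simp
  | h₃ c q hc hq ih =>
    rw [interMult_comm, interMult_mul_left_of_isRelPrime h.symm.of_mul_left_left]
    refine WithTop.add_ne_top.2 ⟨?_, ?_⟩
    · rw [interMult_comm]
      refine interMult_ne_top_of_prime hq fun hd => hq.not_isUnit (h hd (dvd_mul_right _ _))
    · rw [interMult_comm]
      exact ih h.symm.of_mul_left_right.symm

/-- The intersection multiplicity of two germs is finite exactly if they have no common component.
-/
lemma interMult_ne_top_iff {a c : 𝒪} : interMult a c ≠ ⊤ ↔ IsRelPrime a c :=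
  ⟨fun h => by_contra fun H => h (interMult_eq_top_of_not_isRelPrime H), interMult_ne_top⟩

/-- Additivity of the intersection multiplicity; both sides are infinite if there is a common
component. -/
lemma interMult_mul_left (a b c : 𝒪) :
    interMult (a * b) c = interMult a c + interMult b c := by
  by_cases ha : IsRelPrime a c
  · exact interMult_mul_left_of_isRelPrime ha b
  · rw [interMult_eq_top_of_not_isRelPrime ha, top_add]
    exact interMult_eq_top_of_not_isRelPrime fun h => ha h.of_mul_left_left

lemma interMult_mul_right (a b c : 𝒪) :
    interMult a (b * c) = interMult a b + interMult a c := by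
  rw [interMult_comm, interMult_mul_left, interMult_comm a, interMult_comm a]

/-- Intersecting with the line `z₀ = 0` is restricting to it. -/
lemma interMult_coordGerm_zero (φ : 𝒪) :
    interMult φ (coordGerm b 0) = Ring.ord (AnalyticGerm ℂ) (restr b φ) :=
  interMult_eq_ord (restr b) (restr_surjective b) (fun _ => restr_eq_zero_iff b) φ

lemma interMult_coordGerm_zero_ne_top {φ : 𝒪} (h : restr b φ ≠ 0) :
    interMult φ (coordGerm b 0) ≠ ⊤ := by
  rw [interMult_coordGerm_zero]
  exact Ring.ord_ne_top (mem_nonZeroDivisors_of_ne_zero h)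

lemma restr_dirDeriv (φ : 𝒪) : restr b (dirDeriv (b 1) φ) = dirDeriv 1 (restr b φ) := by
  have := germMap_dirDeriv (ContinuousLinearMap.toSpanSingleton ℂ (b 1)) 1 φ
  rw [ContinuousLinearMap.toSpanSingleton_apply, one_smul] at this
  exact this

/-- Differentiation along the line `z₀ = 0` lowers the intersection multiplicity with it by one. -/
lemma interMult_dirDeriv_add_one {φ : 𝒪} (h : restr b φ ≠ 0) (h0 : evalZero φ = 0) :
    restr b (dirDeriv (b 1) φ) ≠ 0 ∧
    interMult (dirDeriv (b 1) φ) (coordGerm b 0) + 1 = interMult φ (coordGerm b 0) := by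
  rw [interMult_coordGerm_zero, interMult_coordGerm_zero, restr_dirDeriv]
  exact ord_dirDeriv_add_one h (by rw [evalZero_restr, h0])

end Plane

end Inter

/-! ### The chain rule along a polar curve -/

section Chain

local notation "𝒪" => AnalyticGerm (Fin 2 → ℂ)

/-- The order comparison of `ord_mul_derivation` for a derivation that descends to a quotient. -/
lemma ord_mul_derivation_of_surjective {k R O A : Type*} [Field k] [IsAlgClosed k] [CharZero k]
    [CommRing R] [IsDomain R] [IsDiscreteValuationRing R] [Algebra k R]
    (π : R →+* k) (hπ : ∀ r, r - algebraMap k R (π r) ∈ IsLocalRing.maximalIdeal R)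
    [CommRing O] [Algebra k O] [CommRing A] [IsDomain A] [IsLocalRing A]
    (ψ : O →+* A) (hψ : Function.Surjective ψ) (ι : R →+* O)
    (hι : ∀ c, ι (algebraMap k R c) = algebraMap k O c) (hfin : (ψ.comp ι).Finite)
    (hinj : Function.Injective (ψ.comp ι)) (D : Derivation k O O)
    (hD : ∀ y, ψ y = 0 → ψ (D y) = 0) {x : R} (hx : x ∈ IsLocalRing.maximalIdeal R)
    (hdx : ψ (D (ι x)) ≠ 0) {f : O} (hf : ψ f ∈ IsLocalRing.maximalIdeal A) :
    (ψ (D f) = 0 → ψ f = 0) ∧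
      Ring.ord A (ψ (ι x * D f)) = Ring.ord A (ψ (D (ι x) * f)) := by
  let : Algebra R A := (ψ.comp ι).toAlgebra
  let : Algebra k A := (ψ.comp (algebraMap k O)).toAlgebra
  have : IsScalarTower k R A := IsScalarTower.of_algebraMap_eq fun c => congrArg ψ (hι c).symm
  have : Module.Finite R A := hfin
  have : FaithfulSMul R A := (faithfulSMul_iff_algebraMap_injective R A).2 hinj
  let ψ' : O →ₐ[k] A := { ψ with commutes' := fun _ => rfl }
  have key := ord_mul_derivation π hπ (Derivation.liftOfSurjective (f := ψ') (d := D) hψ hD) hx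
    (f := ψ f)
  have h1 : ∀ y, Derivation.liftOfSurjective (f := ψ') (d := D) hψ hD (ψ y) = ψ (D y) :=
    Derivation.liftOfSurjective_apply (f := ψ') hψ hD
  have h2 : algebraMap R A x = ψ (ι x) := rfl
  rw [h2, h1, h1, ← map_mul, ← map_mul] at key
  exact key hdx hf

variable (b : Module.Basis (Fin 2) ℂ (Fin 2 → ℂ))

lemma dirDeriv_coordGerm (i j : Fin 2) :
    dirDeriv (b i) (coordGerm b j) = if i = j then 1 else 0 := by
  rw [coordGerm, dirDeriv_linGerm, coordL_apply]
  simp only [Module.Basis.coord_apply, Module.Basis.repr_self, Finsupp.single_apply]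
  split_ifs <;> simp

lemma restr_ne_zero_of_dvd {q φ : 𝒪} (h : q ∣ φ) (hφ : restr b φ ≠ 0) : restr b q ≠ 0 := by
  rintro hq
  obtain ⟨c, rfl⟩ := h
  exact hφ (by rw [map_mul, hq, zero_mul])

/-- A regular nonunit does not divide its derivative along the line `z₀ = 0`. -/
lemma not_dvd_dirDeriv {s : 𝒪} (hreg : restr b s ≠ 0) (hs : evalZero s = 0) :
    ¬ s ∣ dirDeriv (b 1) s := by
  intro h
  obtain ⟨h1, h2⟩ := interMult_dirDeriv_add_one b hreg hs
  have h3 := interMult_le_of_dvd_left h (coordGerm b 0)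
  have h4 := interMult_coordGerm_zero_ne_top b h1
  rw [← h2] at h3
  exact absurd h3 (not_le.2 (ENat.lt_add_one_iff h4 |>.2 le_rfl))

/-- The chain rule along a branch `s = 0` of the polar curve `∂F/∂z₁ = 0`: along the branch
`dF = ∂F/∂z₀ dz₀`, so the orders of `F` and of `∂F/∂z₀ · z₀` agree. In particular a common component
of the partial derivatives of `F` lies on `F = 0`. -/
theorem interMult_chain_prime {s F : 𝒪} (hs : Prime s) (hreg : restr b s ≠ 0)
    (hsF : s ∣ dirDeriv (b 1) F) (hF : evalZero F = 0) :
    (s ∣ dirDeriv (b 0) F → s ∣ F) ∧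
      interMult F s = interMult (dirDeriv (b 0) F) s + interMult (coordGerm b 0) s := by
  have hs0 : evalZero s = 0 := not_isUnit_iff_evalZero.1 hs.not_isUnit
  have hsp : (Ideal.span {s}).IsPrime := (Ideal.span_singleton_prime hs.ne_zero).2 hs
  let A := 𝒪 ⧸ Ideal.span {s}
  let ψ : 𝒪 →+* A := Ideal.Quotient.mk (Ideal.span {s})
  have hψs : Function.Surjective ψ := Ideal.Quotient.mk_surjective
  have hψ : ∀ x, ψ x = 0 ↔ s ∣ x := fun x => Ideal.Quotient.eq_zero_iff_dvd s x
  have : IsLocalRing A := IsLocalRing.of_surjective' ψ hψs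
  -- the Hamiltonian vector field of `s`, which is tangent to the curve `s = 0`
  let D : Derivation ℂ 𝒪 𝒪 := dirDeriv (b 1) s • dirDeriv (b 0) - dirDeriv (b 0) s • dirDeriv (b 1)
  have hDa : ∀ y, D y = dirDeriv (b 1) s * dirDeriv (b 0) y - dirDeriv (b 0) s * dirDeriv (b 1) y :=
    fun y => rfl
  have hD : ∀ y, ψ y = 0 → ψ (D y) = 0 := by
    intro y hy
    obtain ⟨c, rfl⟩ := (hψ y).1 hy
    rw [hψ, Derivation.leibniz, hDa s, smul_eq_mul, smul_eq_mul]
    exact ⟨D c, by ring⟩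
  have hsx : ¬ s ∣ coordGerm b 0 := fun h => by
    have h1 := ((prime_coordGerm_zero b).irreducible.dvd_iff.1 h).resolve_left hs.not_isUnit
    exact hreg ((restr_eq_zero_iff b).2 h1.dvd)
  have hinj : Function.Injective (ψ.comp (pull b)) := by
    rw [injective_iff_map_eq_zero]
    intro c hc
    by_contra hc0
    obtain ⟨n, u, rfl⟩ := exists_eq_pow_mul_unit hc0
    rw [RingHom.comp_apply, hψ, map_mul, map_pow, pull_uniformizer] at hc
    rcases hs.dvd_or_dvd hc with h | h
    · exact hsx (hs.dvd_of_dvd_pow h)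
    · exact hs.not_isUnit (isUnit_of_dvd_unit h (u.isUnit.map (pull b)))
  have hDx : D (pull b uniformizer) = dirDeriv (b 1) s := by
    rw [hDa, pull_uniformizer, dirDeriv_coordGerm, dirDeriv_coordGerm]
    simp
  have hs1 := not_dvd_dirDeriv b hreg hs0
  obtain ⟨h1, h2⟩ := ord_mul_derivation_of_surjective (k := ℂ) (evalZero (E := ℂ))
    (fun r => by rw [mem_maximalIdeal_iff, map_sub, evalZero_algebraMap, sub_self])
    ψ hψs (pull b) (fun c => germMap_algebraMap _ c) (finite_quotient b hreg) hinj D hD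
    (x := uniformizer) (by rw [mem_maximalIdeal_iff, evalZero_uniformizer])
    (by rwa [hDx, Ne, hψ]) (f := F)
    (by
      rw [IsLocalRing.mem_maximalIdeal, mem_nonunits_iff]
      intro h
      obtain ⟨y, hy⟩ := h.exists_right_inv
      obtain ⟨y, rfl⟩ := hψs y
      rw [← map_mul, ← sub_eq_zero, ← map_one ψ, ← map_sub, hψ] at hy
      have h0 := evalZero_dvd_eq_zero hy hs0
      rw [map_sub, map_mul, hF, map_one] at h0
      norm_num at h0)
  have hDF : ψ (D F) = ψ (dirDeriv (b 1) s * dirDeriv (b 0) F) := by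
    rw [← sub_eq_zero, ← map_sub, hψ, hDa]
    obtain ⟨c, hc⟩ := hsF
    exact ⟨- (dirDeriv (b 0) s * c), by rw [hc]; ring⟩
  refine ⟨fun h => (hψ F).1 (h1 ?_), ?_⟩
  · rw [hDF, hψ]
    exact Dvd.dvd.mul_left h _
  · rw [map_mul, hDF, ← map_mul, hDx, pull_uniformizer, ← interMult_eq_ord ψ hψs hψ,
      ← interMult_eq_ord ψ hψs hψ, interMult_mul_left, interMult_mul_left, interMult_mul_left] at h2
    have h3 := interMult_ne_top_of_prime hs hs1
    have h4 : interMult (dirDeriv (b 1) s) s + (interMult (dirDeriv (b 0) F) s +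
        interMult (coordGerm b 0) s) = interMult (dirDeriv (b 1) s) s + interMult F s := by
      rw [← h2]; ring
    exact (ENat.add_right_injective_of_ne_top h3 h4).symm

/-- The chain rule along any part `S = 0` of the polar curve. -/
theorem interMult_chain {S F : 𝒪} (hreg : restr b S ≠ 0)
    (hSF : S ∣ dirDeriv (b 1) F) (hF : evalZero F = 0) :
    interMult F S = interMult (dirDeriv (b 0) F) S + interMult (coordGerm b 0) S := by
  induction S using UniqueFactorizationMonoid.induction_on_prime with
  | h₁ => simp at hreg
  | h₂ S hS => simp [interMult_eq_zero_of_isUnit_right hS]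
  | h₃ S q hS hq ih =>
    rw [interMult_mul_right, interMult_mul_right, interMult_mul_right,
      (interMult_chain_prime b hq (restr_ne_zero_of_dvd b (dvd_mul_right _ _) hreg)
        ((dvd_mul_right _ _).trans hSF) hF).2,
      ih (restr_ne_zero_of_dvd b (dvd_mul_left _ _) hreg) ((dvd_mul_left _ _).trans hSF)]
    ring

/-- Teissier's formula for the intersection multiplicity of a curve with its polar curve. -/
theorem interMult_dirDeriv_self {g : 𝒪} (hreg : restr b g ≠ 0) (hg : evalZero g = 0) :
    interMult (dirDeriv (b 1) g) g + 1 =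
      interMult (dirDeriv (b 0) g) (dirDeriv (b 1) g) + interMult g (coordGerm b 0) := by
  obtain ⟨h1, h2⟩ := interMult_dirDeriv_add_one b hreg hg
  rw [← h2, interMult_comm, interMult_chain b h1 dvd_rfl hg, interMult_comm (coordGerm b 0), add_assoc]

lemma span_range_dirDeriv (φ : 𝒪) : Ideal.span (Set.range fun v => dirDeriv v φ) =
    Ideal.span {dirDeriv (b 0) φ, dirDeriv (b 1) φ} := by
  apply le_antisymm
  · rw [Ideal.span_le]
    rintro _ ⟨v, rfl⟩
    have hv := b.sum_repr v
    rw [Fin.sum_univ_two] at hv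
    rw [SetLike.mem_coe, ← hv]
    simp only [dirDeriv_add, dirDeriv_smul]
    rw [Algebra.smul_def, Algebra.smul_def]
    exact Ideal.mem_span_pair.2 ⟨_, _, rfl⟩
  · apply Ideal.span_mono
    rintro _ (rfl | rfl) <;> exact ⟨_, rfl⟩

end Chain

/-! ### Multiplicities along the components of a divisor -/

section Divisor

variable {R : Type*} [CommRing R]

/-- The order of vanishing of `a` at the point `P`. -/
def ordAt (P : PrimeSpectrum R) (a : R) : ℕ∞ :=
  Ring.ord (Localization.AtPrime P.asIdeal) (algebraMap R _ a)

lemma ordAt_eq_zero {P : PrimeSpectrum R} {a : R} (ha : a ∉ P.asIdeal) : ordAt P a = 0 :=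
  Ring.ord_of_isUnit (IsLocalization.map_units _ (⟨a, ha⟩ : P.asIdeal.primeCompl))

lemma ordAt_congr (P : PrimeSpectrum R) {a c : R} (h : Associated a c) : ordAt P a = ordAt P c :=
  Ring.ord_eq_of_associated (h.map (algebraMap R _))

section

variable [UniqueFactorizationMonoid R]

open UniqueFactorizationMonoid

/-- Divisibility in a factorial ring can be tested on prime powers. -/
lemma dvd_of_forall_prime_pow_dvd {a c : R} (ha : a ≠ 0)
    (h : ∀ q n, Prime q → q ^ n ∣ a → q ^ n ∣ c) : a ∣ c := by
  induction a using induction_on_coprime with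
  | h0 => exact absurd rfl ha
  | h1 hx => exact hx.dvd
  | hpr n hp => exact h _ n hp dvd_rfl
  | hcp hxy hx hy =>
    exact hxy.mul_dvd (hx (left_ne_zero_of_mul ha) fun q n hq hd => h q n hq (hd.mul_right _))
      (hy (right_ne_zero_of_mul ha) fun q n hq hd => h q n hq (hd.mul_left _))

end

variable [IsDomain R]

open Classical in
/-- The point of the spectrum given by a prime element `s` (and the generic point if `s` is not
prime). -/
def branch (s : R) : PrimeSpectrum R :=
  if h : Prime s then ⟨Ideal.span {s}, (Ideal.span_singleton_prime h.ne_zero).2 h⟩ else ⊥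

lemma branch_asIdeal {s : R} (hs : Prime s) : (branch s).asIdeal = Ideal.span {s} := by
  rw [branch, dif_pos hs]

lemma mem_branch {s : R} (hs : Prime s) {x : R} : x ∈ (branch s).asIdeal ↔ s ∣ x := by
  rw [branch_asIdeal hs, Ideal.mem_span_singleton]

lemma branch_eq_branch {s t : R} (hs : Prime s) (ht : Prime t) :
    branch s = branch t ↔ Associated s t := by
  rw [PrimeSpectrum.ext_iff, branch_asIdeal hs, branch_asIdeal ht,
    Ideal.span_singleton_eq_span_singleton]

/-- The components of the divisor of `a`. -/
def branchSet (a : R) : Set (PrimeSpectrum R) := branch '' {s | Prime s ∧ s ∣ a}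

lemma ordAt_mul (P : PrimeSpectrum R) {a : R} (ha : a ≠ 0) (c : R) :
    ordAt P (a * c) = ordAt P a + ordAt P c := by
  have : IsDomain (Localization.AtPrime P.asIdeal) :=
    IsLocalization.isDomain_localization (Ideal.primeCompl_le_nonZeroDivisors _)
  rw [ordAt, map_mul]
  refine Ring.ord_mul' _ (mem_nonZeroDivisors_of_ne_zero ?_)
  rwa [Ne, IsLocalization.to_map_eq_zero_iff _ (Ideal.primeCompl_le_nonZeroDivisors P.asIdeal)]

lemma ordAt_branch_self {s : R} (hs : Prime s) : ordAt (branch s) s = 1 := by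
  rw [ordAt, Ring.ord]
  have h : Ideal.span {algebraMap R (Localization.AtPrime (branch s).asIdeal) s} =
      IsLocalRing.maximalIdeal _ := by
    rw [← Localization.AtPrime.map_eq_maximalIdeal, ← Set.image_singleton, ← Ideal.map_span]
    exact congrArg _ (branch_asIdeal hs).symm
  rw [h, Module.length_eq_one_iff, isSimpleModule_iff_isCoatom, ← Ideal.isMaximal_def]
  exact IsLocalRing.maximalIdeal.isMaximal _

open Classical in
lemma ordAt_branch_prod {q : R} (hq : Prime q) {M : Multiset R} (hM : ∀ s ∈ M, Prime s) :
    ordAt (branch q) M.prod = (M.map branch).count (branch q) := by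
  induction M using Multiset.induction_on with
  | empty =>
    rw [Multiset.prod_zero, ordAt_eq_zero]
    · simp
    · exact fun h => hq.not_isUnit (isUnit_of_dvd_one ((mem_branch hq).1 h))
  | cons s M ih =>
    have hs := hM s (Multiset.mem_cons_self s M)
    rw [Multiset.prod_cons, ordAt_mul _ hs.ne_zero,
      ih fun t ht => hM t (Multiset.mem_cons_of_mem ht), Multiset.map_cons, Multiset.count_cons]
    split_ifs with h
    · rw [h, ordAt_branch_self hs, ← h]
      push_cast
      rw [add_comm]
    · rw [ordAt_eq_zero, zero_add, add_zero]
      intro h'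
      refine h ((branch_eq_branch hq hs).2 ?_)
      exact hq.associated_of_dvd hs ((mem_branch hq).1 h')

lemma ordAt_branch_pow_mul {q K : R} (hq : Prime q) (hK : ¬ q ∣ K) (m : ℕ) :
    ordAt (branch q) (q ^ m * K) = m := by
  induction m with
  | zero => rw [pow_zero, one_mul, ordAt_eq_zero (mt (mem_branch hq).1 hK), Nat.cast_zero]
  | succ m ih =>
    rw [pow_succ', mul_assoc, ordAt_mul _ hq.ne_zero, ih, ordAt_branch_self hq]
    push_cast
    rw [add_comm]

variable [UniqueFactorizationMonoid R]

open UniqueFactorizationMonoid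

lemma branchSet_eq {a : R} (ha : a ≠ 0) :
    branchSet a = {P | P ∈ (factors a).map branch} := by
  ext P
  simp only [Set.mem_ofPred_eq, Multiset.mem_map]
  constructor
  · rintro ⟨s, ⟨hs, hsa⟩, rfl⟩
    obtain ⟨t, ht, hst⟩ := exists_mem_factors_of_dvd ha hs.irreducible hsa
    exact ⟨t, ht, ((branch_eq_branch hs (prime_of_factor t ht)).2 hst).symm⟩
  · rintro ⟨s, hs, rfl⟩
    exact ⟨s, ⟨prime_of_factor s hs, dvd_of_mem_factors hs⟩, rfl⟩

lemma branchSet_finite {a : R} (ha : a ≠ 0) : (branchSet a).Finite := by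
  classical
  rw [branchSet_eq ha]
  exact ((factors a).map branch).toFinset.finite_toSet.subset fun P hP => by simpa using hP

lemma ordAt_ne_top {a : R} (ha : a ≠ 0) {P : PrimeSpectrum R} (hP : P ∈ branchSet a) :
    ordAt P a ≠ ⊤ := by
  classical
  obtain ⟨q, ⟨hq, -⟩, rfl⟩ := hP
  rw [← ordAt_congr _ (factors_prod ha), ordAt_branch_prod hq prime_of_factor]
  exact ENat.natCast_ne_top _

/-- Summing over the components of a divisor with multiplicities is summing over its prime
factors. -/
lemma finsum_ordAt_nsmul {M : Type*} [AddCommMonoid M] {a : R} (ha : a ≠ 0)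
    (ψ : PrimeSpectrum R → M) :
    ∑ᶠ P ∈ branchSet a, (ordAt P a).toNat • ψ P = ((factors a).map fun s => ψ (branch s)).sum := by
  classical
  have h1 : branchSet a = ((factors a).map branch).toFinset := by
    rw [branchSet_eq ha]
    ext P
    simp
  rw [h1, finsum_mem_coe_finset, ← Function.comp_def ψ branch, ← Multiset.map_map,
    Finset.sum_multiset_map_count]
  refine Finset.sum_congr rfl fun P hP => ?_
  obtain ⟨s, hs, rfl⟩ := Multiset.mem_map.1 (Multiset.mem_toFinset.1 hP)
  rw [← ordAt_congr _ (factors_prod ha), ordAt_branch_prod (prime_of_factor s hs) prime_of_factor,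
    ENat.toNat_natCast]

/-- A principal prime ideal that contains a nonzero ideal is minimal over it, since it has height
one. -/
lemma span_singleton_mem_minimalPrimes {I : Ideal R} {x q : R} (hx : x ∈ I) (hx0 : x ≠ 0)
    (hq : Prime q) (hIq : I ≤ Ideal.span {q}) : Ideal.span {q} ∈ I.minimalPrimes := by
  refine ⟨⟨(Ideal.span_singleton_prime hq.ne_zero).2 hq, hIq⟩, ?_⟩
  rintro Q ⟨hQ, hIQ⟩ hQq
  obtain ⟨r, hrQ, hr⟩ := hQ.exists_mem_prime_of_ne_bot
    (fun h => hx0 (by simpa [h] using hIQ hx))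
  have h := hq.associated_of_dvd hr (Ideal.mem_span_singleton.1 (hQq hrQ))
  rw [Ideal.span_singleton_eq_span_singleton.2 h]
  exact (Ideal.span_singleton_le_iff_mem Q).2 hrQ

/-- A minimal prime of `I` that contains a common divisor `a` of the elements of `I` is a component
of the divisor of `a`. -/
lemma mem_branchSet_of_mem_minimalPrimes {I : Ideal R} {a : R} (ha : a ≠ 0)
    {P : PrimeSpectrum R} (hP : P.asIdeal ∈ I.minimalPrimes) (haP : a ∈ P.asIdeal)
    (hI : I ≤ Ideal.span {a}) : P ∈ branchSet a := by
  have h1 : (factors a).prod ∈ P.asIdeal := by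
    obtain ⟨u, hu⟩ := (factors_prod ha).symm
    rw [← hu]
    exact P.asIdeal.mul_mem_right _ haP
  obtain ⟨q, hqa, hqP⟩ := (P.isPrime.multiset_prod_mem_iff_exists_mem _).1 h1
  have hq := prime_of_factor q hqa
  refine ⟨q, ⟨hq, dvd_of_mem_factors hqa⟩, ?_⟩
  rw [PrimeSpectrum.ext_iff, branch_asIdeal hq]
  have h2 := (Ideal.span_singleton_le_iff_mem P.asIdeal).2 hqP
  refine le_antisymm h2 (hP.2 ⟨(Ideal.span_singleton_prime hq.ne_zero).2 hq, hI.trans ?_⟩ h2)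
  exact Ideal.span_singleton_le_span_singleton.2 (dvd_of_mem_factors hqa)

lemma mem_minimalPrimes_span_singleton {a : R} (ha : a ≠ 0) {P : PrimeSpectrum R} :
    P.asIdeal ∈ (Ideal.span {a}).minimalPrimes ↔ P ∈ branchSet a := by
  refine ⟨fun hP => mem_branchSet_of_mem_minimalPrimes ha hP
    (hP.1.2 (Ideal.mem_span_singleton_self a)) le_rfl, ?_⟩
  rintro ⟨q, ⟨hq, hqa⟩, rfl⟩
  rw [branch_asIdeal hq]
  exact span_singleton_mem_minimalPrimes (Ideal.mem_span_singleton_self a) ha hq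
    (Ideal.span_singleton_le_span_singleton.2 hqa)

end Divisor

/-! ### The polar curve of a non-reduced germ -/

section Polar

local notation "𝒪" => AnalyticGerm (Fin 2 → ℂ)

variable {b : Module.Basis (Fin 2) ℂ (Fin 2 → ℂ)}

lemma interMult_eq_sum_factors {a : 𝒪} (ha : a ≠ 0) (c : 𝒪) :
    interMult a c = ((UniqueFactorizationMonoid.factors a).map fun s => interMult s c).sum := by
  rw [← interMult_congr_left (UniqueFactorizationMonoid.factors_prod ha)]
  induction UniqueFactorizationMonoid.factors a using Multiset.induction_on with
  | empty => rw [Multiset.prod_zero, interMult_eq_zero_of_isUnit_left isUnit_one]; rfl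
  | cons s M ih => rw [Multiset.prod_cons, interMult_mul_left, ih, Multiset.map_cons,
      Multiset.sum_cons]

lemma isUnit_natCast_succ {E : Type*} [NormedAddCommGroup E] [NormedSpace ℂ E] (m : ℕ) :
    IsUnit (((m + 1 : ℕ) : AnalyticGerm E)) := by
  rw [isUnit_iff_evalZero, map_natCast]
  exact Nat.cast_ne_zero.2 m.succ_ne_zero

lemma dirDeriv_pow_mul {E : Type*} [NormedAddCommGroup E] [NormedSpace ℂ E] (v : E)
    (q K : AnalyticGerm E) (m : ℕ) :
    dirDeriv v (q ^ (m + 1) * K) =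
      q ^ m * (((m + 1 : ℕ) : AnalyticGerm E) * K * dirDeriv v q + q * dirDeriv v K) := by
  rw [Derivation.leibniz, Derivation.leibniz_pow]
  simp only [smul_eq_mul, nsmul_eq_mul, Nat.add_sub_cancel]
  ring

/-- Multiplicities of the components of the critical locus and of the polar curve: if `q` divides
`F` exactly `m + 1` times, and `R` is the greatest common divisor of the partial derivatives of `F`,
then `q` divides `R` exactly `m` times and does not divide the polar curve. -/
lemma polar_factor {F R B C q K : 𝒪} (hreg : restr b F ≠ 0) (hR1 : dirDeriv (b 1) F = R * B)
    (hR0 : dirDeriv (b 0) F = R * C) (hBC : IsRelPrime B C) (hq : Prime q) {m : ℕ}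
    (hF : F = q ^ (m + 1) * K) (hK : ¬ q ∣ K) :
    ∃ R', R = q ^ m * R' ∧ ¬ q ∣ R' ∧ ¬ q ∣ B ∧
      R' * B = ((m + 1 : ℕ) : 𝒪) * K * dirDeriv (b 1) q + q * dirDeriv (b 1) K := by
  have h1 := dirDeriv_pow_mul (b 1) q K m
  have h0 := dirDeriv_pow_mul (b 0) q K m
  rw [← hF, hR1] at h1
  rw [← hF, hR0] at h0
  have hdvd : q ^ m ∣ R := by
    by_cases hB : q ∣ B
    · have hC : ¬ q ∣ C := fun hC => hq.not_isUnit (hBC hB hC)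
      exact hq.pow_dvd_of_dvd_mul_right m hC ⟨_, h0⟩
    · exact hq.pow_dvd_of_dvd_mul_right m hB ⟨_, h1⟩
  obtain ⟨R', rfl⟩ := hdvd
  have h2 : R' * B = ((m + 1 : ℕ) : 𝒪) * K * dirDeriv (b 1) q + q * dirDeriv (b 1) K := by
    refine mul_left_cancel₀ (pow_ne_zero m hq.ne_zero) ?_
    rw [← h1]; ring
  have h3 : ¬ q ∣ R' * B := by
    rw [h2, dvd_add_left (dvd_mul_right q _), mul_assoc, (isUnit_natCast_succ m).dvd_mul_left]
    intro h
    have hqreg : restr b q ≠ 0 := restr_ne_zero_of_dvd b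
      (hF ▸ (dvd_pow_self q m.succ_ne_zero).mul_right K) hreg
    exact (hq.dvd_or_dvd h).elim hK
      (not_dvd_dirDeriv b hqreg (not_isUnit_iff_evalZero.1 hq.not_isUnit))
  exact ⟨R', rfl, fun h => h3 (h.mul_right _), fun h => h3 (h.mul_left _), h2⟩

/-- The components of the critical locus of `F` lie on `F = 0`. -/
lemma dvd_of_dvd_gcd {F R B C q : 𝒪} (hreg : restr b F ≠ 0) (hF0 : evalZero F = 0)
    (hR1 : dirDeriv (b 1) F = R * B) (hR0 : dirDeriv (b 0) F = R * C) (hq : Prime q) (h : q ∣ R) :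
    q ∣ F := by
  have h1 : q ∣ dirDeriv (b 1) F := hR1 ▸ h.mul_right _
  have h2 := (interMult_dirDeriv_add_one b hreg hF0).1
  exact (interMult_chain_prime b hq (restr_ne_zero_of_dvd b h1 h2) h1 hF0).1 (hR0 ▸ h.mul_right _)

/-- The critical locus and the part of the polar curve outside it have no common component. -/
lemma isRelPrime_polar_gcd {F R B C : 𝒪} (hreg : restr b F ≠ 0) (hF0 : evalZero F = 0)
    (hR1 : dirDeriv (b 1) F = R * B) (hR0 : dirDeriv (b 0) F = R * C) (hBC : IsRelPrime B C) :
    IsRelPrime B R := by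
  have hF : F ≠ 0 := fun h => hreg (by rw [h, map_zero])
  have hB : B ≠ 0 := by
    rintro rfl
    refine (interMult_dirDeriv_add_one b hreg hF0).1 ?_
    rw [hR1, mul_zero, map_zero]
  refine WfDvdMonoid.isRelPrime_of_no_irreducible_factors (fun h => hB h.1) fun q hq hqB hqR => ?_
  have hqp := UniqueFactorizationMonoid.irreducible_iff_prime.1 hq
  have hqF := dvd_of_dvd_gcd hreg hF0 hR1 hR0 hqp hqR
  obtain ⟨m, K, hK, hFK⟩ := WfDvdMonoid.max_power_factor hF hq
  obtain _ | m := m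
  · rw [pow_zero, one_mul] at hFK
    exact hK (hFK ▸ hqF)
  · obtain ⟨R', -, -, h, -⟩ := polar_factor hreg hR1 hR0 hBC hqp hFK hK
    exact h hqB

/-- The greatest common divisor of the partial derivatives of `F` divides `F`, and the quotient is
divisible by every product of two distinct irreducible factors of `F`. -/
lemma mul_gcd_dvd {F R B C q r : 𝒪} (hreg : restr b F ≠ 0) (hF0 : evalZero F = 0)
    (hR1 : dirDeriv (b 1) F = R * B) (hR0 : dirDeriv (b 0) F = R * C) (hBC : IsRelPrime B C)
    (hq : Prime q) (hr : Prime r) (hqr : ¬ Associated q r) (hqF : q ∣ F) (hrF : r ∣ F) :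
    q * r * R ∣ F := by
  have hF : F ≠ 0 := fun h => hreg (by rw [h, map_zero])
  have hR : R ≠ 0 := by
    rintro rfl
    refine (interMult_dirDeriv_add_one b hreg hF0).1 ?_
    rw [hR1, zero_mul, map_zero]
  refine dvd_of_forall_prime_pow_dvd (mul_ne_zero (mul_ne_zero hq.ne_zero hr.ne_zero) hR) ?_
  intro s n hs hd
  obtain ⟨m, K, hK, hFK⟩ := WfDvdMonoid.max_power_factor hF hs.irreducible
  -- a prime other than `s` may be cancelled, and `s` itself divides `q * r` at most once
  have key : ∀ {t u : 𝒪}, Prime t → (¬ Associated s t) → s ^ n ∣ t * u → s ^ n ∣ u :=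
    fun ht hst h => hs.pow_dvd_of_dvd_mul_left n (fun h' => hst (hs.associated_of_dvd ht h')) h
  have hR' : s ∣ F → s ^ n ∣ s * R → s ^ n ∣ F := by
    intro hsF h
    obtain _ | m := m
    · rw [pow_zero, one_mul] at hFK
      exact absurd (hFK ▸ hsF) hK
    obtain ⟨R', rfl, hR', -, -⟩ := polar_factor hreg hR1 hR0 hBC hs hFK hK
    rw [← mul_assoc, ← pow_succ'] at h
    have := hs.pow_dvd_of_dvd_mul_right n hR' h
    rw [hFK]
    exact this.mul_right _
  by_cases hsq : Associated s q
  · refine hR' (hsq.dvd.trans hqF) ?_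
    have h2 : ¬ Associated s r := fun h => hqr (hsq.symm.trans h)
    have h3 : s ^ n ∣ q * R := key hr h2 (by convert hd using 1; ring)
    exact h3.trans (mul_dvd_mul_right hsq.symm.dvd R)
  by_cases hsr : Associated s r
  · refine hR' (hsr.dvd.trans hrF) ?_
    have h3 : s ^ n ∣ r * R := key hq hsq (by convert hd using 1; ring)
    exact h3.trans (mul_dvd_mul_right hsr.symm.dvd R)
  have h4 : s ^ n ∣ R := key hr hsr (key hq hsq (by convert hd using 1; ring))
  obtain _ | n := n
  · simp
  exact hR' (dvd_of_dvd_gcd hreg hF0 hR1 hR0 hs ((dvd_pow_self s n.succ_ne_zero).trans h4))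
    (h4.mul_left _)

/-- If `F` has two distinct irreducible factors, the polar curve meets each irreducible factor of
`F` with at least the multiplicity of that factor along `z₀ = 0`. -/
lemma interMult_coordGerm_le_polar {F R B C q r : 𝒪} (hreg : restr b F ≠ 0) (hF0 : evalZero F = 0)
    (hR1 : dirDeriv (b 1) F = R * B) (hR0 : dirDeriv (b 0) F = R * C) (hBC : IsRelPrime B C)
    (hq : Prime q) (hr : Prime r) (hqr : ¬ Associated q r) (hqF : q ∣ F) (hrF : r ∣ F) :
    interMult q (coordGerm b 0) ≤ interMult q B := by
  have hF : F ≠ 0 := fun h => hreg (by rw [h, map_zero])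
  have hq0 : evalZero q = 0 := not_isUnit_iff_evalZero.1 hq.not_isUnit
  have hqreg := restr_ne_zero_of_dvd b hqF hreg
  obtain ⟨m, K, hK, hFK⟩ := WfDvdMonoid.max_power_factor hF hq.irreducible
  obtain _ | m := m
  · rw [pow_zero, one_mul] at hFK
    exact absurd (hFK ▸ hqF) hK
  obtain ⟨R', hRR', hR', hB, e⟩ := polar_factor hreg hR1 hR0 hBC hq hFK hK
  obtain ⟨t, ht⟩ := mul_gcd_dvd hreg hF0 hR1 hR0 hBC hq hr hqr hqF hrF
  have hKt : K = R' * (r * t) := by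
    refine mul_left_cancel₀ (pow_ne_zero (m + 1) hq.ne_zero) ?_
    rw [← hFK, ht, hRR', pow_succ]
    ring
  have hm := isUnit_natCast_succ (E := Fin 2 → ℂ) m
  -- restrict `R' * B = (m + 1) * K * ∂q/∂z₁ + q * ∂K/∂z₁` to `q = 0` and cancel `R'`
  have h1 : interMult R' q + interMult B q =
      interMult R' q + (interMult (r * t) q + interMult (dirDeriv (b 1) q) q) := by
    rw [← interMult_mul_left, e, mul_comm q, interMult_add_mul_left, interMult_mul_left,
      interMult_mul_left, interMult_eq_zero_of_isUnit_left hm, hKt, interMult_mul_left]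
    ring
  have h2 := ENat.add_right_injective_of_ne_top (interMult_ne_top_of_prime hq hR') h1
  have h3 := interMult_dirDeriv_self b hqreg hq0
  have h4 : 1 ≤ interMult (r * t) q :=
    one_le_interMult (fun h => hr.not_isUnit (isUnit_of_mul_isUnit_left h)) hq.not_isUnit
  rw [interMult_comm q B, h2]
  calc interMult q (coordGerm b 0) ≤ interMult (dirDeriv (b 1) q) q + 1 := by
        rw [h3]; exact le_add_self
    _ ≤ _ := by rw [add_comm]; gcongr

/-- If `F` has two distinct irreducible factors, its polar curve meets `F = 0` with at least the
multiplicity of `F` along `z₀ = 0`. -/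
lemma interMult_coordGerm_le_interMult_polar {F R B C g h : 𝒪} (hreg : restr b F ≠ 0)
    (hF0 : evalZero F = 0) (hR1 : dirDeriv (b 1) F = R * B) (hR0 : dirDeriv (b 0) F = R * C)
    (hBC : IsRelPrime B C) (hg : Prime g) (hgF : g ∣ F) (hh : Prime h) (hhF : h ∣ F)
    (hgh : ¬ Associated g h) : interMult F (coordGerm b 0) ≤ interMult F B := by
  have hF : F ≠ 0 := fun h => hreg (by rw [h, map_zero])
  rw [interMult_eq_sum_factors hF, interMult_eq_sum_factors hF]
  refine Multiset.sum_map_le_sum_map _ _ fun q hq => ?_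
  have hqp := UniqueFactorizationMonoid.prime_of_factor q hq
  have hqF := UniqueFactorizationMonoid.dvd_of_mem_factors hq
  by_cases hqg : Associated q g
  · exact interMult_coordGerm_le_polar hreg hF0 hR1 hR0 hBC hqp hh
      (fun hqh => hgh (hqg.symm.trans hqh)) hqF hhF
  · exact interMult_coordGerm_le_polar hreg hF0 hR1 hR0 hBC hqp hg hqg hqF hgF

/-- An irreducible germ has at most an isolated critical point. -/
lemma isRelPrime_dirDeriv_of_prime {g : 𝒪} (hreg : restr b g ≠ 0) (hg : Prime g) :
    IsRelPrime (dirDeriv (b 0) g) (dirDeriv (b 1) g) := by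
  have hg0 := not_isUnit_iff_evalZero.1 hg.not_isUnit
  have h1 := (interMult_dirDeriv_add_one b hreg hg0).1
  refine WfDvdMonoid.isRelPrime_of_no_irreducible_factors
    (fun h => h1 (by rw [h.2, map_zero])) fun q hq h0 h1' => ?_
  have hqp := UniqueFactorizationMonoid.irreducible_iff_prime.1 hq
  have h2 := (interMult_chain_prime b hqp (restr_ne_zero_of_dvd b h1' h1) h1' hg0).1 h0
  have h3 := hqp.associated_of_dvd hg h2
  exact not_dvd_dirDeriv b hreg hg0 (h3.symm.dvd.trans h1')

/-- A germ with at most an isolated critical point is squarefree. -/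
lemma not_sq_dvd_of_isRelPrime_dirDeriv {h q k : 𝒪}
    (hh : IsRelPrime (dirDeriv (b 0) h) (dirDeriv (b 1) h)) (hq : Prime q) (hk : h = q * k) :
    ¬ q ∣ k := by
  rintro ⟨l, rfl⟩
  have key : ∀ v, q ∣ dirDeriv v h := fun v => by
    have : h = q ^ (1 + 1) * l := by rw [hk]; ring
    rw [this, dirDeriv_pow_mul, pow_one]
    exact dvd_mul_right _ _
  exact hq.not_isUnit (hh (key _) (key _))

/-- The partial derivatives of `g ^ (n + 1) * h` are the multiples of `g ^ n` by `(n + 1) h ∂g/∂zᵢ +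
g ∂h/∂zᵢ`. For `h` squarefree these cofactors are coprime, so that `g ^ n` is the greatest common
divisor of the partial derivatives. -/
lemma isRelPrime_polar_of_reduced {g h : 𝒪} {n : ℕ} (hreg : restr b (g ^ (n + 1) * h) ≠ 0)
    (hg : Prime g) (hgh : ¬ g ∣ h) (hsq : ∀ q k, Prime q → h = q * k → ¬ q ∣ k) :
    IsRelPrime (((n + 1 : ℕ) : 𝒪) * h * dirDeriv (b 1) g + g * dirDeriv (b 1) h)
      (((n + 1 : ℕ) : 𝒪) * h * dirDeriv (b 0) g + g * dirDeriv (b 0) h) := by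
  have hg0 := not_isUnit_iff_evalZero.1 hg.not_isUnit
  have hF0 : evalZero (g ^ (n + 1) * h) = 0 := by simp [hg0]
  have hd := fun v => dirDeriv_pow_mul v g h n
  have h1 := (interMult_dirDeriv_add_one b hreg hF0).1
  have hgreg : restr b g ≠ 0 := restr_ne_zero_of_dvd b ((dvd_pow_self g n.succ_ne_zero).mul_right h) hreg
  have hm := isUnit_natCast_succ (E := Fin 2 → ℂ) n
  refine WfDvdMonoid.isRelPrime_of_no_irreducible_factors
    (fun h => h1 (by rw [hd, h.1, mul_zero, map_zero])) fun q hq hq1 hq0 => ?_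
  have hqp := UniqueFactorizationMonoid.irreducible_iff_prime.1 hq
  have hq1' : q ∣ dirDeriv (b 1) (g ^ (n + 1) * h) := by rw [hd]; exact hq1.mul_left _
  have hq0' : q ∣ dirDeriv (b 0) (g ^ (n + 1) * h) := by rw [hd]; exact hq0.mul_left _
  have hqF := (interMult_chain_prime b hqp (restr_ne_zero_of_dvd b hq1' h1) hq1' hF0).1 hq0'
  by_cases hqg : Associated q g
  · have h2 : g ∣ ((n + 1 : ℕ) : 𝒪) * h * dirDeriv (b 1) g :=
      (dvd_add_left (dvd_mul_right g _)).1 (hqg.symm.dvd.trans hq1)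
    rw [mul_assoc, hm.dvd_mul_left] at h2
    rcases hg.dvd_or_dvd h2 with h3 | h3
    · exact hgh h3
    · exact not_dvd_dirDeriv b hgreg hg0 h3
  · have hqg' : ¬ q ∣ g := fun h => hqg (hqp.associated_of_dvd hg h)
    have hqh : q ∣ h := (hqp.dvd_or_dvd hqF).resolve_left fun h => hqg' (hqp.dvd_of_dvd_pow h)
    have h2 := (hqp.dvd_or_dvd ((dvd_add_right ((hqh.mul_left _).mul_right _)).1 hq1)).resolve_left
      hqg'
    obtain ⟨k, hk⟩ := hqh
    rw [hk, Derivation.leibniz, smul_eq_mul, smul_eq_mul] at h2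
    have h3 := (dvd_add_right (dvd_mul_right q _)).1 h2
    have hqreg : restr b q ≠ 0 := restr_ne_zero_of_dvd b hqF hreg
    exact (hqp.dvd_or_dvd h3).elim (hsq q k hqp hk)
      (not_dvd_dirDeriv b hqreg (not_isUnit_iff_evalZero.1 hq.not_isUnit))

lemma card_factors_prime_pow {g : 𝒪} (hg : Prime g) (n : ℕ) :
    (UniqueFactorizationMonoid.factors (g ^ n)).card = n := by
  have h := UniqueFactorizationMonoid.factors_unique
    (f := UniqueFactorizationMonoid.factors (g ^ n)) (g := Multiset.replicate n g)
    UniqueFactorizationMonoid.irreducible_of_factor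
    (fun x hx => (Multiset.eq_of_mem_replicate hx) ▸ hg.irreducible)
    (by
      rw [Multiset.prod_replicate]
      exact UniqueFactorizationMonoid.factors_prod (pow_ne_zero n hg.ne_zero))
  rw [Multiset.card_eq_card_of_rel h, Multiset.card_replicate]

lemma interMult_pow_mul_left (g h c : 𝒪) (k : ℕ) :
    interMult (g ^ k * h) c = k * interMult g c + interMult h c := by
  rw [interMult_mul_left]
  congr 1
  induction k with
  | zero => rw [pow_zero, interMult_eq_zero_of_isUnit_left isUnit_one]; simp
  | succ k ih => rw [pow_succ, interMult_mul_left, ih]; push_cast; ring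

/-- The intersection multiplicity of `g ^ (n + 1) * h` with its polar curve. -/
lemma interMult_polar {g h : 𝒪} {n : ℕ} :
    interMult (g ^ (n + 1) * h)
        (((n + 1 : ℕ) : 𝒪) * h * dirDeriv (b 1) g + g * dirDeriv (b 1) h) =
      (n + 1 : ℕ) * (interMult g h + interMult (dirDeriv (b 1) g) g) +
        (interMult g h + interMult (dirDeriv (b 1) h) h) := by
  have hm := isUnit_natCast_succ (E := Fin 2 → ℂ) n
  set Q := ((n + 1 : ℕ) : 𝒪) * h * dirDeriv (b 1) g + g * dirDeriv (b 1) h with hQ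
  have h1 : interMult g Q = interMult g h + interMult (dirDeriv (b 1) g) g := by
    rw [interMult_comm, hQ, mul_comm g, interMult_add_mul_left, interMult_mul_left,
      interMult_mul_left, interMult_eq_zero_of_isUnit_left hm, zero_add, interMult_comm h]
  have h2 : interMult h Q = interMult g h + interMult (dirDeriv (b 1) h) h := by
    have : Q = g * dirDeriv (b 1) h + (((n + 1 : ℕ) : 𝒪) * dirDeriv (b 1) g) * h := by
      rw [hQ]; ring
    rw [interMult_comm, this, interMult_add_mul_left, interMult_mul_left]
  rw [interMult_pow_mul_left, h1, h2]

end Polar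

/-! ### Milnor numbers of line slices near the origin -/

section Nearby

local notation "𝒪" => AnalyticGerm (Fin 2 → ℂ)

lemma uniformizer_dvd {φ : AnalyticGerm ℂ} (h : evalZero φ = 0) : uniformizer ∣ φ := by
  by_cases hφ : φ = 0
  · rw [hφ]; exact dvd_zero _
  obtain ⟨n, u, rfl⟩ := exists_eq_pow_mul_unit hφ
  obtain _ | n := n
  · rw [pow_zero, one_mul] at h
    exact absurd h (isUnit_iff_evalZero.1 u.isUnit)
  · exact (dvd_pow_self _ n.succ_ne_zero).mul_right _

lemma le_ord_dirDeriv_pow_mul {φ : AnalyticGerm ℂ} (h : evalZero φ = 0) (κ : AnalyticGerm ℂ)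
    (m : ℕ) : (m : ℕ∞) ≤ Ring.ord (AnalyticGerm ℂ) (dirDeriv 1 (φ ^ (m + 1) * κ)) := by
  have h1 := ord_uniformizer_pow_mul_unit m 1
  rw [Units.val_one, mul_one] at h1
  rw [dirDeriv_pow_mul, ← h1]
  exact Ring.ord_le_ord_of_dvd ((pow_dvd_pow_of_dvd (uniformizer_dvd h) m).mul_right _)

lemma ord_dirDeriv_pow_mul {φ κ : AnalyticGerm ℂ} (h : evalZero φ = 0)
    (h' : evalZero (dirDeriv 1 φ) ≠ 0) (hκ : evalZero κ ≠ 0) (m : ℕ) :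
    Ring.ord (AnalyticGerm ℂ) (dirDeriv 1 (φ ^ (m + 1) * κ)) = m := by
  have hφ : φ ≠ 0 := by
    rintro rfl
    simp at h'
  have h1 : Ring.ord (AnalyticGerm ℂ) φ = 1 := by
    rw [← (ord_dirDeriv_add_one hφ h).2, Ring.ord_of_isUnit (isUnit_iff_evalZero.2 h'), zero_add]
  rw [dirDeriv_pow_mul, Ring.ord_mul_of_isUnit_right,
    Ring.ord_pow (mem_nonZeroDivisors_of_ne_zero hφ), h1, nsmul_eq_mul, mul_one]
  rw [isUnit_iff_evalZero, map_add, map_mul, map_mul, map_mul, h, zero_mul, add_zero, map_natCast]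
  exact mul_ne_zero (mul_ne_zero (Nat.cast_ne_zero.2 m.succ_ne_zero) hκ) h'

/-- The Milnor number in one variable is the order of vanishing of the derivative. -/
lemma milnorNumber_eq_ord {H : Type*} [NormedAddCommGroup H] [NormedSpace ℂ H] (e : ℂ ≃L[ℂ] H)
    {F : H → ℂ} (hF : AnalyticAt ℂ F 0) :
    milnorNumber F = Ring.ord (AnalyticGerm ℂ)
      (dirDeriv 1 (germMap (e : ℂ →L[ℂ] H) (germ F hF))) := by
  have h1 : jacobianIdeal F = Ideal.span {dirDeriv (e 1) (germ F hF), 0} := by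
    rw [jacobianIdeal_eq hF, Set.pair_comm, Ideal.span_insert_zero]
    apply le_antisymm
    · rw [Ideal.span_le]
      rintro _ ⟨v, rfl⟩
      have hv : v = e.symm v • e 1 := by
        rw [← map_smul, smul_eq_mul, mul_one, ContinuousLinearEquiv.apply_symm_apply]
      rw [SetLike.mem_coe, Ideal.mem_span_singleton, hv]
      simp only [dirDeriv_smul]
      rw [Algebra.smul_def]
      exact dvd_mul_left _ _
    · rw [Ideal.span_singleton_le_iff_mem]
      exact Ideal.subset_span ⟨_, rfl⟩
  have h2 := interMult_eq_ord (germEquiv e).toRingHom (germEquiv e).surjective (c := 0)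
    (by intro x; simp [zero_dvd_iff]) (dirDeriv (e 1) (germ F hF))
  have h3 := germMap_dirDeriv (e : ℂ →L[ℂ] H) 1 (germ F hF)
  rw [milnorNumber, colength, h1]
  refine h2.trans ?_
  rw [← h3]
  rfl

/-- The generic line slice of `Q ^ (m + 1) * K` at a point where `Q` vanishes to first order and
`K` does not vanish. -/
lemma sliceMilnorNumber_eq {v z : Fin 2 → ℂ} {f Q K : (Fin 2 → ℂ) → ℂ} {m : ℕ}
    (hQ : AnalyticAt ℂ Q z) (hK : AnalyticAt ℂ K z)
    (hf : ∀ᶠ w in 𝓝 z, f w = Q w ^ (m + 1) * K w) (hQz : Q z = 0) (hKz : K z ≠ 0)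
    (hQv : fderiv ℂ Q z v ≠ 0) : sliceMilnorNumber f z = m := by
  -- the germ of the restriction of a function to a line through `z`
  have hL : ∀ (H : Submodule ℂ (Fin 2 → ℂ)) {G : (Fin 2 → ℂ) → ℂ}, AnalyticAt ℂ G z →
      AnalyticAt ℂ (fun w : H => G (z + w)) 0 := fun H G hG => by
    have h1 : AnalyticAt ℂ (fun w : H => z + (w : Fin 2 → ℂ)) 0 :=
      analyticAt_const.add (H.subtypeL.analyticAt 0)
    have h2 : AnalyticAt ℂ G ((fun w : H => z + (w : Fin 2 → ℂ)) 0) := by simpa using hG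
    exact AnalyticAt.comp (f := fun w : H => z + (w : Fin 2 → ℂ)) h2 h1
  have key : ∀ (H : Submodule ℂ (Fin 2 → ℂ)) (e : ℂ ≃L[ℂ] H),
      milnorNumber (fun w : H => f (z + w)) = Ring.ord (AnalyticGerm ℂ)
        (dirDeriv 1 (germMap (e : ℂ →L[ℂ] H) (germ _ (hL H hQ)) ^ (m + 1) *
          germMap (e : ℂ →L[ℂ] H) (germ _ (hL H hK)))) := by
    intro H e
    have hc : ContinuousAt (fun w : H => z + (w : Fin 2 → ℂ)) 0 := by fun_prop
    have hev : (fun w : H => f (z + w)) =ᶠ[𝓝 0]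
        (fun w : H => Q (z + w)) ^ (m + 1) * fun w : H => K (z + w) := by
      have : ∀ᶠ w in 𝓝 (z + ((0 : H) : Fin 2 → ℂ)), f w = Q w ^ (m + 1) * K w := by simpa using hf
      exact hc.eventually this
    have hfa : AnalyticAt ℂ (fun w : H => f (z + w)) 0 :=
      (((hL H hQ).pow (m + 1)).mul (hL H hK)).congr hev.symm
    rw [milnorNumber_eq_ord e hfa, ← map_pow, ← map_mul, germ_pow, germ_mul]
    congr 3
    exact germ_eq_iff.2 hev
  have hfin : Module.finrank ℂ (Fin 2 → ℂ) = 2 := by simp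
  have h0 : ∀ (H : Submodule ℂ (Fin 2 → ℂ)) (e : ℂ ≃L[ℂ] H) {G : (Fin 2 → ℂ) → ℂ}
      (hG : AnalyticAt ℂ G z), evalZero (germMap (e : ℂ →L[ℂ] H) (germ _ (hL H hG))) = G z := by
    intro H e G hG
    rw [evalZero_germMap, evalZero_germ]
    simp
  apply le_antisymm
  · have hv : v ≠ 0 := by
      rintro rfl
      simp at hQv
    refine (iInf₂_le (Submodule.span ℂ {v}) (by rw [finrank_span_singleton hv, hfin])).trans ?_
    let e : ℂ ≃L[ℂ] Submodule.span ℂ {v} :=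
      ContinuousLinearEquiv.toSpanNonzeroSingleton ℂ v hv
    have h1 : HasFDerivAt (fun w : Submodule.span ℂ {v} => Q (z + w))
        ((fderiv ℂ Q z).comp (Submodule.subtypeL _)) 0 := by
      have h2 : HasFDerivAt Q (fderiv ℂ Q z) (z + ((0 : Submodule.span ℂ {v}) : Fin 2 → ℂ)) := by
        simpa using hQ.differentiableAt.hasFDerivAt
      exact h2.comp (f := fun w : Submodule.span ℂ {v} => z + (w : Fin 2 → ℂ)) 0
        ((Submodule.subtypeL _).hasFDerivAt.const_add z)
    have h3 : ((e 1 : Submodule.span ℂ {v}) : Fin 2 → ℂ) = v := by simp [e]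
    rw [key _ e, ord_dirDeriv_pow_mul (by rw [h0 _ _ hQ, hQz]) _ (by rwa [h0 _ _ hK])]
    rw [← germMap_dirDeriv, evalZero_germMap, dirDeriv_germ, evalZero_germ, h1.fderiv]
    simpa [h3] using hQv
  · refine le_iInf₂ fun H hH => ?_
    have hH1 : Module.finrank ℂ ℂ = Module.finrank ℂ H := by
      rw [hfin] at hH
      rw [Module.finrank_self]
      omega
    let e : ℂ ≃L[ℂ] H := ContinuousLinearEquiv.ofFinrankEq hH1
    rw [key _ e]
    exact le_ord_dirDeriv_pow_mul (by rw [h0 _ _ hQ, hQz]) _ m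

/-- A zero of an analytic function of two variables is not isolated. -/
lemma frequently_eq_zero {G : ℂ × ℂ → ℂ} (hG : AnalyticAt ℂ G 0) (hG0 : G 0 = 0) :
    ∃ᶠ z in 𝓝[≠] (0 : ℂ × ℂ), G z = 0 := by
  intro H
  rw [eventually_nhdsWithin_iff] at H
  obtain ⟨ρ, hρ, hball⟩ := Metric.eventually_nhds_iff_ball.1 (H.and hG.eventually_analyticAt)
  set r := ρ / 2 with hr
  have hr0 : 0 < r := by positivity
  have hmem : ∀ x y : ℂ, ‖x‖ < ρ → ‖y‖ ≤ r → (x, y) ∈ Metric.ball (0 : ℂ × ℂ) ρ := by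
    intro x y hx hy
    rw [mem_ball_zero_iff, Prod.norm_mk, max_lt_iff]
    exact ⟨hx, by linarith⟩
  have hcont : ∀ x y : ℂ, ‖x‖ < ρ → ‖y‖ ≤ r → ContinuousAt G (x, y) := fun x y hx hy =>
    (hball _ (hmem x y hx hy)).2.continuousAt
  -- `G` is bounded below by `δ` on the circle, and hence by `δ / 2` on all nearby circles
  obtain ⟨δ, hδ, hδG⟩ : ∃ δ > 0, ∀ y ∈ Metric.sphere (0 : ℂ) r, δ < ‖G (0, y)‖ := by
    have hc : ContinuousOn (fun y => ‖G (0, y)‖) (Metric.sphere (0 : ℂ) r) := fun y hy => by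
      have : ContinuousAt (fun y => G (0, y)) y :=
        (hcont 0 y (by simpa) (by simpa using (mem_sphere_zero_iff_norm.1 hy).le)).comp
          (by fun_prop)
      exact this.norm.continuousWithinAt
    obtain ⟨y, hy, hmin⟩ := (isCompact_sphere (0 : ℂ) r).exists_isMinOn
      (NormedSpace.sphere_nonempty.2 hr0.le) hc
    have hy' := mem_sphere_zero_iff_norm.1 hy
    have hpos : 0 < ‖G (0, y)‖ := by
      refine norm_pos_iff.2 ((hball _ (hmem 0 y (by simpa) hy'.le)).1 ?_)
      rw [Set.mem_compl_singleton_iff, Ne, Prod.ext_iff, not_and]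
      intro _ h
      rw [show y = 0 from h, norm_zero] at hy'
      exact hr0.ne hy'
    refine ⟨‖G (0, y)‖ / 2, by positivity, fun y' hy' => ?_⟩
    have := hmin hy'
    have h2 : ‖G (0, y)‖ ≤ ‖G (0, y')‖ := this
    linarith
  have h1 : ∀ᶠ x in 𝓝 (0 : ℂ), ∀ y ∈ Metric.sphere (0 : ℂ) r, δ < ‖G (x, y)‖ := by
    refine (isCompact_sphere (0 : ℂ) r).eventually_forall_of_forall_eventually fun y hy => ?_
    exact (hcont 0 y (by simpa) (by simpa using (mem_sphere_zero_iff_norm.1 hy).le)).norm.eventually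
      (lt_mem_nhds (hδG y hy))
  have h2 : ∀ᶠ x in 𝓝 (0 : ℂ), ‖G (x, 0)‖ < δ := by
    have hc : ContinuousAt (fun x => ‖G (x, 0)‖) 0 :=
      ((hcont 0 0 (by simpa) (by simpa using hr0.le)).comp
        (f := fun x : ℂ => (x, (0 : ℂ))) (by fun_prop)).norm
    have h0 : ‖G (0, 0)‖ < δ := by
      rw [show ((0 : ℂ), (0 : ℂ)) = 0 from rfl, hG0, norm_zero]
      exact hδ
    exact hc.eventually (gt_mem_nhds h0)
  have h3 : ∀ᶠ x in 𝓝 (0 : ℂ), ‖x‖ < ρ := by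
    filter_upwards [Metric.ball_mem_nhds (0 : ℂ) hρ] with x hx using mem_ball_zero_iff.1 hx
  obtain ⟨x, ⟨hx1, hx2, hx3⟩, hx0⟩ :=
    (((h1.and (h2.and h3)).filter_mono nhdsWithin_le_nhds).and
      (self_mem_nhdsWithin : {0}ᶜ ∈ 𝓝[≠] (0 : ℂ))).exists
  have hne : ∀ y : ℂ, ‖y‖ ≤ r → G (x, y) ≠ 0 := fun y hy =>
    (hball _ (hmem x y hx3 hy)).1 fun h => hx0 (congrArg Prod.fst h)
  -- the maximum principle for `1 / G (x, ·)` gives a contradiction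
  have hd : DiffContOnCl ℂ (fun y => (G (x, y))⁻¹) (Metric.ball (0 : ℂ) r) := by
    have : DifferentiableOn ℂ (fun y => (G (x, y))⁻¹) (Metric.closedBall (0 : ℂ) r) := by
      intro y hy
      rw [mem_closedBall_zero_iff] at hy
      have : DifferentiableAt ℂ (fun y => G (x, y)) y :=
        (hball _ (hmem x y hx3 hy)).2.differentiableAt.comp y
          (f := fun y : ℂ => (x, y)) (by fun_prop)
      exact (this.inv (hne y hy)).differentiableWithinAt
    exact this.diffContOnCl_ball le_rfl
  have h4 := Complex.norm_le_of_forall_mem_frontier_norm_le Metric.isBounded_ball hd (C := δ⁻¹)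
    (fun y hy => by
      rw [frontier_ball _ hr0.ne'] at hy
      rw [norm_inv]
      exact inv_anti₀ hδ (hx1 y hy).le) (subset_closure (Metric.mem_ball_self hr0))
  rw [norm_inv, inv_le_inv₀ (norm_pos_iff.2 (hne 0 (by simpa using hr0.le))) hδ] at h4
  exact absurd h4 (not_le.2 hx2)

/-- An ideal of finite colength contains a power of every nonunit. -/
lemma exists_pow_mem_of_interMult_ne_top {a c x : 𝒪} (h : interMult a c ≠ ⊤)
    (hx : evalZero x = 0) : ∃ n, x ^ n ∈ Ideal.span {a, c} := by
  rw [interMult, Module.length_ne_top_iff, isFiniteLength_iff_isNoetherian_isArtinian] at h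
  obtain ⟨-, h⟩ := h
  obtain ⟨n, y, hy⟩ := IsArtinian.exists_pow_succ_smul_dvd x
    (Ideal.Quotient.mk (Ideal.span {a, c}) 1)
  obtain ⟨y, rfl⟩ := Ideal.Quotient.mk_surjective y
  refine ⟨n, ?_⟩
  have h1 : x ^ n * (1 - x * y) ∈ Ideal.span {a, c} := by
    rw [← Ideal.Quotient.eq_zero_iff_mem]
    have h2 : Ideal.Quotient.mk (Ideal.span {a, c}) (x ^ (n + 1) * y) =
      Ideal.Quotient.mk (Ideal.span {a, c}) (x ^ n * 1) := hy
    rw [mul_sub, map_sub, ← h2, sub_eq_zero]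
    congr 1; ring
  have hu : IsUnit (1 - x * y) := by
    rw [isUnit_iff_evalZero, map_sub, map_mul, hx]
    simp
  exact (Ideal.mul_unit_mem_iff_mem _ hu).1 h1

/-- Coprime germs have no common zeros outside the origin. -/
lemma eventually_eq_zero_of_isRelPrime {F G : (Fin 2 → ℂ) → ℂ} {hF : AnalyticAt ℂ F 0}
    {hG : AnalyticAt ℂ G 0} (h : IsRelPrime (germ F hF) (germ G hG)) :
    ∀ᶠ z in 𝓝 (0 : Fin 2 → ℂ), F z = 0 → G z = 0 → z = 0 := by
  let b := Pi.basisFun ℂ (Fin 2)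
  have key : ∀ i, ∀ᶠ z in 𝓝 (0 : Fin 2 → ℂ), F z = 0 → G z = 0 → b.coord i z = 0 := by
    intro i
    obtain ⟨n, hn⟩ := exists_pow_mem_of_interMult_ne_top (interMult_ne_top h)
      (evalZero_coordGerm b i)
    obtain ⟨s, t, hst⟩ := Ideal.mem_span_pair.1 hn
    obtain ⟨S, hS, rfl⟩ := exists_rep s
    obtain ⟨T, hT, rfl⟩ := exists_rep t
    rw [coordGerm, linGerm, germ_mul, germ_mul, germ_add, germ_pow] at hst
    filter_upwards [germ_eq_iff.1 hst] with z hz hFz hGz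
    simp only [hFz, hGz, mul_zero, add_zero] at hz
    rw [← coordL_apply]
    exact eq_zero_of_pow_eq_zero hz.symm
  filter_upwards [key 0, key 1] with z h0 h1 hF hG
  refine b.ext_elem fun i => ?_
  fin_cases i
  · simpa using h0 hF hG
  · simpa using h1 hF hG

lemma puncturedFilter_branch {Q : (Fin 2 → ℂ) → ℂ} {hQ : AnalyticAt ℂ Q 0}
    (hq : Prime (germ Q hQ)) :
    puncturedFilter (branch (germ Q hQ)) = 𝓝[≠] 0 ⊓ 𝓟 {z | Q z = 0} := by
  rw [puncturedFilter]
  apply le_antisymm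
  · refine inf_le_inf_left _ ((iInf_le _ Q).trans ((iInf_le _ hQ).trans (iInf_le _ ?_)))
    rw [mem_branch hq]
  · refine le_inf inf_le_left (le_iInf fun G => le_iInf fun hG => le_iInf fun hGP => ?_)
    obtain ⟨c, hc⟩ := (mem_branch hq).1 hGP
    obtain ⟨C, hC, rfl⟩ := exists_rep c
    rw [germ_mul] at hc
    rw [le_principal_iff, mem_inf_principal]
    filter_upwards [(germ_eq_iff.1 hc).filter_mono nhdsWithin_le_nhds] with z hz hQz
    exact hz.trans (by rw [hQz, zero_mul])

/-- The zero set of an irreducible germ is not an isolated point. -/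
lemma puncturedFilter_neBot {q : 𝒪} (hq : Prime q) : (puncturedFilter (branch q)).NeBot := by
  obtain ⟨Q, hQ, rfl⟩ := exists_rep q
  have hq0 : Q 0 = 0 := not_isUnit_iff_evalZero.1 hq.not_isUnit
  let b := Pi.basisFun ℂ (Fin 2)
  rw [puncturedFilter_branch hq, ← frequently_mem_iff_neBot]
  have hG : AnalyticAt ℂ (fun w => Q (planeEquiv b w)) 0 :=
    AnalyticAt.comp_clm (by simpa using hQ) (planeEquiv b : (ℂ × ℂ) →L[ℂ] (Fin 2 → ℂ))
  have h1 := frequently_eq_zero hG (by simpa using hq0)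
  have h2 : Tendsto (planeEquiv b) (𝓝[≠] 0) (𝓝[≠] 0) := by
    refine tendsto_nhdsWithin_iff.2 ⟨?_, ?_⟩
    · have h3 := (planeEquiv b).continuous.tendsto 0
      rw [map_zero] at h3
      exact h3.mono_left nhdsWithin_le_nhds
    · filter_upwards [self_mem_nhdsWithin] with w hw h
      exact hw ((map_eq_zero_iff _ (planeEquiv b).injective).1 h)
  exact h2.frequently h1

/-- Along the component `q = 0` the generic line slice of `F` has Milnor number one less than the
multiplicity of `q` in `F`. -/
theorem nearbyMilnorNumber_branch {b : Module.Basis (Fin 2) ℂ (Fin 2 → ℂ)}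
    {f : (Fin 2 → ℂ) → ℂ} (hf : AnalyticAt ℂ f 0) {q K : 𝒪} (hq : Prime q) (hreg : restr b q ≠ 0)
    (hK : ¬ q ∣ K) {m : ℕ} (hF : germ f hf = q ^ (m + 1) * K) :
    nearbyMilnorNumber f (branch q) = m := by
  have hne := puncturedFilter_neBot hq
  suffices h : ∀ᶠ z in puncturedFilter (branch q), sliceMilnorNumber f z = m by
    rw [nearbyMilnorNumber, liminf_congr h, liminf_const]
  have hq1 := not_dvd_dirDeriv b hreg (not_isUnit_iff_evalZero.1 hq.not_isUnit)
  obtain ⟨Q, hQ, rfl⟩ := exists_rep q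
  obtain ⟨k, hk, rfl⟩ := exists_rep K
  have hrel : IsRelPrime (germ Q hQ) (germ k hk * dirDeriv (b 1) (germ Q hQ)) := by
    refine (hq.irreducible.isRelPrime_iff_not_dvd).2 fun h => ?_
    exact (hq.dvd_or_dvd h).elim hK hq1
  rw [dirDeriv_germ, germ_mul] at hrel
  rw [germ_pow, germ_mul] at hF
  rw [puncturedFilter_branch hq, eventually_inf_principal]
  have hFev := (germ_eq_iff.1 hF).eventually_nhds
  filter_upwards [(eventually_eq_zero_of_isRelPrime hrel).filter_mono nhdsWithin_le_nhds,
    hFev.filter_mono nhdsWithin_le_nhds, hQ.eventually_analyticAt.filter_mono nhdsWithin_le_nhds,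
    hk.eventually_analyticAt.filter_mono nhdsWithin_le_nhds, self_mem_nhdsWithin]
    with z h1 h2 h3 h4 h5 hQz
  have h6 : k z * fderiv ℂ Q z (b 1) ≠ 0 := fun h => h5 (h1 hQz h)
  exact sliceMilnorNumber_eq h3 h4 h2 hQz (left_ne_zero_of_mul h6) (right_ne_zero_of_mul h6)

end Nearby

/-! ### The beta invariant -/

section Beta

local notation "𝒪" => AnalyticGerm (Fin 2 → ℂ)

variable {f : (Fin 2 → ℂ) → ℂ} (hf : AnalyticAt ℂ f 0) (b : Module.Basis (Fin 2) ℂ (Fin 2 → ℂ))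

/-- The coordinate `z₁` on the line `z₀ = 0`. -/
def kerEquiv : ℂ ≃L[ℂ] LinearMap.ker (b.coord 0) :=
  ContinuousLinearEquiv.equivOfInverse
    ((ContinuousLinearMap.toSpanSingleton ℂ (b 1)).codRestrict _ fun t => by simp)
    ((coordL b 1).comp (Submodule.subtypeL _))
    (fun t => by
      change b.coord 1 (t • b 1) = t
      simp)
    (fun w => by
      have hw : b.coord 0 w = 0 := w.2
      ext1
      change b.coord 1 w • b 1 = w
      have h := b.sum_repr (w : Fin 2 → ℂ)
      rw [Fin.sum_univ_two, ← b.coord_apply 0, hw, zero_smul, zero_add] at h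
      exact h)

/-- Coordinates are admissible exactly if the derivative of `f` along the line `z₀ = 0` vanishes at
the origin without vanishing identically. -/
lemma isAdmissible_iff : IsAdmissible f b ↔
    dirDeriv 1 (restr b (germ f hf)) ≠ 0 ∧ evalZero (dirDeriv 1 (restr b (germ f hf))) = 0 := by
  set φ : ℂ → ℂ := fun t => f (t • b 1) with hφ
  have hφa : AnalyticAt ℂ φ 0 :=
    AnalyticAt.comp_clm hf (ContinuousLinearMap.toSpanSingleton ℂ (b 1))
  have hD : dirDeriv 1 (restr b (germ f hf)) = germ (fun t => fderiv ℂ φ t 1) (hφa.dirDeriv 1) := by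
    rw [← dirDeriv_germ 1 hφa]
    rfl
  have hcrit : ∀ t : ℂ, kerEquiv b t ∈
      criticalLocus (fun w : LinearMap.ker (b.coord 0) => f w) ↔ fderiv ℂ φ t 1 = 0 := by
    intro t
    have h1 : φ = (fun w : LinearMap.ker (b.coord 0) => f w) ∘ kerEquiv b := rfl
    rw [h1, (kerEquiv b).comp_right_fderiv]
    constructor
    · intro h
      have h2 : fderiv ℂ (fun w : LinearMap.ker (b.coord 0) => f w) (kerEquiv b t) = 0 := h
      rw [h2]
      simp
    · intro h
      change fderiv ℂ (fun w : LinearMap.ker (b.coord 0) => f w) (kerEquiv b t) = 0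
      ext w
      obtain ⟨s, rfl⟩ := (kerEquiv b).surjective w
      have h3 : kerEquiv b s = s • kerEquiv b 1 := by
        rw [← map_smul, smul_eq_mul, mul_one]
      rw [h3, map_smul]
      have h4 : fderiv ℂ (fun w : LinearMap.ker (b.coord 0) => f w) (kerEquiv b t)
        (kerEquiv b 1) = 0 := h
      rw [h4]
      simp
  have hadm : IsAdmissible f b ↔ ∀ᶠ t in 𝓝 (0 : ℂ), fderiv ℂ φ t 1 = 0 ↔ t = 0 := by
    rw [IsAdmissible, ← map_zero (kerEquiv b), ← (kerEquiv b).map_nhds_eq, eventually_map]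
    refine eventually_congr (Eventually.of_forall fun t => ?_)
    rw [hcrit, map_zero, map_eq_zero_iff _ (kerEquiv b).injective]
  rw [hadm, hD, Ne, germ_eq_zero_iff, evalZero_germ]
  constructor
  · intro h
    refine ⟨fun h0 => ?_, h.self_of_nhds.2 rfl⟩
    have h1 : ∀ᶠ t in 𝓝[≠] (0 : ℂ), t = 0 :=
      ((h.and h0).mono fun t ht => ht.1.1 ht.2).filter_mono nhdsWithin_le_nhds
    obtain ⟨t, ht, ht0⟩ := (h1.and self_mem_nhdsWithin).exists
    exact ht0 ht
  · rintro ⟨h1, h2⟩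
    have h3 := (hφa.dirDeriv 1).eventually_eq_zero_or_eventually_ne_zero.resolve_left h1
    rw [eventually_nhdsWithin_iff] at h3
    filter_upwards [h3] with t ht
    refine ⟨fun h => by_contra fun h0 => ht h0 h, ?_⟩
    rintro rfl
    exact h2

lemma polarIdeal_eq : polarIdeal f b = Ideal.span {dirDeriv (b 1) (germ f hf)} := by
  have h : {G | ∃ i : Fin 2, i ≠ 0 ∧ G = partialDeriv f b i} = {partialDeriv f b 1} := by
    ext G
    constructor
    · rintro ⟨i, hi, rfl⟩
      obtain rfl : i = 1 := by omega
      rfl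
    · rintro rfl
      exact ⟨1, one_ne_zero, rfl⟩
  rw [polarIdeal, h, dirDeriv_germ]
  exact idealOf_singleton (hf.dirDeriv (b 1))

lemma jacobianIdeal_eq_span_pair : jacobianIdeal f =
    Ideal.span {dirDeriv (b 0) (germ f hf), dirDeriv (b 1) (germ f hf)} := by
  rw [jacobianIdeal_eq hf, span_range_dirDeriv b]

lemma milnorNumber_eq_interMult : milnorNumber f =
    interMult (dirDeriv (b 0) (germ f hf)) (dirDeriv (b 1) (germ f hf)) := by
  rw [milnorNumber, jacobianIdeal_eq_span_pair hf b]
  rfl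

lemma cycleMultiplicity_span_singleton (a : 𝒪) (P : PrimeSpectrum 𝒪) :
    cycleMultiplicity (Ideal.span {a}) P = ordAt P a := by
  rw [cycleMultiplicity, Ideal.map_span, Set.image_singleton]
  rfl

lemma curveIntersection_branch {s : 𝒪} (hs : Prime s) {u : (Fin 2 → ℂ) → ℂ}
    (hu : AnalyticAt ℂ u 0) : curveIntersection (branch s) u = interMult s (germ u hu) := by
  rw [curveIntersection, branch_asIdeal hs, idealOf_singleton hu, ← Ideal.span_insert]
  rfl

lemma toNat_multiset_sum {α : Type*} {M : Multiset α} {c : α → ℕ∞} (h : ∀ s ∈ M, c s ≠ ⊤) :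
    (M.map c).sum.toNat = (M.map fun s => (c s).toNat).sum := by
  have h1 : M.map c = (M.map fun s => (c s).toNat).map (Nat.cast : ℕ → ℕ∞) := by
    rw [Multiset.map_map]
    exact Multiset.map_congr rfl fun s hs => (ENat.natCast_toNat (h s hs)).symm
  rw [h1, ← Nat.cast_multiset_sum, ENat.toNat_natCast]

variable {b}

/-- The components of the critical locus of `f` are those of the greatest common divisor `R` of its
partial derivatives. -/
lemma components_jacobianIdeal {R B C : 𝒪} (hreg : restr b (germ f hf) ≠ 0)
    (hF0 : evalZero (germ f hf) = 0) (hR1 : dirDeriv (b 1) (germ f hf) = R * B)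
    (hR0 : dirDeriv (b 0) (germ f hf) = R * C) (hBC : IsRelPrime B C) (hR : evalZero R = 0) :
    components (jacobianIdeal f) = branchSet R := by
  have h1 := (interMult_dirDeriv_add_one b hreg hF0).1
  have hne : dirDeriv (b 1) (germ f hf) ≠ 0 := fun h => h1 (by rw [h, map_zero])
  have hJ : ∀ q : 𝒪, q ∣ R → jacobianIdeal f ≤ Ideal.span {q} := by
    intro q hq
    rw [jacobianIdeal_eq_span_pair hf b, hR1, hR0, Ideal.span_le]
    rintro x (rfl | rfl)
    · exact Ideal.mem_span_singleton.2 (hq.mul_right _)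
    · exact Ideal.mem_span_singleton.2 (hq.mul_right _)
  have hmem : ∀ i, dirDeriv (b i) (germ f hf) ∈ jacobianIdeal f := by
    intro i
    rw [jacobianIdeal_eq hf]
    exact Ideal.subset_span ⟨_, rfl⟩
  ext P
  constructor
  · intro hP
    have hRP : R ∈ P.asIdeal := by
      by_contra hRP
      -- otherwise the coprime germs `B` and `C` lie in `P`, so that `P` is the maximal ideal
      have hP1 : R * B ∈ P.asIdeal := hR1 ▸ hP.1.2 (hmem 1)
      have hP0 : R * C ∈ P.asIdeal := hR0 ▸ hP.1.2 (hmem 0)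
      obtain ⟨n, hn⟩ := exists_pow_mem_of_interMult_ne_top (interMult_ne_top hBC) hR
      have hle : Ideal.span {B, C} ≤ P.asIdeal := by
        rw [Ideal.span_le, Set.pair_subset_iff]
        exact ⟨(P.isPrime.mem_or_mem hP1).resolve_left hRP,
          (P.isPrime.mem_or_mem hP0).resolve_left hRP⟩
      exact hRP (P.isPrime.mem_of_pow_mem n (hle hn))
    refine mem_branchSet_of_mem_minimalPrimes ?_ hP hRP (hJ R dvd_rfl)
    rintro rfl
    exact hne (by rw [hR1, zero_mul])
  · rintro ⟨q, ⟨hq, hqR⟩, rfl⟩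
    change (branch q).asIdeal ∈ (jacobianIdeal f).minimalPrimes
    rw [branch_asIdeal hq]
    exact span_singleton_mem_minimalPrimes (hmem 1) hne hq (hJ q hqR)

/-- The components of the relative polar curve are those of the quotient `B` of `∂f/∂z₁` by the
greatest common divisor of the partial derivatives. -/
lemma polarComponents_eq {R B C : 𝒪} (hreg : restr b (germ f hf) ≠ 0)
    (hF0 : evalZero (germ f hf) = 0) (hR1 : dirDeriv (b 1) (germ f hf) = R * B)
    (hR0 : dirDeriv (b 0) (germ f hf) = R * C) (hBC : IsRelPrime B C) :
    polarComponents f b = branchSet B := by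
  have h1 := (interMult_dirDeriv_add_one b hreg hF0).1
  have hne : dirDeriv (b 1) (germ f hf) ≠ 0 := fun h => h1 (by rw [h, map_zero])
  have hBR := isRelPrime_polar_gcd hreg hF0 hR1 hR0 hBC
  have hJ : ∀ {q : 𝒪}, Prime q → (jacobianIdeal f ≤ (branch q).asIdeal ↔
      q ∣ R * C ∧ q ∣ R * B) := by
    intro q hq
    rw [jacobianIdeal_eq_span_pair hf b, Ideal.span_le, Set.pair_subset_iff, SetLike.mem_coe,
      SetLike.mem_coe, mem_branch hq, mem_branch hq, hR1, hR0]
  ext P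
  have hP : P ∈ polarComponents f b ↔
      P ∈ branchSet (R * B) ∧ ¬ jacobianIdeal f ≤ P.asIdeal := by
    rw [← hR1, ← mem_minimalPrimes_span_singleton hne, ← polarIdeal_eq hf b]
    rfl
  rw [hP]
  constructor
  · rintro ⟨⟨q, ⟨hq, hqd⟩, rfl⟩, h⟩
    rw [hJ hq] at h
    refine ⟨q, ⟨hq, (hq.dvd_or_dvd hqd).resolve_left fun hqR => h ?_⟩, rfl⟩
    exact ⟨hqR.mul_right _, hqR.mul_right _⟩
  · rintro ⟨q, ⟨hq, hqB⟩, rfl⟩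
    refine ⟨⟨q, ⟨hq, hqB.mul_left _⟩, rfl⟩, fun h => ?_⟩
    rw [hJ hq] at h
    rcases hq.dvd_or_dvd h.1 with h2 | h2
    · exact hq.not_isUnit (hBR hqB h2)
    · exact hq.not_isUnit (hBC hqB h2)

/-- The Lê number is a single intersection multiplicity: the polar curve is the divisor of `B`, with
multiplicities. -/
lemma leNumberZero_eq {R B C : 𝒪} (hreg : restr b (germ f hf) ≠ 0)
    (hF0 : evalZero (germ f hf) = 0) (hR1 : dirDeriv (b 1) (germ f hf) = R * B)
    (hR0 : dirDeriv (b 0) (germ f hf) = R * C) (hBC : IsRelPrime B C) :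
    leNumberZero f b = interMult B (dirDeriv (b 0) (germ f hf)) := by
  have h1 := (interMult_dirDeriv_add_one b hreg hF0).1
  have hne : R * B ≠ 0 := fun h => h1 (by rw [hR1, h, map_zero])
  have hR := left_ne_zero_of_mul hne
  have hB := right_ne_zero_of_mul hne
  have hBR := isRelPrime_polar_gcd hreg hF0 hR1 hR0 hBC
  rw [leNumberZero, polarComponents_eq hf hreg hF0 hR1 hR0 hBC, interMult_eq_sum_factors hB,
    polarIdeal_eq hf b, hR1]
  have h2 : ∀ P ∈ branchSet B, cycleMultiplicity (Ideal.span {R * B}) P *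
      curveIntersection P (partialDeriv f b 0) =
        (ordAt P B).toNat • curveIntersection P (partialDeriv f b 0) := by
    intro P hP
    have hPR : R ∉ P.asIdeal := by
      obtain ⟨q, ⟨hq, hqB⟩, rfl⟩ := hP
      rw [mem_branch hq]
      exact fun h => hq.not_isUnit (hBR hqB h)
    rw [cycleMultiplicity_span_singleton, ordAt_mul P hR, ordAt_eq_zero hPR, zero_add,
      nsmul_eq_mul, ENat.natCast_toNat (ordAt_ne_top hB hP)]
  rw [finsum_mem_congr rfl h2, finsum_ordAt_nsmul hB]
  congr 1
  refine Multiset.map_congr rfl fun s hs => ?_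
  rw [dirDeriv_germ]
  exact curveIntersection_branch (UniqueFactorizationMonoid.prime_of_factor s hs)
    (hf.dirDeriv (b 0))

/-- The generic transversal Milnor number along a component of the critical locus is the
multiplicity of that component in `R`. -/
lemma nearbyMilnorNumber_eq_ordAt {R B C : 𝒪} (hreg : restr b (germ f hf) ≠ 0)
    (hF0 : evalZero (germ f hf) = 0) (hR1 : dirDeriv (b 1) (germ f hf) = R * B)
    (hR0 : dirDeriv (b 0) (germ f hf) = R * C) (hBC : IsRelPrime B C)
    {P : PrimeSpectrum 𝒪} (hP : P ∈ branchSet R) : nearbyMilnorNumber f P = ordAt P R := by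
  obtain ⟨q, ⟨hq, hqR⟩, rfl⟩ := hP
  have hqF := dvd_of_dvd_gcd hreg hF0 hR1 hR0 hq hqR
  have hF : germ f hf ≠ 0 := fun h => hreg (by rw [h, map_zero])
  obtain ⟨m, K, hK, hFK⟩ := WfDvdMonoid.max_power_factor hF hq.irreducible
  obtain _ | m := m
  · rw [pow_zero, one_mul] at hFK
    exact absurd (hFK ▸ hqF) hK
  obtain ⟨R', rfl, hR', -, -⟩ := polar_factor hreg hR1 hR0 hBC hq hFK hK
  rw [ordAt_branch_pow_mul hq hR',
    nearbyMilnorNumber_branch hf hq (restr_ne_zero_of_dvd b hqF hreg) hK hFK]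

/-- The beta invariant in terms of the part `B = 0` of the polar curve outside the critical locus
`R = 0`: the difference of the intersection multiplicities of `f` with `B` and with `z₀`, corrected
by the number of prime factors of `R`. -/
theorem betaFinite_and_beta_eq {R B C : 𝒪} (hreg : restr b (germ f hf) ≠ 0)
    (hF0 : evalZero (germ f hf) = 0) (hR1 : dirDeriv (b 1) (germ f hf) = R * B)
    (hR0 : dirDeriv (b 0) (germ f hf) = R * C) (hBC : IsRelPrime B C) (hR : evalZero R = 0) :
    BetaFinite f b ∧ interMult (germ f hf) B ≠ ⊤ ∧
      beta f b = ((interMult (germ f hf) B).toNat : ℤ) -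
        ((interMult (germ f hf) (coordGerm b 0)).toNat : ℤ) + 1 +
        ((UniqueFactorizationMonoid.factors R).card : ℤ) := by
  obtain ⟨h1, h1'⟩ := interMult_dirDeriv_add_one b hreg hF0
  have hne : R * B ≠ 0 := fun h => h1 (by rw [hR1, h, map_zero])
  have hRne := left_ne_zero_of_mul hne
  have hBne := right_ne_zero_of_mul hne
  have hBR := isRelPrime_polar_gcd hreg hF0 hR1 hR0 hBC
  have hBf0 : IsRelPrime B (dirDeriv (b 0) (germ f hf)) := hR0 ▸ hBR.mul_right hBC
  have hfin0 := interMult_ne_top hBf0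
  have hregR : restr b R ≠ 0 := restr_ne_zero_of_dvd b (hR1 ▸ dvd_mul_right R B) h1
  have hregB : restr b B ≠ 0 := restr_ne_zero_of_dvd b (hR1 ▸ dvd_mul_left B R) h1
  have hchain := interMult_chain b hregB (hR1 ▸ dvd_mul_left B R) hF0
  rw [interMult_comm _ B, interMult_comm _ B, interMult_comm _ B] at hchain
  have hfinBx := interMult_coordGerm_zero_ne_top b hregB
  have hfinRx := interMult_coordGerm_zero_ne_top b hregR
  have hcomp := components_jacobianIdeal hf hreg hF0 hR1 hR0 hBC hR
  have hnear := fun P hP => nearbyMilnorNumber_eq_ordAt hf hreg hF0 hR1 hR0 hBC (P := P) hP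
  have hcurve : ∀ s : 𝒪, Prime s →
      curveIntersection (branch s) (b.coord 0) = interMult s (coordGerm b 0) := fun s hs =>
    curveIntersection_branch hs ((coordL b 0).analyticAt 0)
  have hle := leNumberZero_eq hf hreg hF0 hR1 hR0 hBC
  have hfs : ∀ s ∈ UniqueFactorizationMonoid.factors R, interMult s (coordGerm b 0) ≠ ⊤ :=
    fun s hs => interMult_coordGerm_zero_ne_top b
      (restr_ne_zero_of_dvd b (UniqueFactorizationMonoid.dvd_of_mem_factors hs) hregR)
  -- the sum over the components of the critical locus is the intersection multiplicity of `R` with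
  -- `z₀`, less the number of prime factors of `R`
  have hsum : ∑ᶠ P ∈ components (jacobianIdeal f), ((nearbyMilnorNumber f P).toNat : ℤ) *
      (((curveIntersection P (b.coord 0)).toNat : ℤ) - 1) =
      ((interMult R (coordGerm b 0)).toNat : ℤ) -
        ((UniqueFactorizationMonoid.factors R).card : ℤ) := by
    rw [hcomp, finsum_mem_congr rfl (g := fun P => (ordAt P R).toNat •
      (((curveIntersection P (b.coord 0)).toNat : ℤ) - 1)) fun P hP => by
        rw [hnear P hP, nsmul_eq_mul], finsum_ordAt_nsmul hRne, interMult_eq_sum_factors hRne,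
      toNat_multiset_sum hfs, Multiset.map_congr rfl (g := fun s =>
        ((interMult s (coordGerm b 0)).toNat : ℤ) - 1) fun s hs => by
          rw [hcurve s (UniqueFactorizationMonoid.prime_of_factor s hs)],
      Multiset.sum_map_sub, Nat.cast_multiset_sum, Multiset.map_map]
    simp
  refine ⟨⟨?_, ?_, ?_, ?_⟩, ?_, ?_⟩
  · rw [polarComponents_eq hf hreg hF0 hR1 hR0 hBC]
    exact branchSet_finite hBne
  · rw [hle]
    exact hfin0
  · rw [hcomp]
    exact branchSet_finite hRne
  · intro P hP
    rw [hcomp] at hP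
    refine ⟨by rw [hnear P hP]; exact ordAt_ne_top hRne hP, ?_⟩
    obtain ⟨q, ⟨hq, hqR⟩, rfl⟩ := hP
    rw [hcurve q hq]
    exact interMult_coordGerm_zero_ne_top b (restr_ne_zero_of_dvd b hqR hregR)
  · rw [interMult_comm, hchain]
    exact WithTop.add_ne_top.2 ⟨hfin0, hfinBx⟩
  -- the Lê number is `(f · B) - (z₀ · B)` by the chain rule, and `(z₀ · B) + (z₀ · R) = (z₀ · f) - 1`
  -- because `∂f/∂z₁ = R B`
  · rw [beta, hsum, hle, interMult_comm _ B, hchain, ← h1', hR1, interMult_mul_left]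
    lift interMult B (dirDeriv (b 0) (germ f hf)) to ℕ using hfin0 with n1
    lift interMult B (coordGerm b 0) to ℕ using hfinBx with n2
    lift interMult R (coordGerm b 0) to ℕ using hfinRx with n3
    have e1 : (n1 : ℕ∞) + n2 = ((n1 + n2 : ℕ) : ℕ∞) := by push_cast; rfl
    have e2 : (n3 : ℕ∞) + n2 + 1 = ((n3 + n2 + 1 : ℕ) : ℕ∞) := by push_cast; rfl
    rw [e1, e2]
    simp only [ENat.toNat_natCast]
    push_cast
    ring

end Beta

/-! ### The beta invariant of a product `g ^ p * h` -/

section Main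

local notation "𝒪" => AnalyticGerm (Fin 2 → ℂ)

variable {b : Module.Basis (Fin 2) ℂ (Fin 2 → ℂ)}

/-- Every germ that is regular in the given coordinates has a polar decomposition. -/
lemma exists_polar_decomposition {F : 𝒪} (hreg : restr b F ≠ 0) (hF0 : evalZero F = 0) :
    ∃ R B C : 𝒪, dirDeriv (b 1) F = R * B ∧ dirDeriv (b 0) F = R * C ∧ IsRelPrime B C := by
  have h1 := (interMult_dirDeriv_add_one b hreg hF0).1
  obtain ⟨B, C, R, hBC, h, h'⟩ := UniqueFactorizationMonoid.exists_reduced_factors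
    (dirDeriv (b 1) F) (fun h => h1 (by rw [h, map_zero])) (dirDeriv (b 0) F)
  exact ⟨R, B, C, h.symm, h'.symm, hBC⟩

/-- The gcd of the partial derivatives of `g ^ (n + 1) * h`, `n > 0`, is not a unit. -/
lemma evalZero_gcd_eq_zero {F R B C g h : 𝒪} {n : ℕ} (hn : n ≠ 0) (hreg : restr b F ≠ 0)
    (hR1 : dirDeriv (b 1) F = R * B) (hR0 : dirDeriv (b 0) F = R * C) (hBC : IsRelPrime B C)
    (hg : Prime g) (hgh : ¬ g ∣ h) (hF : F = g ^ (n + 1) * h) : evalZero R = 0 := by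
  obtain ⟨R', rfl, -, -, -⟩ := polar_factor hreg hR1 hR0 hBC hg hF hgh
  rw [map_mul, map_pow, not_isUnit_iff_evalZero.1 hg.not_isUnit, zero_pow hn, zero_mul]

variable {f : (Fin 2 → ℂ) → ℂ} (hf : AnalyticAt ℂ f 0) {g h : 𝒪} {n : ℕ}

/-- The beta invariant of `g ^ (n + 1) * h` for `h` squarefree, where the polar decomposition is
explicit. -/
lemma beta_eq_of_squarefree (hn : n ≠ 0) (hreg : restr b (germ f hf) ≠ 0) (hg : Prime g)
    (hgh : ¬ g ∣ h) (hF : germ f hf = g ^ (n + 1) * h)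
    (hsq : ∀ q k, Prime q → h = q * k → ¬ q ∣ k) :
    (n + 1 : ℕ) * (interMult g h + interMult (dirDeriv (b 1) g) g) +
        (interMult g h + interMult (dirDeriv (b 1) h) h) ≠ ⊤ ∧
      beta f b = ((((n + 1 : ℕ) : ℕ∞) * (interMult g h + interMult (dirDeriv (b 1) g) g) +
        (interMult g h + interMult (dirDeriv (b 1) h) h)).toNat : ℤ) -
        ((interMult (germ f hf) (coordGerm b 0)).toNat : ℤ) + 1 + n := by
  have hF0 : evalZero (germ f hf) = 0 := by
    rw [hF]
    simp [not_isUnit_iff_evalZero.1 hg.not_isUnit]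
  have hd := fun v => dirDeriv_pow_mul v g h n
  rw [← hF] at hd
  have hrel := isRelPrime_polar_of_reduced (hF ▸ hreg) hg hgh hsq
  have hR := evalZero_gcd_eq_zero hn hreg (hd (b 1)) (hd (b 0)) hrel hg hgh hF
  obtain ⟨-, h1, h2⟩ := betaFinite_and_beta_eq hf hreg hF0 (hd (b 1)) (hd (b 0)) hrel hR
  rw [card_factors_prime_pow hg] at h2
  have h3 := interMult_polar (b := b) (g := g) (h := h) (n := n)
  rw [← hF] at h3
  rw [h3] at h1 h2
  exact ⟨h1, h2⟩

/-- The beta invariant of `g ^ (n + 1) * h` for `h` a nonunit with coprime partial derivatives. -/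
lemma beta_eq_of_isRelPrime_dirDeriv (hn : n ≠ 0) (hreg : restr b (germ f hf) ≠ 0) (hg : Prime g)
    (hgh : ¬ g ∣ h) (hF : germ f hf = g ^ (n + 1) * h) (hh0 : evalZero h = 0)
    (hh : IsRelPrime (dirDeriv (b 0) h) (dirDeriv (b 1) h)) :
    beta f b = ((n + 1 : ℕ) + 1) * ((interMult g h).toNat : ℤ) +
      (n + 1 : ℕ) * ((interMult (dirDeriv (b 0) g) (dirDeriv (b 1) g)).toNat : ℤ) +
      ((interMult (dirDeriv (b 0) h) (dirDeriv (b 1) h)).toNat : ℤ) - 1 := by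
  obtain ⟨-, h1⟩ := beta_eq_of_squarefree hf hn hreg hg hgh hF
    fun q k hq hk => not_sq_dvd_of_isRelPrime_dirDeriv hh hq hk
  have hgreg : restr b g ≠ 0 :=
    restr_ne_zero_of_dvd b (hF ▸ (dvd_pow_self g n.succ_ne_zero).mul_right h) hreg
  have hhreg : restr b h ≠ 0 := restr_ne_zero_of_dvd b (hF ▸ dvd_mul_left h _) hreg
  have hg0 := not_isUnit_iff_evalZero.1 hg.not_isUnit
  have hV := interMult_ne_top (hg.irreducible.isRelPrime_iff_not_dvd.2 hgh)
  have hμg := interMult_ne_top (isRelPrime_dirDeriv_of_prime hgreg hg)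
  have hμh := interMult_ne_top hh
  have hgx := interMult_coordGerm_zero_ne_top b hgreg
  have hhx := interMult_coordGerm_zero_ne_top b hhreg
  have hTg := interMult_dirDeriv_self b hgreg hg0
  have hTh := interMult_dirDeriv_self b hhreg hh0
  have hFx := interMult_pow_mul_left g h (coordGerm b 0) (n + 1)
  rw [h1, hF, hFx]
  clear h1 hFx
  lift interMult g h to ℕ using hV with V
  lift interMult (dirDeriv (b 0) g) (dirDeriv (b 1) g) to ℕ using hμg with μg
  lift interMult (dirDeriv (b 0) h) (dirDeriv (b 1) h) to ℕ using hμh with μh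
  lift interMult g (coordGerm b 0) to ℕ using hgx with xg
  lift interMult h (coordGerm b 0) to ℕ using hhx with xh
  have e1 : interMult (dirDeriv (b 1) g) g ≠ ⊤ := fun h => by
    rw [h, top_add] at hTg
    exact WithTop.top_ne_coe hTg
  have e2 : interMult (dirDeriv (b 1) h) h ≠ ⊤ := fun h => by
    rw [h, top_add] at hTh
    exact WithTop.top_ne_coe hTh
  lift interMult (dirDeriv (b 1) g) g to ℕ using e1 with tg
  lift interMult (dirDeriv (b 1) h) h to ℕ using e2 with th
  have hTg' : tg + 1 = μg + xg := by exact_mod_cast hTg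
  have hTh' : th + 1 = μh + xh := by exact_mod_cast hTh
  have e3 : (((n + 1 : ℕ) : ℕ∞) * (V + tg) + (V + th)) =
    (((n + 1) * (V + tg) + (V + th) : ℕ) : ℕ∞) := by push_cast; rfl
  have e4 : (((n + 1 : ℕ) : ℕ∞) * xg + xh) = (((n + 1) * xg + xh : ℕ) : ℕ∞) := by push_cast; rfl
  rw [e3, e4]
  simp only [ENat.toNat_natCast]
  have hTg'' : (tg : ℤ) + 1 = μg + xg := by exact_mod_cast hTg'
  have hTh'' : (th : ℤ) + 1 = μh + xh := by exact_mod_cast hTh'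
  push_cast
  linear_combination ((n : ℤ) + 1) * hTg'' + hTh''

/-- The beta invariant of `g ^ (n + 1) * h` for `h` a unit. -/
lemma beta_eq_of_isUnit (hn : n ≠ 0) (hreg : restr b (germ f hf) ≠ 0) (hg : Prime g)
    (hF : germ f hf = g ^ (n + 1) * h) (hh : IsUnit h) :
    beta f b =
      (n + 1 : ℕ) * ((interMult (dirDeriv (b 0) g) (dirDeriv (b 1) g)).toNat : ℤ) := by
  have hgh : ¬ g ∣ h := fun hd => hg.not_isUnit (isUnit_of_dvd_unit hd hh)
  obtain ⟨-, h1⟩ := beta_eq_of_squarefree hf hn hreg hg hgh hF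
    fun q k hq hk _ => hq.not_isUnit (isUnit_of_dvd_unit (Dvd.intro k hk.symm) hh)
  have hgreg : restr b g ≠ 0 :=
    restr_ne_zero_of_dvd b (hF ▸ (dvd_pow_self g n.succ_ne_zero).mul_right h) hreg
  have hg0 := not_isUnit_iff_evalZero.1 hg.not_isUnit
  have hμg := interMult_ne_top (isRelPrime_dirDeriv_of_prime hgreg hg)
  have hgx := interMult_coordGerm_zero_ne_top b hgreg
  have hTg := interMult_dirDeriv_self b hgreg hg0
  have hFx := interMult_pow_mul_left g h (coordGerm b 0) (n + 1)
  rw [h1, hF, hFx, interMult_eq_zero_of_isUnit_right hh, interMult_eq_zero_of_isUnit_right hh,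
    interMult_eq_zero_of_isUnit_left hh]
  clear h1 hFx
  lift interMult (dirDeriv (b 0) g) (dirDeriv (b 1) g) to ℕ using hμg with μg
  lift interMult g (coordGerm b 0) to ℕ using hgx with xg
  have e1 : interMult (dirDeriv (b 1) g) g ≠ ⊤ := fun h => by
    rw [h, top_add] at hTg
    exact WithTop.top_ne_coe hTg
  lift interMult (dirDeriv (b 1) g) g to ℕ using e1 with tg
  have e3 : (((n + 1 : ℕ) : ℕ∞) * (0 + tg) + (0 + 0)) = (((n + 1) * tg : ℕ) : ℕ∞) := by
    push_cast; ring
  have e4 : (((n + 1 : ℕ) : ℕ∞) * xg + 0) = (((n + 1) * xg : ℕ) : ℕ∞) := by push_cast; ring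
  rw [e3, e4]
  simp only [ENat.toNat_natCast]
  have hTg' : (tg : ℤ) + 1 = μg + xg := by exact_mod_cast hTg
  push_cast
  linear_combination ((n : ℤ) + 1) * hTg'

/-- If `h` is not a unit, then the beta invariant of `g ^ (n + 1) * h` is positive: the polar curve
meets `f = 0` with at least the multiplicity of `f` along `z₀ = 0`. -/
lemma beta_pos_of_evalZero_eq_zero (hn : n ≠ 0) (hreg : restr b (germ f hf) ≠ 0) (hg : Prime g)
    (hgh : ¬ g ∣ h) (hF : germ f hf = g ^ (n + 1) * h) (hh0 : evalZero h = 0) :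
    0 < beta f b := by
  have hF0 : evalZero (germ f hf) = 0 := by
    rw [hF]
    simp [hh0]
  obtain ⟨R, B, C, hR1, hR0, hBC⟩ := exists_polar_decomposition hreg hF0
  have hR := evalZero_gcd_eq_zero hn hreg hR1 hR0 hBC hg hgh hF
  obtain ⟨-, h1, h2⟩ := betaFinite_and_beta_eq hf hreg hF0 hR1 hR0 hBC hR
  have hh : h ≠ 0 := fun h => hgh (h ▸ dvd_zero _)
  obtain ⟨q, hq, hqh⟩ := WfDvdMonoid.exists_irreducible_factor (not_isUnit_iff_evalZero.2 hh0) hh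
  have hle := interMult_coordGerm_le_interMult_polar hreg hF0 hR1 hR0 hBC hg
    (hF ▸ (dvd_pow_self g n.succ_ne_zero).mul_right h)
    (UniqueFactorizationMonoid.irreducible_iff_prime.1 hq) (hF ▸ hqh.mul_left _)
    (fun hgq => hgh (hgq.dvd.trans hqh))
  have hle' := ENat.toNat_le_toNat hle h1
  rw [h2]
  omega

/-- If `dg ≠ 0` and `h ≠ 0` at the origin, then the critical locus of `g ^ (n + 1) * h`, `n > 0`,
is the smooth hypersurface `g = 0`. -/
lemma isSmoothAtOrigin_criticalLocus {E : Type*} [NormedAddCommGroup E] [NormedSpace ℂ E]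
    {d : ℕ} (hE : 1 + d = Module.finrank ℂ E) {f g h : E → ℂ} {n : ℕ} (hn : n ≠ 0)
    (hg : AnalyticAt ℂ g 0) (hh : AnalyticAt ℂ h 0) (hg0 : g 0 = 0) (hh0 : h 0 ≠ 0)
    (hdg : fderiv ℂ g 0 ≠ 0) (hf : ∀ᶠ z in 𝓝 0, f z = g z ^ (n + 1) * h z) :
    IsSmoothAtOrigin (criticalLocus f) d := by
  have hd : HasFDerivAt (fun z (_ : Fin 1) => g z)
      (ContinuousLinearMap.pi fun _ : Fin 1 => fderiv ℂ g 0) 0 :=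
    hasFDerivAt_pi.2 fun _ => hg.differentiableAt.hasFDerivAt
  refine ⟨1, hE, fun z _ => g z, ?_, ?_, ?_, ?_⟩
  · exact AnalyticAt.pi fun _ => hg
  · ext
    exact hg0
  · rw [hd.fderiv]
    intro y
    obtain ⟨v, hv⟩ : ∃ v, fderiv ℂ g 0 v ≠ 0 := by
      by_contra! H
      exact hdg (ContinuousLinearMap.ext H)
    refine ⟨(y 0 / fderiv ℂ g 0 v) • v, ?_⟩
    ext i
    obtain rfl : i = 0 := Subsingleton.elim _ _
    simp [hv]
  · -- `df = g ^ n * ((n + 1) h dg + g dh)`, and the second factor does not vanish near the origin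
    have hcont : ContinuousAt (fun z => ((n + 1 : ℕ) * h z) • fderiv ℂ g z + g z • fderiv ℂ h z) 0 :=
      ((continuousAt_const.mul hh.continuousAt).smul hg.fderiv.continuousAt).add
        (hg.continuousAt.smul hh.fderiv.continuousAt)
    have hne : ∀ᶠ z in 𝓝 (0 : E),
        ((n + 1 : ℕ) * h z) • fderiv ℂ g z + g z • fderiv ℂ h z ≠ 0 := by
      refine hcont.eventually_ne ?_
      have h0 : g 0 • fderiv ℂ h 0 = 0 := by
        rw [hg0]
        ext v
        simp
      rw [h0, add_zero]
      exact smul_ne_zero (mul_ne_zero (Nat.cast_ne_zero.2 n.succ_ne_zero) hh0) hdg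
    filter_upwards [hne, hf.eventually_nhds, hg.eventually_analyticAt, hh.eventually_analyticAt]
      with z h1 h2 h3 h4
    have h5 : fderiv ℂ f z =
        g z ^ n • (((n + 1 : ℕ) * h z) • fderiv ℂ g z + g z • fderiv ℂ h z) := by
      have h6 : f =ᶠ[𝓝 z] fun z => g z ^ (n + 1) * h z := h2
      rw [h6.fderiv_eq]
      refine HasFDerivAt.fderiv ?_
      refine ((h3.differentiableAt.hasFDerivAt.pow (n + 1)).mul
        h4.differentiableAt.hasFDerivAt).congr_fderiv ?_
      ext v
      simp
      ring
    change fderiv ℂ f z = 0 ↔ _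
    rw [h5]
    constructor
    · intro h
      ext
      exact (pow_eq_zero_iff hn).1 ((smul_eq_zero.1 h).resolve_right h1)
    · intro h
      have h0 : g z = 0 := congrFun h 0
      rw [h0, zero_pow hn]
      ext v
      simp

/-- A germ with Milnor number zero has no critical point at the origin. -/
lemma fderiv_ne_zero_of_interMult_eq_zero {g : (Fin 2 → ℂ) → ℂ} (hg : AnalyticAt ℂ g 0)
    (h : interMult (dirDeriv (b 0) (germ g hg)) (dirDeriv (b 1) (germ g hg)) = 0) :
    fderiv ℂ g 0 ≠ 0 := by
  intro hd
  have h1 : ∀ v, ¬ IsUnit (dirDeriv v (germ g hg)) := fun v => by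
    rw [not_isUnit_iff_evalZero, dirDeriv_germ, evalZero_germ, hd]
    rfl
  have := one_le_interMult (h1 (b 0)) (h1 (b 1))
  rw [h] at this
  simp at this

end Main

end BetaInvariant

end

theorem mainTheorem5
    (U : Set (Fin 2 → ℂ)) (hU : IsOpen U) (h0U : (0 : Fin 2 → ℂ) ∈ U)
    (f g h : (Fin 2 → ℂ) → ℂ) (hg : AnalyticOnNhd ℂ g U) (hh : AnalyticOnNhd ℂ h U)
    (p : ℕ) (hp : 1 < p)
    (hf : ∀ z ∈ U, f z = g z ^ p * h z)
    (hg0 : g 0 = 0)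
    (hirr : Irreducible (BetaInvariant.germ g (hg 0 h0U)))
    (hdvd : ¬ BetaInvariant.germ g (hg 0 h0U) ∣ BetaInvariant.germ h (hh 0 h0U)) :
    BetaInvariant.milnorNumber g ≠ ⊤ ∧
    BetaInvariant.intersectionNumber g h ≠ ⊤ ∧
    (∃ b : Module.Basis (Fin 2) ℂ (Fin 2 → ℂ), BetaInvariant.IsAdmissible f b) ∧
    ∀ b : Module.Basis (Fin 2) ℂ (Fin 2 → ℂ), BetaInvariant.IsAdmissible f b →
      BetaInvariant.BetaFinite f b ∧
      (h 0 = 0 → BetaInvariant.milnorNumber h ≠ ⊤ →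
        BetaInvariant.beta f b =
          ((p : ℤ) + 1) * ((BetaInvariant.intersectionNumber g h).toNat : ℤ)
            + (p : ℤ) * ((BetaInvariant.milnorNumber g).toNat : ℤ)
            + ((BetaInvariant.milnorNumber h).toNat : ℤ) - 1) ∧
      (h 0 ≠ 0 →
        BetaInvariant.beta f b = (p : ℤ) * ((BetaInvariant.milnorNumber g).toNat : ℤ)) ∧
      (BetaInvariant.beta f b = 0 →
        BetaInvariant.IsSmoothAtOrigin (BetaInvariant.criticalLocus f) 1) := by
  have hga := hg 0 h0U
  have hha := hh 0 h0U
  have hev : ∀ᶠ z in 𝓝 (0 : Fin 2 → ℂ), f z = g z ^ p * h z :=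
    Filter.mem_of_superset (hU.mem_nhds h0U) hf
  have hfa : AnalyticAt ℂ f 0 := ((hga.pow p).mul hha).congr (hev.mono fun z hz => hz.symm)
  obtain ⟨n, rfl⟩ : ∃ n, p = n + 1 := ⟨p - 1, by omega⟩
  have hn : n ≠ 0 := by omega
  have hF : BetaInvariant.germ f hfa =
      BetaInvariant.germ g hga ^ (n + 1) * BetaInvariant.germ h hha := by
    rw [BetaInvariant.germ_pow, BetaInvariant.germ_mul]
    exact BetaInvariant.germ_eq_iff.2 hev
  have hgp : Prime (BetaInvariant.germ g hga) := UniqueFactorizationMonoid.irreducible_iff_prime.1 hirr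
  have hh0 : BetaInvariant.germ h hha ≠ 0 := fun h => hdvd (h ▸ dvd_zero _)
  have hF0 : BetaInvariant.germ f hfa ≠ 0 := by
    rw [hF]
    exact mul_ne_zero (pow_ne_zero _ hgp.ne_zero) hh0
  have hFz : BetaInvariant.evalZero (BetaInvariant.germ f hfa) = 0 := by
    rw [BetaInvariant.evalZero_germ, hev.self_of_nhds, hg0]
    simp
  have hV : BetaInvariant.intersectionNumber g h =
      BetaInvariant.interMult (BetaInvariant.germ g hga) (BetaInvariant.germ h hha) := by
    rw [BetaInvariant.intersectionNumber, BetaInvariant.idealOf_pair hga hha]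
    rfl
  refine ⟨?_, ?_, ?_, ?_⟩
  · obtain ⟨b, hb⟩ := BetaInvariant.exists_basis_restr_ne_zero hgp.ne_zero
    rw [BetaInvariant.milnorNumber_eq_interMult hga b]
    exact BetaInvariant.interMult_ne_top (BetaInvariant.isRelPrime_dirDeriv_of_prime hb hgp)
  · rw [hV]
    exact BetaInvariant.interMult_ne_top (hirr.isRelPrime_iff_not_dvd.2 hdvd)
  · obtain ⟨b, hb⟩ := BetaInvariant.exists_basis_restr_ne_zero hF0
    refine ⟨b, (BetaInvariant.isAdmissible_iff hfa b).2 ⟨?_, ?_⟩⟩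
    · exact (BetaInvariant.ord_dirDeriv_add_one hb (by rw [BetaInvariant.evalZero_restr, hFz])).1
    · rw [← BetaInvariant.restr_dirDeriv, BetaInvariant.evalZero_restr, hF,
        BetaInvariant.dirDeriv_pow_mul, map_mul, map_pow, BetaInvariant.evalZero_germ, hg0,
        zero_pow hn, zero_mul]
  intro b hb
  have hreg : BetaInvariant.restr b (BetaInvariant.germ f hfa) ≠ 0 := fun h =>
    ((BetaInvariant.isAdmissible_iff hfa b).1 hb).1 (by rw [h, map_zero])
  rw [hV, BetaInvariant.milnorNumber_eq_interMult hga b,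
    BetaInvariant.milnorNumber_eq_interMult hha b]
  have hunit : h 0 ≠ 0 → IsUnit (BetaInvariant.germ h hha) := fun h0 =>
    BetaInvariant.isUnit_iff_evalZero.2 h0
  refine ⟨?_, fun h0 hμ => ?_, fun h0 => ?_, fun hβ => ?_⟩
  · obtain ⟨R, B, C, hR1, hR0, hBC⟩ := BetaInvariant.exists_polar_decomposition hreg hFz
    exact (BetaInvariant.betaFinite_and_beta_eq hfa hreg hFz hR1 hR0 hBC
      (BetaInvariant.evalZero_gcd_eq_zero hn hreg hR1 hR0 hBC hgp hdvd hF)).1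
  · exact BetaInvariant.beta_eq_of_isRelPrime_dirDeriv hfa hn hreg hgp hdvd hF h0
      (BetaInvariant.interMult_ne_top_iff.1 hμ)
  · exact BetaInvariant.beta_eq_of_isUnit hfa hn hreg hgp hF (hunit h0)
  · have h0 : h 0 ≠ 0 := fun h0 => (BetaInvariant.beta_pos_of_evalZero_eq_zero hfa hn hreg hgp hdvd
      hF h0).ne' hβ
    rw [BetaInvariant.beta_eq_of_isUnit hfa hn hreg hgp hF (hunit h0)] at hβ
    have hgreg : BetaInvariant.restr b (BetaInvariant.germ g hga) ≠ 0 :=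
      BetaInvariant.restr_ne_zero_of_dvd b (hF ▸ (dvd_pow_self _ n.succ_ne_zero).mul_right _) hreg
    have hμ := BetaInvariant.interMult_ne_top
      (BetaInvariant.isRelPrime_dirDeriv_of_prime hgreg hgp)
    have h1 := (mul_eq_zero.1 hβ).resolve_left (Nat.cast_ne_zero.2 n.succ_ne_zero)
    have h2 := (ENat.toNat_eq_zero.1 (Nat.cast_eq_zero.1 h1)).resolve_right hμ
    exact BetaInvariant.isSmoothAtOrigin_criticalLocus (by simp) hn hga hha hg0 h0
      (BetaInvariant.fderiv_ne_zero_of_interMult_eq_zero hga h2) hev
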